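/- Let $\mathcal W$ be the Weyl group of a finite reduced crystallographic root system $\Delta$ with a chosen base, $\ell$ its length function with respect to the simple reflections, $\le$ its Bruhat order, and $w_0\in\mathcal W$ its longest element. Let $\check Q$ be the coroot lattice, let $k$ be a (commutative) local ring in which $2$ is invertible, and let $S_k=\mathrm{Sym}_k(\check Q\otimes_{\mathbb Z}k)$, graded so that $\check Q\otimes k$ has degree $2$. Modules over $S_k$ are finitely generated and $\mathbb Z$-graded, and their morphisms have degree $0$. The Bruhat graph $\mathcal G$ has vertex set $\mathcal W$, an edge $x\to y$ whenever $x<y$ and $y=s_\alpha x$ for a positive root $\alpha$, and the label of this edge is $l(x\to y)=\check\alpha$. Let $\mathcal G_{w_0}$ be its full subgraph on $\{x\in\mathcal W\mid x\le w_0\}$. A $k$-sheaf $\mathcal F$ on $\mathcal G_{w_0}$ consists of $S_k$-modules $\mathcal F^x$ for the vertices $x$, $S_k$-modules $\mathcal F^E$ with $l(E)\mathcal F^E=0$ for the edges $E$, and morphisms $\rho_{x,E}:\mathcal F^x\to\mathcal F^E$ whenever $x$ is an end point of $E$. For a vertex $x$, let $\mathcal F^{\delta x}\subseteq\bigoplus_{E:x\to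 y}\mathcal F^E$ be the set of all $(\rho_{y,E}(m_y))_{E:x\to y}$, where $(m_y)_{y>x}$ runs over the sections of $\mathcal F$ over $\{y\mid y>x\}$, that is, over the families in $\prod_{y>x}\mathcal F^y$ with $\rho_{y,E}(m_y)=\rho_{z,E}(m_z)$ for all edges $E:y\to z$ with $y,z>x$. A canonical (Braden–MacPherson) sheaf $\mathcal B_{w_0}$ is an indecomposable $k$-sheaf $\mathcal B$ on $\mathcal G_{w_0}$ such that (i) $\mathcal B^{w_0}\cong S_k$; (ii) for every edge $E:x\to y$ the map $\rho_{y,E}$ is surjective with kernel $l(E)\mathcal B^y$; (iii) for every vertex $x$ that is the source of an edge, $\bigoplus_{E:x\to y}\rho_{x,E}$ is a projective cover $\mathcal B^x\to\mathcal B^{\delta x}$ in the category of graded $S_k$-modules. Then a canonical sheaf $\mathcal B_{w_0}$ exists, and for every canonical sheaf $\mathcal B_{w_0}$ and every $y\in\mathcal W$ one has $y\le w_0$ and $\mathcal B_{w_0}^y\cong S_k$ as graded $S_k$-modules. -/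

import Mathlib

open scoped TensorProduct DirectSum

noncomputable section

universe u v

/-! ### The graded ring `S_k = Sym(Y ⊗ k)` and its graded modules -/

/-- `S_k = Sym_k(Y_k)`, where `Y_k = k ⊗ Y`. -/
abbrev SymRing (k : Type u) (Y : Type v) [CommRing k] [AddCommGroup Y] : Type (max u v) :=
  SymmetricAlgebra k (k ⊗[ℤ] Y)

namespace SymRing

variable (k : Type u) {Y : Type v} [CommRing k] [AddCommGroup Y]

/-- The image in `S_k` of a lattice element `l ∈ Y`. -/
def ofLattice (l : Y) : SymRing k Y := SymmetricAlgebra.ι k (k ⊗[ℤ] Y) (1 ⊗ₜ[ℤ] l)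

variable (Y)

/-- The `ℤ`-grading of `S_k` with `Y_k` in degree `2`: the piece of degree `2 d` is spanned by the
products of `d` elements of `Y_k`; odd and negative pieces vanish. -/
def piece (n : ℤ) : Submodule k (SymRing k Y) :=
  if 0 ≤ n ∧ Even n then LinearMap.range (SymmetricAlgebra.ι k (k ⊗[ℤ] Y)) ^ (n / 2).toNat else ⊥

theorem piece_two_mul (d : ℕ) :
    piece k Y (2 * (d : ℤ)) = LinearMap.range (SymmetricAlgebra.ι k (k ⊗[ℤ] Y)) ^ d := by
  have h : (0 : ℤ) ≤ 2 * (d : ℤ) ∧ Even (2 * (d : ℤ)) := ⟨by positivity, even_two_mul _⟩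
  rw [piece, if_pos h]
  congr 1
  omega

theorem piece_eq_bot {n : ℤ} (h : ¬ ∃ d : ℕ, n = 2 * (d : ℤ)) : piece k Y n = ⊥ := by
  rw [piece, if_neg]
  rintro ⟨h0, m, hm⟩
  exact h ⟨m.toNat, by omega⟩

instance gradedMonoid : SetLike.GradedMonoid (piece k Y) where
  one_mem := by
    have := piece_two_mul k Y 0
    simp only [Nat.cast_zero, mul_zero, pow_zero] at this
    rw [this]
    exact Submodule.one_le.mp le_rfl
  mul_mem := by
    intro i j a b ha hb
    by_cases hi : ∃ d : ℕ, i = 2 * (d : ℤ)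
    · by_cases hj : ∃ d : ℕ, j = 2 * (d : ℤ)
      · obtain ⟨d, rfl⟩ := hi
        obtain ⟨e, rfl⟩ := hj
        have h : 2 * (d : ℤ) + 2 * (e : ℤ) = 2 * ((d + e : ℕ) : ℤ) := by push_cast; ring
        rw [h, piece_two_mul, pow_add]
        rw [piece_two_mul] at ha hb
        exact Submodule.mul_mem_mul ha hb
      · rw [piece_eq_bot k Y hj, Submodule.mem_bot] at hb
        subst hb
        simp
    · rw [piece_eq_bot k Y hi, Submodule.mem_bot] at ha
      subst ha
      simp

theorem ι_mem_piece (m : k ⊗[ℤ] Y) : SymmetricAlgebra.ι k (k ⊗[ℤ] Y) m ∈ piece k Y 2 := by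
  have := piece_two_mul k Y 1
  simp only [Nat.cast_one, mul_one, pow_one] at this
  rw [this]
  exact LinearMap.mem_range_self _ m

/-- Auxiliary: `Y_k` as degree two elements of the direct sum of the pieces. -/
def gradedι : (k ⊗[ℤ] Y) →ₗ[k] ⨁ i : ℤ, piece k Y i :=
  DirectSum.lof k ℤ (fun i => piece k Y i) 2 ∘ₗ
    (SymmetricAlgebra.ι k (k ⊗[ℤ] Y)).codRestrict _ (ι_mem_piece k Y)

theorem gradedι_apply (m : k ⊗[ℤ] Y) :
    gradedι k Y m = DirectSum.of (fun i => piece k Y i) 2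
      ⟨SymmetricAlgebra.ι k (k ⊗[ℤ] Y) m, ι_mem_piece k Y m⟩ := rfl

theorem lift_gradedι_pow (d : ℕ) (x : SymRing k Y)
    (hx : x ∈ LinearMap.range (SymmetricAlgebra.ι k (k ⊗[ℤ] Y)) ^ d)
    (hx' : x ∈ piece k Y (2 * (d : ℤ))) :
    SymmetricAlgebra.lift (gradedι k Y) x =
      DirectSum.of (fun i => piece k Y i) (2 * (d : ℤ)) ⟨x, hx'⟩ := by
  induction hx using Submodule.pow_induction_on_left' with
  | algebraMap r =>
    rw [AlgHom.commutes, DirectSum.algebraMap_apply]; rfl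
  | add x y i hx hy ihx ihy =>
    rw [map_add, ihx (by rwa [piece_two_mul]), ihy (by rwa [piece_two_mul]), ← map_add]
    rfl
  | mem_mul m hm i x hx ih =>
    obtain ⟨m, rfl⟩ := hm
    rw [map_mul, ih (by rwa [piece_two_mul]), SymmetricAlgebra.lift_ι_apply, gradedι_apply,
      DirectSum.of_mul_of]
    refine DirectSum.of_eq_of_gradedMonoid_eq (Sigma.subtype_ext ?_ rfl)
    change 2 + 2 * (i : ℤ) = 2 * ((i.succ : ℕ) : ℤ)
    push_cast
    ring

instance gradedAlgebra : GradedAlgebra (piece k Y) :=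
  GradedAlgebra.ofAlgHom _ (SymmetricAlgebra.lift (gradedι k Y))
    (by
      ext m
      change DirectSum.coeAlgHom (piece k Y)
        (SymmetricAlgebra.lift (gradedι k Y) (SymmetricAlgebra.ι k (k ⊗[ℤ] Y) _)) =
          SymmetricAlgebra.ι k (k ⊗[ℤ] Y) _
      rw [SymmetricAlgebra.lift_ι_apply, gradedι_apply, DirectSum.coeAlgHom_of])
    (by
      rintro i ⟨x, hx⟩
      by_cases hi : ∃ d : ℕ, i = 2 * (d : ℤ)
      · obtain ⟨d, rfl⟩ := hi
        exact lift_gradedι_pow k Y d x (by rwa [piece_two_mul] at hx) hx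
      · have h0 := hx
        rw [piece_eq_bot k Y hi, Submodule.mem_bot] at h0
        subst h0
        have : (⟨0, hx⟩ : piece k Y i) = 0 := rfl
        rw [this, map_zero]
        simp)

end SymRing

/-- A finitely generated `ℤ`-graded `S_k`-module. -/
structure GradedMod (k : Type u) (Y : Type v) [CommRing k] [AddCommGroup Y] where
  carrier : Type (max u v)
  [addCommGroup : AddCommGroup carrier]
  [module : Module (SymRing k Y) carrier]
  piece : ℤ → AddSubgroup carrier
  isInternal : DirectSum.IsInternal piece
  smul_mem : ∀ {i j : ℤ} {s : SymRing k Y} {m : carrier},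
    s ∈ SymRing.piece k Y i → m ∈ piece j → s • m ∈ piece (i + j)
  finite : Module.Finite (SymRing k Y) carrier

namespace GradedMod

attribute [instance] GradedMod.addCommGroup GradedMod.module

variable {k : Type u} {Y : Type v} [CommRing k] [AddCommGroup Y]

instance : CoeSort (GradedMod k Y) (Type (max u v)) := ⟨GradedMod.carrier⟩

/-- `S_k` as a graded module over itself. -/
def self (k : Type u) (Y : Type v) [CommRing k] [AddCommGroup Y] : GradedMod k Y where
  carrier := SymRing k Y
  piece i := (SymRing.piece k Y i).toAddSubgroup
  isInternal := DirectSum.Decomposition.isInternal (SymRing.piece k Y)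
  smul_mem hs hm := SetLike.mul_mem_graded hs hm
  finite := inferInstance

/-- Homomorphisms of graded modules (of degree zero). -/
structure Hom (A B : GradedMod k Y) where
  toLinearMap : A →ₗ[SymRing k Y] B
  map_mem : ∀ (i : ℤ) (m : A), m ∈ A.piece i → toLinearMap m ∈ B.piece i

/-- `A ≅ B` as graded modules (the isomorphism being of degree zero). -/
def Isomorphic (A B : GradedMod k Y) : Prop :=
  ∃ e : A ≃ₗ[SymRing k Y] B, ∀ (i : ℤ) (m : A), m ∈ A.piece i ↔ e m ∈ B.piece i

/-- A submodule is graded if it is generated by homogeneous elements. -/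
def IsGraded (A : GradedMod k Y) (N : Submodule (SymRing k Y) A) : Prop :=
  N ≤ Submodule.span (SymRing k Y) {m | m ∈ N ∧ ∃ i, m ∈ A.piece i}

/-- Projectivity in the category of (finitely generated) graded modules. -/
def IsProjective (P : GradedMod k Y) : Prop :=
  ∀ (A B : GradedMod k Y) (g : Hom A B) (f : Hom P B), Function.Surjective g.toLinearMap →
    ∃ h : Hom P A, g.toLinearMap ∘ₗ h.toLinearMap = f.toLinearMap

/-- `f`, viewed as a map from `P` to the submodule `T`, is a projective cover in the category of
graded modules: it maps onto `T`, `P` is projective, and `f` is essential, i.e. the kernel of `f` is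
superfluous among the graded submodules of `P`. -/
def IsProjectiveCover (P : GradedMod k Y) {X : Type*} [AddCommGroup X] [Module (SymRing k Y) X]
    (f : P →ₗ[SymRing k Y] X) (T : Submodule (SymRing k Y) X) : Prop :=
  LinearMap.range f = T ∧ P.IsProjective ∧
    ∀ N : Submodule (SymRing k Y) P, P.IsGraded N → N ⊔ LinearMap.ker f = ⊤ → N = ⊤

end GradedMod

/-! ### Moment graphs and sheaves on them -/

/-- A moment graph on the lattice `Y` with vertex set the poset `V`: a directed graph without
multiple edges, all of whose edges go strictly upwards (so that it has no directed cycles), each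
edge being labelled by a nonzero element of `Y`. -/
structure MomentGraph (Y : Type*) [AddCommGroup Y] (V : Type*) [PartialOrder V] where
  /-- `Edge x y` means that there is an edge `x → y`. -/
  Edge : V → V → Prop
  lt_of_edge : ∀ {x y : V}, Edge x y → x < y
  label : ∀ {x y : V}, Edge x y → Y
  label_ne_zero : ∀ {x y : V} (e : Edge x y), label e ≠ 0

namespace MomentGraph

/-- The full subgraph on a set of vertices. -/
def restrict {Y V : Type*} [AddCommGroup Y] [PartialOrder V] (G : MomentGraph Y V) (I : Set V) :
    MomentGraph Y I where
  Edge x y := G.Edge x y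
  lt_of_edge e := G.lt_of_edge e
  label e := G.label e
  label_ne_zero e := G.label_ne_zero e

variable {Y : Type v} [AddCommGroup Y] {V : Type*} [PartialOrder V]

/-- A `k`-sheaf on a moment graph; for an edge `e : x → y`, `resSource e` and `resTarget e` are the
maps `ρ_{x,e}` and `ρ_{y,e}`. -/
structure Sheaf (k : Type u) [CommRing k] (G : MomentGraph Y V) where
  stalk : V → GradedMod k Y
  edge : ∀ {x y : V}, G.Edge x y → GradedMod k Y
  label_smul : ∀ {x y : V} (e : G.Edge x y) (m : edge e), SymRing.ofLattice k (G.label e) • m = 0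
  resSource : ∀ {x y : V} (e : G.Edge x y), GradedMod.Hom (stalk x) (edge e)
  resTarget : ∀ {x y : V} (e : G.Edge x y), GradedMod.Hom (stalk y) (edge e)

namespace Sheaf

variable {k : Type u} [CommRing k] {G : MomentGraph Y V} (F : Sheaf k G)

/-- The module `Γ(I, F)` of sections over a set of vertices `I`. -/
def sections (I : Set V) : Submodule (SymRing k Y) (∀ x : I, F.stalk x) where
  carrier := {m | ∀ (x y : I) (e : G.Edge x y),
    (F.resSource e).toLinearMap (m x) = (F.resTarget e).toLinearMap (m y)}
  zero_mem' := by intro x y e; simp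
  add_mem' := by
    intro a b ha hb x y e
    simp only [Pi.add_apply, map_add, ha x y e, hb x y e]
  smul_mem' := by
    intro c a ha x y e
    simp only [Pi.smul_apply, map_smul, ha x y e]

/-- The map `∏_{y > x} F^y → ∏_{e : x → y} F^e` given by the restriction maps `ρ_{y,e}`. -/
def upMap (x : V) : (∀ y : Set.Ioi x, F.stalk y) →ₗ[SymRing k Y]
    (∀ y : {y : V // G.Edge x y}, F.edge y.2) :=
  LinearMap.pi fun y =>
    (F.resTarget y.2).toLinearMap ∘ₗ LinearMap.proj (⟨y.1, G.lt_of_edge y.2⟩ : Set.Ioi x)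

/-- `F^{δx}`: the image of `Γ({y | y > x}, F)` under `u_x`. -/
def boundary (x : V) :
    Submodule (SymRing k Y) (∀ y : {y : V // G.Edge x y}, F.edge y.2) :=
  (F.sections (Set.Ioi x)).map (F.upMap x)

/-- The map `d_x : F^x → ∏_{e : x → y} F^e` given by the restriction maps `ρ_{x,e}`. -/
def downMap (x : V) : F.stalk x →ₗ[SymRing k Y] (∀ y : {y : V // G.Edge x y}, F.edge y.2) :=
  LinearMap.pi fun y => (F.resSource y.2).toLinearMap

/-- A subsheaf: graded submodules of all the modules, preserved by the restriction maps. -/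
structure Subsheaf where
  stalk : ∀ x : V, Submodule (SymRing k Y) (F.stalk x)
  edge : ∀ {x y : V} (e : G.Edge x y), Submodule (SymRing k Y) (F.edge e)
  stalk_graded : ∀ x : V, (F.stalk x).IsGraded (stalk x)
  edge_graded : ∀ {x y : V} (e : G.Edge x y), (F.edge e).IsGraded (edge e)
  resSource_mem : ∀ {x y : V} (e : G.Edge x y) (m : F.stalk x), m ∈ stalk x →
    (F.resSource e).toLinearMap m ∈ edge e
  resTarget_mem : ∀ {x y : V} (e : G.Edge x y) (m : F.stalk y), m ∈ stalk y →
    (F.resTarget e).toLinearMap m ∈ edge e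

/-- The zero subsheaf, as a predicate. -/
def Subsheaf.IsZero {F : Sheaf k G} (A : F.Subsheaf) : Prop :=
  (∀ x : V, A.stalk x = ⊥) ∧ ∀ (x y : V) (e : G.Edge x y), A.edge e = ⊥

/-- `F = A ⊕ B` as sheaves. -/
def Subsheaf.IsDecomposition {F : Sheaf k G} (A B : F.Subsheaf) : Prop :=
  (∀ x : V, IsCompl (A.stalk x) (B.stalk x)) ∧
    ∀ (x y : V) (e : G.Edge x y), IsCompl (A.edge e) (B.edge e)

/-- The zero sheaf, as a predicate. -/
def IsZero : Prop :=
  (∀ x : V, Subsingleton (F.stalk x)) ∧ ∀ (x y : V) (e : G.Edge x y), Subsingleton (F.edge e)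

/-- `F` is nonzero and is not a direct sum of two nonzero sheaves. -/
def IsIndecomposable : Prop :=
  ¬ F.IsZero ∧ ∀ A B : F.Subsheaf, A.IsDecomposition B → A.IsZero ∨ B.IsZero

/-- `F` is a canonical (Braden–MacPherson) sheaf on `G`, `w` being the highest vertex of `G`. -/
structure IsCanonical (w : V) : Prop where
  isIndecomposable : F.IsIndecomposable
  stalk_top : (F.stalk w).Isomorphic (GradedMod.self k Y)
  resTarget_surjective : ∀ {x y : V} (e : G.Edge x y),
    Function.Surjective (F.resTarget e).toLinearMap
  /-- The kernel of `ρ_{y,e}` is `l(e) F^y`. -/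
  ker_resTarget : ∀ {x y : V} (e : G.Edge x y) (m : F.stalk y),
    (F.resTarget e).toLinearMap m = 0 ↔
      ∃ n : F.stalk y, m = SymRing.ofLattice k (G.label e) • n
  isProjectiveCover : ∀ x : V, (∃ y, G.Edge x y) →
    (F.stalk x).IsProjectiveCover (F.downMap x) (F.boundary x)

end Sheaf

end MomentGraph

/-! ### The Bruhat graph of a finite Weyl group -/

namespace BruhatGraph

variable {ι K M N : Type*} [Field K] [AddCommGroup M] [Module K M]
  [AddCommGroup N] [Module K N] {P : RootPairing ι K M N}

/-- The Weyl group of `P`; the base `b` is recorded since the length function and the Bruhat order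
depend on it. -/
def Weyl (_b : P.Base) : Type _ := P.weylGroup

instance (b : P.Base) : Group (Weyl b) := inferInstanceAs (Group P.weylGroup)

variable (b : P.Base)

/-- The reflection in the `i`-th root. -/
def refl (i : ι) : Weyl b := RootPairing.weylGroup.ofIdx P i

/-- The length: the least number of factors in an expression as a product of simple reflections. -/
def length (w : Weyl b) : ℕ :=
  sInf {n | ∃ l : List b.support, l.length = n ∧ (l.map fun i => refl b i).prod = w}

/-- The Bruhat order: the reflexive and transitive closure of the relation `x < t x`, for `t` a
reflection with `ℓ(x) < ℓ(t x)`. -/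
def BruhatLE : Weyl b → Weyl b → Prop :=
  Relation.ReflTransGen fun x y => length b x < length b y ∧ ∃ i : ι, y = refl b i * x

theorem BruhatLE.eq_or_length_lt {x y : Weyl b} (h : BruhatLE b x y) :
    x = y ∨ length b x < length b y := by
  induction h with
  | refl => exact Or.inl rfl
  | tail _ h ih =>
    rcases ih with rfl | ih
    · exact Or.inr h.1
    · exact Or.inr (ih.trans h.1)

instance : PartialOrder (Weyl b) where
  le := BruhatLE b
  le_refl _ := Relation.ReflTransGen.refl
  le_trans _ _ _ := Relation.ReflTransGen.trans
  le_antisymm x y hxy hyx := by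
    rcases BruhatLE.eq_or_length_lt b hxy with h | h
    · exact h
    · rcases BruhatLE.eq_or_length_lt b hyx with h' | h'
      · exact h'.symm
      · omega

/-- The coroot lattice, spanned over `ℤ` by the coroots. -/
abbrev CorootLattice (P : RootPairing ι K M N) : Type _ := Submodule.span ℤ (Set.range P.coroot)

/-- The Bruhat moment graph of the Weyl group: there is an edge `x → y` if `x < y` and
`y x⁻¹ = s_α` for a positive root `α`, and its label is the coroot of `α` (when `P` is reduced and
of characteristic zero, `α` is determined by `s_α`). -/
def bruhatGraph [CharZero K] (b : P.Base) : MomentGraph (CorootLattice P) (Weyl b) where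
  Edge x y := x < y ∧ ∃ i : ι, b.IsPos i ∧ y * x⁻¹ = refl b i
  lt_of_edge e := e.1
  label e := ⟨P.coroot e.2.choose, Submodule.subset_span ⟨_, rfl⟩⟩
  label_ne_zero e h := P.flip.ne_zero e.2.choose (congrArg Subtype.val h)

end BruhatGraph

end

/-!
The constant sheaf on the Bruhat graph, with stalks `S = S_k` and with modules `S / (l(E))` on the
edges, is canonical, and a canonical sheaf has stalks `S`. Both claims come down to one statement
about congruences, `BruhatGraph.exists_extension`: a family of elements `m y` of `S`, for `y > x`,
with `m y ≡ m z` modulo the label of every edge between `y` and `z`, extends to `x`, that is, there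
is an element `u` of `S` with `u ≡ m y` modulo the label of every edge from `x` to `y`.

*From congruences to sheaves.* The extension property says that the boundary module of the constant
sheaf at `x` is the image of `S`. This is a projective cover because the kernel consists of
multiples of a label, which has positive degree, and the sheaf is indecomposable because `S` is
graded local and every vertex is joined to `w₀` by edges on which the class of `1` does not vanish.
Conversely, in a canonical sheaf one constructs, by descending induction on the length, free
generators `g x` of degree zero of the stalks which agree along all edges
(`MomentGraph.Sheaf.exists_generator`).
Sections above `x` are then families of coefficients satisfying the congruences; since these
extend, the boundary module at `x` is generated by the family of the `g y`. A lift of it to the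
stalk at `x` generates the stalk, the cover being essential, and generates it freely: the stalk is
projective, hence a direct summand of `S` cut out by an idempotent of the local ring `k`.

*Extension of congruences.* The length of `s_α x` exceeds that of `x` exactly if `x⁻¹ α` has the
same sign as `α`. If `s` is a simple reflection with `s x > x`, then by the lifting property the
set above `x` is stable under `s`. With `c_s` the coroot of `s`, the divided difference
`d y = (m y - s (m (s y))) / c_s` is, for `y` different from `x` and `s x`, again a family of the
same kind, of smaller degree, provided that `c_s` is a nonzerodivisor modulo the other coroots.
Induction on the degree extends it to `s x` and then to `x`, and `u = s (m (s x)) + c_s d x` extends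
`m` (`BruhatGraph.ExtendsAt.of_coprime`).

The graph need not satisfy the usual condition that the labels at a vertex are pairwise
independent over `k`: the condition on `s` fails if the residue characteristic of `k` is three and
`s` is the reflection in the short simple root of a component of type `G₂`. For the components of
type `G₂` the extension is therefore written down explicitly (`BruhatGraph.ExtendsAt.g2`). Such a
component is split off by the product lemma `BruhatGraph.Extends.union`, in which functions on the
first factor serve as values for the second; this is why the extension property is formulated for
value modules more general than `S` and for sets of roots that are unions of components.
-/

noncomputable section

set_option linter.unusedSectionVars false

/-! ### The Weyl group: signs of roots, length and Bruhat order -/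

namespace BruhatGraph

variable {ι K M N : Type*} [Field K] [AddCommGroup M] [Module K M]
  [AddCommGroup N] [Module K N] {P : RootPairing ι K M N}

/-- The action of the Weyl group on the indices of the roots. -/
def toPerm (b : P.Base) : Weyl b →* Equiv.Perm ι := P.weylGroupToPerm

variable (b : P.Base)

@[simp] theorem toPerm_refl (i : ι) : toPerm b (refl b i) = P.reflectionPerm i := rfl

theorem toPerm_mul_apply (v w : Weyl b) (i : ι) :
    toPerm b (v * w) i = toPerm b v (toPerm b w i) := by
  rw [map_mul]; rfl

@[simp] theorem refl_mul_refl (i : ι) : refl b i * refl b i = 1 := by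
  have h := RootPairing.Equiv.reflection_inv P i
  refine Subtype.ext ?_
  change RootPairing.Equiv.reflection P i * RootPairing.Equiv.reflection P i = 1
  nth_rw 1 [← h]
  exact inv_mul_cancel _

@[simp] theorem refl_inv (i : ι) : (refl b i)⁻¹ = refl b i :=
  inv_eq_of_mul_eq_one_left (refl_mul_refl b i)

@[simp] theorem refl_mul_cancel_left (i : ι) (w : Weyl b) : refl b i * (refl b i * w) = w := by
  rw [← mul_assoc, refl_mul_refl, one_mul]

/-- The action of the Weyl group on the root space, as linear automorphisms. -/
def weightEquiv (w : Weyl b) : M ≃ₗ[K] M := RootPairing.Equiv.weightHom P (Subtype.val w)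

theorem root_toPerm (w : Weyl b) (i : ι) :
    P.root (toPerm b w i) = weightEquiv b w (P.root i) :=
  (P.weylGroup_apply_root w i).symm

theorem pairing_toPerm (w : Weyl b) (i j : ι) :
    P.pairing (toPerm b w i) (toPerm b w j) = P.pairing i j := by
  obtain ⟨w, hw⟩ := w
  induction hw using RootPairing.weylGroup.induction generalizing i j with
  | mem k =>
    change P.pairing (P.reflectionPerm k i) (P.reflectionPerm k j) = _
    rw [P.pairing_reflectionPerm, P.reflectionPerm_self]
  | one => rfl
  | mul x y hx hy ihx ihy => exact (ihx _ _).trans (ihy i j)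

theorem toPerm_injective [P.IsRootSystem] : Function.Injective (toPerm b) := by
  intro v w h
  refine Subtype.ext (RootPairing.Equiv.weightHom_injective P ?_)
  refine LinearEquiv.toLinearMap_injective ?_
  refine LinearMap.ext_on_range (v := P.root) (RootPairing.IsRootSystem.span_root_eq_top) ?_
  intro i
  change weightEquiv b v (P.root i) = weightEquiv b w (P.root i)
  rw [← root_toPerm, ← root_toPerm, h]

theorem refl_toPerm [P.IsRootSystem] (w : Weyl b) (i : ι) :
    refl b (toPerm b w i) = w * refl b i * w⁻¹ := by
  rw [eq_mul_inv_iff_mul_eq]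
  apply toPerm_injective b
  ext j
  apply P.root.injective
  rw [toPerm_mul_apply, toPerm_mul_apply, root_toPerm b w, toPerm_refl, toPerm_refl,
    P.root_reflectionPerm, P.root_reflectionPerm, P.reflection_apply_root,
    P.reflection_apply_root, map_sub, map_smul, pairing_toPerm, root_toPerm, root_toPerm]

theorem refl_toPerm_mul [P.IsRootSystem] (w x : Weyl b) (i : ι) :
    refl b (toPerm b w i) * (w * x) = w * (refl b i * x) := by
  rw [refl_toPerm]; group

theorem refl_mul_comm [P.IsRootSystem] (i j : ι) (x : Weyl b) :
    refl b i * (refl b j * x) = refl b (P.reflectionPerm i j) * (refl b i * x) := by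
  rw [← toPerm_refl b i, refl_toPerm_mul]

section Length

/-- The product of the simple reflections in a word. -/
def wordProd (l : List b.support) : Weyl b := (l.map fun i : b.support => refl b i.1).prod

@[simp] theorem wordProd_nil : wordProd b [] = 1 := rfl

@[simp] theorem wordProd_cons (s : b.support) (l : List b.support) :
    wordProd b (s :: l) = refl b s * wordProd b l := rfl

theorem wordProd_append (l l' : List b.support) :
    wordProd b (l ++ l') = wordProd b l * wordProd b l' := by
  rw [wordProd, List.map_append, List.prod_append]; rfl

theorem length_eq_sInf (w : Weyl b) :
    length b w = sInf {n | ∃ l : List b.support, l.length = n ∧ wordProd b l = w} := by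
  have h : ∀ l : List b.support, (do let a ← l; pure (a : ι) : List ι) = l.map Subtype.val :=
    fun l => bind_pure_comp _ _
  simp only [length, h, List.map_map]
  rfl

theorem length_le {w : Weyl b} {l : List b.support} (h : wordProd b l = w) :
    length b w ≤ l.length := by
  rw [length_eq_sInf]
  exact Nat.sInf_le ⟨l, rfl, h⟩

variable [CharZero K] [Finite ι] [P.IsRootSystem] [P.IsCrystallographic] [P.IsReduced]

theorem exists_word (w : Weyl b) : ∃ l : List b.support, wordProd b l = w := by
  have hrefl : ∀ i : ι, ∃ l : List b.support, wordProd b l = refl b i := by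
    intro i
    induction i using b.induction_reflect with
    | h₀ i ih =>
      obtain ⟨l, hl⟩ := ih
      refine ⟨l, hl.trans ?_⟩
      have := refl_toPerm b (refl b i) i
      rw [toPerm_refl] at this
      rw [this]; simp
    | h₁ i hi => exact ⟨[⟨i, hi⟩], by simp⟩
    | h₂ i j ih hj =>
      obtain ⟨l, hl⟩ := ih
      refine ⟨⟨j, hj⟩ :: (l ++ [⟨j, hj⟩]), ?_⟩
      have := refl_toPerm b (refl b j) i
      rw [toPerm_refl] at this
      rw [this, ← hl]
      simp [wordProd_append, mul_assoc]
  obtain ⟨w, hw⟩ := w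
  induction hw using RootPairing.weylGroup.induction with
  | mem i => exact hrefl i
  | one => exact ⟨[], rfl⟩
  | mul x y hx hy ihx ihy =>
    obtain ⟨l, hl⟩ := ihx
    obtain ⟨l', hl'⟩ := ihy
    refine ⟨l ++ l', ?_⟩
    rw [wordProd_append]
    exact congrArg₂ (· * ·) hl hl'

theorem exists_reduced_word (w : Weyl b) :
    ∃ l : List b.support, l.length = length b w ∧ wordProd b l = w := by
  rw [length_eq_sInf]
  exact Nat.sInf_mem (s := {n | ∃ l : List b.support, l.length = n ∧ wordProd b l = w})
    (let ⟨l, hl⟩ := exists_word b w; ⟨l.length, l, rfl, hl⟩)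

theorem isPos_reflectionPerm_self (i : ι) : b.IsPos (P.reflectionPerm i i) ↔ ¬ b.IsPos i :=
  RootPairing.Base.IsPos.neg_iff_not b i

theorem toPerm_reflectionPerm_self (w : Weyl b) (i : ι) :
    toPerm b w (P.reflectionPerm i i) =
      P.reflectionPerm (toPerm b w i) (toPerm b w i) := by
  apply P.root.injective
  rw [root_toPerm, P.root_reflectionPerm, P.root_reflectionPerm, P.reflection_apply_self,
    P.reflection_apply_self, map_neg, root_toPerm]

/-- A simple reflection permutes the positive roots other than the simple root itself. -/
theorem isPos_reflectionPerm_iff {s : ι} (hs : s ∈ b.support) {i : ι} (h : i ≠ s)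
    (h' : i ≠ P.reflectionPerm s s) : b.IsPos (P.reflectionPerm s i) ↔ b.IsPos i := by
  refine ⟨fun hp => ?_, fun hp => hp.reflectionPerm hs h⟩
  have := hp.reflectionPerm hs (fun h0 => h' (by
    rw [← P.reflectionPerm_self s i, h0]))
  rwa [P.reflectionPerm_self] at this

/-- The strong exchange property: a positive root made negative by `(s₁ ⋯ sₙ)⁻¹` is
`s₁ ⋯ sₖ₋₁ αₖ` for some `k`, so its reflection deletes a letter of the word. -/
theorem exists_shorter_word (l : List b.support) (i : ι) (hi : b.IsPos i)
    (hn : ¬ b.IsPos (toPerm b (wordProd b l)⁻¹ i)) :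
    ∃ l' : List b.support, l'.length < l.length ∧ wordProd b l' = refl b i * wordProd b l := by
  induction l generalizing i with
  | nil => exact absurd (by simpa using hi) hn
  | cons s l ih =>
    have hw : wordProd b (s :: l) = refl b s * wordProd b l := by simp
    by_cases his : i = s
    · refine ⟨l, by simp, ?_⟩
      rw [hw, his, refl_mul_cancel_left]
    · have hpos : b.IsPos (P.reflectionPerm s i) := hi.reflectionPerm s.2 his
      rw [hw, mul_inv_rev, refl_inv, toPerm_mul_apply, toPerm_refl] at hn
      obtain ⟨l', hl', hl''⟩ := ih _ hpos hn
      refine ⟨s :: l', by simpa using hl', ?_⟩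
      have : wordProd b (s :: l') = refl b s * wordProd b l' := by simp
      rw [this, hl'', hw, refl_mul_comm, P.reflectionPerm_self]

theorem length_refl_mul_lt {x : Weyl b} {i : ι} (hi : b.IsPos i)
    (hn : ¬ b.IsPos (toPerm b x⁻¹ i)) : length b (refl b i * x) < length b x := by
  obtain ⟨l, hl, rfl⟩ := exists_reduced_word b x
  obtain ⟨l', hl', hl''⟩ := exists_shorter_word b l i hi hn
  rw [← hl]
  exact (length_le b hl'').trans_lt hl'

theorem lt_length_refl_mul {x : Weyl b} {i : ι} (hi : b.IsPos i)
    (hp : b.IsPos (toPerm b x⁻¹ i)) : length b x < length b (refl b i * x) := by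
  have := length_refl_mul_lt b (x := refl b i * x) hi (by
    rwa [mul_inv_rev, refl_inv, toPerm_mul_apply, toPerm_refl, toPerm_reflectionPerm_self,
      isPos_reflectionPerm_self, not_not])
  rwa [refl_mul_cancel_left] at this

/-- Multiplication by the reflection in a positive root `α` increases the length of `x` if and only
if `x⁻¹ α` is positive. -/
theorem length_lt_iff {x : Weyl b} {i : ι} (hi : b.IsPos i) :
    length b x < length b (refl b i * x) ↔ b.IsPos (toPerm b x⁻¹ i) :=
  ⟨fun h => by_contra fun hn => (length_refl_mul_lt b hi hn).not_gt h, lt_length_refl_mul b hi⟩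

theorem refl_reflectionPerm_self (i : ι) : refl b (P.reflectionPerm i i) = refl b i := by
  have := refl_toPerm b (refl b i) i
  rw [toPerm_refl] at this
  rw [this]; simp

theorem length_ne (x : Weyl b) (i : ι) : length b (refl b i * x) ≠ length b x := by
  wlog hi : b.IsPos i generalizing i
  · rw [← refl_reflectionPerm_self]
    exact this _ ((isPos_reflectionPerm_self b i).2 hi)
  by_cases h : b.IsPos (toPerm b x⁻¹ i)
  · exact (lt_length_refl_mul b hi h).ne'
  · exact (length_refl_mul_lt b hi h).ne

theorem length_simple_mul_le (x : Weyl b) {s : ι} (hs : s ∈ b.support) :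
    length b (refl b s * x) ≤ length b x + 1 := by
  obtain ⟨l, hl, rfl⟩ := exists_reduced_word b x
  rw [← hl]
  exact length_le b (l := ⟨s, hs⟩ :: l) (by simp)

theorem eq_one_of_forall_isPos {x : Weyl b} (h : ∀ s ∈ b.support, b.IsPos (toPerm b x⁻¹ s)) :
    x = 1 := by
  obtain ⟨l, hl, rfl⟩ := exists_reduced_word b x
  cases l with
  | nil => rfl
  | cons s l =>
    have h1 := lt_length_refl_mul b (RootPairing.Base.isPos_of_mem_support s.2) (h s s.2)
    have h2 : wordProd b (s :: l) = refl b s * wordProd b l := by simp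
    rw [h2, refl_mul_cancel_left, ← h2, ← hl] at h1
    have := length_le b (l := l) rfl
    simp only [List.length_cons] at h1
    omega

/-- If `x⁻¹` makes the simple roots negative then it does so with all positive roots. -/
theorem not_isPos_of_forall_simple {x : Weyl b}
    (h : ∀ s ∈ b.support, ¬ b.IsPos (toPerm b x⁻¹ s)) {i : ι} (hi : b.IsPos i) :
    ¬ b.IsPos (toPerm b x⁻¹ i) := by
  refine hi.induction_on_add (p := fun i => ¬ b.IsPos (toPerm b x⁻¹ i)) h ?_
  · intro i j k hk ih hj
    rw [← isPos_reflectionPerm_self] at ih ⊢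
    have hj' := h j hj
    rw [← isPos_reflectionPerm_self] at hj'
    refine ih.add hj' ?_
    rw [P.root_reflectionPerm, P.root_reflectionPerm, P.root_reflectionPerm,
      P.reflection_apply_self, P.reflection_apply_self, P.reflection_apply_self, root_toPerm, hk,
      map_add, root_toPerm, root_toPerm, neg_add]

/-- An element of the Weyl group that is not of maximal length has a simple ascent. -/
theorem exists_simple_ascent {x w₀ : Weyl b} (hw₀ : ∀ w, length b w ≤ length b w₀)
    (hx : x ≠ w₀) : ∃ s ∈ b.support, length b x < length b (refl b s * x) := by
  by_contra! hcon
  have key : ∀ y : Weyl b, (∀ s ∈ b.support, length b (refl b s * y) ≤ length b y) →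
      ∀ i, b.IsPos i → ¬ b.IsPos (toPerm b y⁻¹ i) := by
    intro y hy i hi
    refine not_isPos_of_forall_simple b (fun s hs hp => ?_) hi
    exact (hy s hs).not_gt (lt_length_refl_mul b (RootPairing.Base.isPos_of_mem_support hs) hp)
  have hx' := key x hcon
  have hw := key w₀ (fun s _ => hw₀ _)
  refine hx ?_
  rw [← mul_inv_eq_one]
  refine eq_one_of_forall_isPos b fun s hs => ?_
  have hs' := RootPairing.Base.isPos_of_mem_support hs
  rw [mul_inv_rev, inv_inv, toPerm_mul_apply]
  -- `x⁻¹ s` is negative, and `w₀` makes every negative root positive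
  have h1 := hx' s hs'
  by_contra h2
  rw [← isPos_reflectionPerm_self] at h2
  have h3 := hw _ h2
  rw [toPerm_reflectionPerm_self, ← toPerm_mul_apply, inv_mul_cancel, map_one] at h3
  rw [isPos_reflectionPerm_self, not_not] at h3
  exact h1 h3

/-- The element of maximal length is the largest element of the Bruhat order. -/
theorem le_longest {w₀ : Weyl b} (hw₀ : ∀ w, length b w ≤ length b w₀) (x : Weyl b) :
    x ≤ w₀ := by
  by_cases hx : x = w₀
  · exact hx.le
  · obtain ⟨s, hs, h⟩ := exists_simple_ascent b hw₀ hx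
    have := hw₀ (refl b s * x)
    have h1 := le_longest hw₀ (refl b s * x)
    exact le_trans (Relation.ReflTransGen.single ⟨h, s, rfl⟩) h1
termination_by length b w₀ - length b x

end Length

end BruhatGraph

/-! ### Congruences between functions on the Weyl group -/

namespace BruhatGraph

variable {ι K M N : Type*} [Field K] [AddCommGroup M] [Module K M]
  [AddCommGroup N] [Module K N] {P : RootPairing ι K M N}

section Above

variable [CharZero K] [Finite ι] [P.IsRootSystem] [P.IsCrystallographic] [P.IsReduced]
variable (b : P.Base)

theorem length_lt_iff' {x : Weyl b} {i : ι} :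
    length b x < length b (refl b i * x) ↔ (b.IsPos i ↔ b.IsPos (toPerm b x⁻¹ i)) := by
  by_cases hi : b.IsPos i
  · simp [hi, length_lt_iff]
  · have hi' := (isPos_reflectionPerm_self b i).2 hi
    have := length_lt_iff b (x := x) hi'
    rw [refl_reflectionPerm_self, toPerm_reflectionPerm_self, isPos_reflectionPerm_self] at this
    simp [hi, this]

/-- A variant of the Bruhat order: `y` is reached from `x` by length increasing multiplications with
reflections in the roots from `Ψ`. -/
def Above (Ψ : Set ι) : Weyl b → Weyl b → Prop :=
  Relation.ReflTransGen fun x y => length b x < length b y ∧ ∃ i ∈ Ψ, y = refl b i * x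

/-- The elements strictly above `x`, with respect to `Ψ`. -/
def StrictlyAbove (Ψ : Set ι) (x : Weyl b) : Set (Weyl b) := {y | Above b Ψ x y ∧ y ≠ x}

variable {b} {Ψ : Set ι} {x y : Weyl b}

theorem Above.eq_or_length_lt (h : Above b Ψ x y) : y = x ∨ length b x < length b y := by
  induction h with
  | refl => exact Or.inl rfl
  | tail _ h ih =>
    rcases ih with rfl | ih
    · exact Or.inr h.1
    · exact Or.inr (ih.trans h.1)

theorem Above.length_le (h : Above b Ψ x y) : length b x ≤ length b y := by
  rcases h.eq_or_length_lt with rfl | h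
  · exact le_rfl
  · exact h.le

theorem StrictlyAbove.length_lt (h : y ∈ StrictlyAbove b Ψ x) : length b x < length b y :=
  h.1.eq_or_length_lt.resolve_left h.2

theorem StrictlyAbove.step {i : ι} (hi : i ∈ Ψ) (h : length b x < length b (refl b i * x)) :
    refl b i * x ∈ StrictlyAbove b Ψ x :=
  ⟨Relation.ReflTransGen.single ⟨h, i, hi, rfl⟩, fun h0 => by rw [h0] at h; exact h.false⟩

theorem StrictlyAbove.trans {z : Weyl b} (h : y ∈ StrictlyAbove b Ψ x)
    (h' : z ∈ StrictlyAbove b Ψ y) : z ∈ StrictlyAbove b Ψ x :=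
  ⟨Relation.ReflTransGen.trans h.1 h'.1, fun h0 => by
    subst h0; exact (StrictlyAbove.length_lt h).not_gt (StrictlyAbove.length_lt h')⟩

theorem refl_eq_of_eq_or_neg {i s : ι} (h : i = s ∨ i = P.reflectionPerm s s) :
    refl b i = refl b s := by
  rcases h with rfl | rfl
  · rfl
  · exact refl_reflectionPerm_self b s

theorem eq_or_neg_of_refl_eq {i s : ι} (h : refl b i = refl b s) :
    i = s ∨ i = P.reflectionPerm s s := by
  have h1 : toPerm b (refl b i) i = toPerm b (refl b s) i := by rw [h]
  have h2 := congrArg P.root h1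
  rw [toPerm_refl, toPerm_refl, P.root_reflectionPerm, P.root_reflectionPerm,
    P.reflection_apply_self, P.reflection_apply_root] at h2
  have h3 : ¬ LinearIndependent K ![P.root i, P.root s] := by
    rw [LinearIndependent.pair_iff]
    intro h0
    have := (h0 2 (-P.pairing i s) (by
      rw [two_smul, neg_smul, ← sub_eq_add_neg, add_sub_assoc, ← h2]; simp)).1
    exact two_ne_zero this
  by_cases his : i = s
  · exact Or.inl his
  rcases RootPairing.IsReduced.eq_or_eq_neg i s h3 with h4 | h4
  · exact Or.inl (P.root.injective h4)
  · refine Or.inr (P.root.injective ?_)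
    rw [P.root_reflectionPerm, P.reflection_apply_self, h4]

/-- A set of roots stable under its own reflections. -/
def ReflClosed (Ψ : Set ι) : Prop := ∀ i ∈ Ψ, ∀ j ∈ Ψ, P.reflectionPerm i j ∈ Ψ

/-- The lifting property of the Bruhat order. -/
theorem Above.simple_mul (hcl : ReflClosed (P := P) Ψ) {s : ι} (hs : s ∈ b.support) (hΨ : s ∈ Ψ)
    (hx : length b x < length b (refl b s * x)) (h : Above b Ψ x y) :
    Above b Ψ x (refl b s * y) := by
  induction h with
  | refl => exact Relation.ReflTransGen.single ⟨hx, s, hΨ, rfl⟩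
  | @tail y z hy hz ih =>
    obtain ⟨hlt, i, hi, rfl⟩ := hz
    by_cases his : i = s ∨ i = P.reflectionPerm s s
    · rw [refl_eq_of_eq_or_neg his, refl_mul_cancel_left]; exact hy
    · rw [not_or] at his
      rw [refl_mul_comm]
      refine Relation.ReflTransGen.tail ih ⟨?_, _, hcl s hΨ i hi, rfl⟩
      rw [length_lt_iff', isPos_reflectionPerm_iff b hs his.1 his.2,
        mul_inv_rev, refl_inv, toPerm_mul_apply, toPerm_refl, P.reflectionPerm_self]
      exact (length_lt_iff' b).1 hlt

theorem StrictlyAbove.simple_mul (hcl : ReflClosed (P := P) Ψ) {s : ι} (hs : s ∈ b.support)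
    (hΨ : s ∈ Ψ) (hx : length b x < length b (refl b s * x)) (h : y ∈ StrictlyAbove b Ψ x)
    (hy : y ≠ refl b s * x) :
    refl b s * y ∈ StrictlyAbove b Ψ x ∧ refl b s * y ≠ refl b s * x :=
  ⟨⟨h.1.simple_mul hcl hs hΨ hx, fun h0 => hy (by rw [← h0, refl_mul_cancel_left])⟩,
    fun h0 => h.2 (mul_left_cancel h0)⟩

end Above

/-! ### Rings with an action of the reflections -/

/-- An abstraction of the symmetric algebra of the coroot lattice: a commutative ring with elements
`c i` standing for the coroots, endomorphisms `σ i` standing for the reflections, and a filtration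
`F` standing for the one by degree. -/
structure CorootRing (P : RootPairing ι K M N) [CharZero K] [P.IsCrystallographic]
    (S : Type*) [CommRing S] where
  c : ι → S
  σ : ι → S →+* S
  F : ℤ → AddSubgroup S
  c_reflectionPerm : ∀ i j, c (P.reflectionPerm i j) = c j - P.pairingIn ℤ i j • c i
  σ_c : ∀ i j, σ i (c j) = c (P.reflectionPerm i j)
  σ_σ : ∀ i f, σ i (σ i f) = f
  dvd_sub_σ : ∀ i f, c i ∣ f - σ i f
  eq_zero_of_mul : ∀ i f, c i * f = 0 → f = 0
  eq_zero_of_neg : ∀ n < 0, ∀ f ∈ F n, f = 0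
  σ_mem : ∀ i n f, f ∈ F n → σ i f ∈ F n
  mul_mem : ∀ i n f, f ∈ F n → c i * f ∈ F (n + 1)
  mem_of_mul_mem : ∀ i n f, c i * f ∈ F (n + 1) → f ∈ F n

section Congruences

variable [CharZero K] [Finite ι] [P.IsRootSystem] [P.IsCrystallographic] [P.IsReduced]
variable {S : Type*} [CommRing S] (R : CorootRing P S)

namespace CorootRing

/-- `c i` is a nonzerodivisor modulo `c j`. -/
def Coprime (i j : ι) : Prop := ∀ f, R.c j ∣ R.c i * f → R.c j ∣ f

theorem c_neg (i : ι) : R.c (P.reflectionPerm i i) = -R.c i := by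
  rw [R.c_reflectionPerm, P.pairingIn_same]
  simp [two_smul]

theorem c_dvd_iff_of_eq_or_neg {i s : ι} (h : i = s ∨ i = P.reflectionPerm s s) (f : S) :
    R.c i ∣ f ↔ R.c s ∣ f := by
  rcases h with rfl | rfl
  · rfl
  · rw [R.c_neg, neg_dvd]

theorem dvd_sub_comm {i : ι} {f g : S} : R.c i ∣ f - g ↔ R.c i ∣ g - f := by
  rw [← dvd_neg, neg_sub]

end CorootRing

variable {R} {I : Type*}

/-- The modules of values: submodules of a power of `S` that are stable under the reflections in the
roots from `Ψ` and under division by their coroots. -/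
structure IsValueModule (R : CorootRing P S) (Ψ : Set ι) (A : Submodule S (I → S)) : Prop where
  σ_mem : ∀ i ∈ Ψ, ∀ v ∈ A, (fun p => R.σ i (v p)) ∈ A
  mem_of_mul_mem : ∀ i ∈ Ψ, ∀ v : I → S, (fun p => R.c i * v p) ∈ A → v ∈ A

theorem IsValueModule.mul_mem {Ψ : Set ι} {A : Submodule S (I → S)} (_h : IsValueModule R Ψ A)
    (f : S) {v : I → S} (hv : v ∈ A) : (fun p => f * v p) ∈ A := A.smul_mem f hv

theorem IsValueModule.exists_quotient {Ψ : Set ι} {A : Submodule S (I → S)}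
    (h : IsValueModule R Ψ A) {i : ι} (hi : i ∈ Ψ) {n : ℤ} {v : I → S} (hv : v ∈ A)
    (hn : ∀ p, v p ∈ R.F (n + 1)) (hdvd : ∀ p, R.c i ∣ v p) :
    ∃ q ∈ A, (∀ p, q p ∈ R.F n) ∧ ∀ p, v p = R.c i * q p := by
  choose q hq using hdvd
  have hvq : v = fun p => R.c i * q p := funext hq
  exact ⟨q, h.mem_of_mul_mem i hi q (hvq ▸ hv),
    fun p => R.mem_of_mul_mem i n _ (hq p ▸ hn p), hq⟩

variable (b : P.Base)

/-- Families of values that satisfy the congruences of the edges with labels from `Ψ` between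
elements of `U`. -/
def IsSection (R : CorootRing P S) (Ψ : Set ι) (U : Set (Weyl b)) (m : Weyl b → I → S) : Prop :=
  ∀ y ∈ U, ∀ i ∈ Ψ, refl b i * y ∈ U → ∀ p, R.c i ∣ m y p - m (refl b i * y) p

/-- Sections of degree `≤ n` over the elements strictly above `x` extend to `x`. -/
def ExtendsAt (R : CorootRing P S) (Ψ : Set ι) (A : Submodule S (I → S)) (n : ℤ) (x : Weyl b) :
    Prop :=
  ∀ m : Weyl b → I → S, (∀ y ∈ StrictlyAbove b Ψ x, m y ∈ A ∧ ∀ p, m y p ∈ R.F n) →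
    IsSection b R Ψ (StrictlyAbove b Ψ x) m →
    ∃ u ∈ A, (∀ p, u p ∈ R.F n) ∧
      ∀ i ∈ Ψ, length b x < length b (refl b i * x) → ∀ p, R.c i ∣ u p - m (refl b i * x) p

variable {b} {Ψ : Set ι} {A : Submodule S (I → S)} {n : ℤ} {x : Weyl b}

/-- Above a simple ascent `s` of `x`, a section `m` has a divided difference
`d y = (m y - s (m (s y))) / c s`. -/
theorem exists_divided_difference (hcl : ReflClosed (P := P) Ψ) (hA : IsValueModule R Ψ A)
    {s : ι} (hs : s ∈ b.support) (hsΨ : s ∈ Ψ) (hx : length b x < length b (refl b s * x))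
    {m : Weyl b → I → S} (hm : ∀ y ∈ StrictlyAbove b Ψ x, m y ∈ A ∧ ∀ p, m y p ∈ R.F (n + 1))
    (hsec : IsSection b R Ψ (StrictlyAbove b Ψ x) m) :
    ∃ d : Weyl b → I → S, ∀ y ∈ StrictlyAbove b Ψ x, y ≠ refl b s * x →
      d y ∈ A ∧ (∀ p, d y p ∈ R.F n) ∧
      (∀ p, m y p = R.σ s (m (refl b s * y) p) + R.c s * d y p) ∧
      (∀ p, d (refl b s * y) p = R.σ s (d y p)) ∧
      ∀ i ∈ Ψ, i ≠ s → i ≠ P.reflectionPerm s s → refl b i * y ∈ StrictlyAbove b Ψ x →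
        refl b i * y ≠ refl b s * x → ∀ p, R.c i ∣ R.c s * (d y p - d (refl b i * y) p) := by
  have key : ∀ y, ∃ q : I → S, y ∈ StrictlyAbove b Ψ x → y ≠ refl b s * x →
      q ∈ A ∧ (∀ p, q p ∈ R.F n) ∧ ∀ p, m y p - R.σ s (m (refl b s * y) p) = R.c s * q p := by
    intro y
    by_cases hy : y ∈ StrictlyAbove b Ψ x ∧ y ≠ refl b s * x
    · obtain ⟨hsy, -⟩ := StrictlyAbove.simple_mul hcl hs hsΨ hx hy.1 hy.2
      obtain ⟨q, hq⟩ := hA.exists_quotient hsΨ (n := n)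
        (v := fun p => m y p - R.σ s (m (refl b s * y) p))
        (A.sub_mem (hm y hy.1).1 (hA.σ_mem s hsΨ _ (hm _ hsy).1))
        (fun p => (R.F _).sub_mem ((hm y hy.1).2 p) (R.σ_mem s _ _ ((hm _ hsy).2 p)))
        (fun p => by
          have h1 := hsec y hy.1 s hsΨ hsy p
          have h2 := R.dvd_sub_σ s (m (refl b s * y) p)
          simpa using dvd_add h1 h2)
      exact ⟨q, fun _ _ => hq⟩
    · exact ⟨0, fun h h' => absurd ⟨h, h'⟩ hy⟩
  choose d hd using key
  refine ⟨d, fun y hy hys => ?_⟩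
  obtain ⟨hdA, hdF, hdy⟩ := hd y hy hys
  obtain ⟨hsy, hsy'⟩ := StrictlyAbove.simple_mul hcl hs hsΨ hx hy hys
  refine ⟨hdA, hdF, fun p => by rw [← hdy p]; ring, fun p => ?_, ?_⟩
  · have h1 := (hd _ hsy hsy').2.2 p
    rw [refl_mul_cancel_left] at h1
    rw [← sub_eq_zero]
    refine R.eq_zero_of_mul s _ ?_
    have h2 := congrArg (R.σ s) (hdy p)
    rw [map_sub, R.σ_σ, map_mul, R.σ_c, R.c_neg] at h2
    linear_combination -h1 - h2
  · intro i hi his his' hiy hiy' p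
    have h1 := hdy p
    have h2 := (hd _ hiy hiy').2.2 p
    obtain ⟨hsiy, -⟩ := StrictlyAbove.simple_mul hcl hs hsΨ hx hiy hiy'
    have h3 := hsec y hy i hi hiy p
    rw [refl_mul_comm] at hsiy h2
    obtain ⟨w, hw⟩ := hsec _ hsy _ (hcl s hsΨ i hi) hsiy p
    have h4 : R.c s * (d y p - d (refl b i * y) p) =
        (m y p - m (refl b i * y) p) - R.c i * R.σ s w := by
      have h5 := congrArg (R.σ s) hw
      rw [map_sub, map_mul, R.σ_c, P.reflectionPerm_self] at h5
      linear_combination h2 - h1 - h5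
    rw [h4]
    exact dvd_sub h3 (dvd_mul_right _ _)

/-- A value of the divided difference at `x` gives an extension of the section to `x`. -/
theorem exists_extension_of_divided_difference (hcl : ReflClosed (P := P) Ψ)
    (hA : IsValueModule R Ψ A) {s : ι} (hs : s ∈ b.support) (hsΨ : s ∈ Ψ)
    (hx : length b x < length b (refl b s * x)) {m d : Weyl b → I → S}
    (hm : ∀ y ∈ StrictlyAbove b Ψ x, m y ∈ A ∧ ∀ p, m y p ∈ R.F (n + 1))
    (hsec : IsSection b R Ψ (StrictlyAbove b Ψ x) m)
    (hd : ∀ y ∈ StrictlyAbove b Ψ x, y ≠ refl b s * x → ∀ p,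
      m y p = R.σ s (m (refl b s * y) p) + R.c s * d y p) {u : I → S} (huA : u ∈ A)
    (huF : ∀ p, u p ∈ R.F n)
    (hu : ∀ i ∈ Ψ, i ≠ s → i ≠ P.reflectionPerm s s → length b x < length b (refl b i * x) →
      refl b i * x ≠ refl b s * x → ∀ p, R.c i ∣ R.c s * (u p - d (refl b i * x) p)) :
    ∃ v ∈ A, (∀ p, v p ∈ R.F (n + 1)) ∧
      ∀ i ∈ Ψ, length b x < length b (refl b i * x) → ∀ p, R.c i ∣ v p - m (refl b i * x) p := by
  have hsx := StrictlyAbove.step hsΨ hx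
  refine ⟨fun p => R.σ s (m (refl b s * x) p) + R.c s * u p,
    A.add_mem (hA.σ_mem s hsΨ _ (hm _ hsx).1) (hA.mul_mem _ huA),
    fun p => (R.F _).add_mem (R.σ_mem _ _ _ ((hm _ hsx).2 p)) (R.mul_mem _ _ _ (huF p)), ?_⟩
  intro i hi hix p
  by_cases his : i = s ∨ i = P.reflectionPerm s s
  · rw [refl_eq_of_eq_or_neg his, R.c_dvd_iff_of_eq_or_neg his]
    have h3 := R.dvd_sub_σ s (m (refl b s * x) p)
    rw [R.dvd_sub_comm] at h3
    have h4 := dvd_add h3 (dvd_mul_right (R.c s) (u p))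
    convert h4 using 1; ring
  · rw [not_or] at his
    have hiy := StrictlyAbove.step hi hix
    have hiys : refl b i * x ≠ refl b s * x := by
      intro h0
      have h5 : refl b i = refl b s := mul_right_cancel h0
      exact not_or.2 his (eq_or_neg_of_refl_eq h5)
    obtain ⟨hsiy, -⟩ := StrictlyAbove.simple_mul hcl hs hsΨ hx hiy hiys
    have h3 := hu i hi his.1 his.2 hix hiys p
    rw [refl_mul_comm] at hsiy
    obtain ⟨w, hw⟩ := hsec _ hsx _ (hcl s hsΨ i hi) hsiy p
    have h5 := congrArg (R.σ s) hw
    rw [map_sub, map_mul, R.σ_c, P.reflectionPerm_self] at h5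
    have h6 := hd _ hiy hiys p
    rw [refl_mul_comm] at h6
    have h7 : R.σ s (m (refl b s * x) p) + R.c s * u p - m (refl b i * x) p =
        R.c i * R.σ s w + R.c s * (u p - d (refl b i * x) p) := by
      linear_combination h5 - h6
    rw [h7]
    exact dvd_add (dvd_mul_right _ _) h3

/-- Extension at a simple ascent whose coroot is coprime to the other ones: dividing by this coroot
gives a section of lower degree. -/
theorem ExtendsAt.of_coprime (hcl : ReflClosed (P := P) Ψ) (hA : IsValueModule R Ψ A)
    {s : ι} (hs : s ∈ b.support) (hsΨ : s ∈ Ψ) (hx : length b x < length b (refl b s * x))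
    (hcop : ∀ i ∈ Ψ, i ≠ s → i ≠ P.reflectionPerm s s → R.Coprime s i)
    (h1 : ExtendsAt b R Ψ A n (refl b s * x)) (h2 : ExtendsAt b R Ψ A n x) :
    ExtendsAt b R Ψ A (n + 1) x := by
  classical
  intro m hm hsec
  obtain ⟨d, hd⟩ := exists_divided_difference hcl hA hs hsΨ hx hm hsec
  have hsx := StrictlyAbove.step hsΨ hx
  have hdsec : ∀ y ∈ StrictlyAbove b Ψ x, y ≠ refl b s * x → ∀ i ∈ Ψ,
      refl b i * y ∈ StrictlyAbove b Ψ x → refl b i * y ≠ refl b s * x →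
      ∀ p, R.c i ∣ d y p - d (refl b i * y) p := by
    intro y hy hys i hi hiy hiys p
    obtain ⟨-, -, -, heq, hdvd⟩ := hd y hy hys
    by_cases his : i = s ∨ i = P.reflectionPerm s s
    · rw [refl_eq_of_eq_or_neg his, R.c_dvd_iff_of_eq_or_neg his, heq p]
      exact R.dvd_sub_σ s _
    · rw [not_or] at his
      exact hcop i hi his.1 his.2 _ (hdvd i hi his.1 his.2 hiy hiys p)
  have hsub : ∀ y ∈ StrictlyAbove b Ψ (refl b s * x), y ∈ StrictlyAbove b Ψ x ∧
      y ≠ refl b s * x := fun y hy => ⟨StrictlyAbove.trans hsx hy, hy.2⟩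
  obtain ⟨v, hvA, hvF, hv⟩ := h1 d
    (fun y hy => ⟨(hd y (hsub y hy).1 (hsub y hy).2).1, (hd y (hsub y hy).1 (hsub y hy).2).2.1⟩)
    (fun y hy i hi hiy p => hdsec y (hsub y hy).1 (hsub y hy).2 i hi (hsub _ hiy).1
      (hsub _ hiy).2 p)
  obtain ⟨u, huA, huF, hu⟩ := h2 (Function.update d (refl b s * x) v)
    (fun y hy => by
      by_cases hys : y = refl b s * x
      · subst hys; simpa using ⟨hvA, hvF⟩
      · rw [Function.update_of_ne hys]
        exact ⟨(hd y hy hys).1, (hd y hy hys).2.1⟩)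
    (by
      have up : ∀ y ∈ StrictlyAbove b Ψ x, ∀ i, y = refl b i * (refl b s * x) →
          length b (refl b s * x) < length b y := by
        intro y hy i hyi
        refine lt_of_le_of_ne ?_ (fun h => length_ne b (refl b s * x) i (by rw [← hyi, h]))
        have := length_simple_mul_le b x hs
        have := StrictlyAbove.length_lt hy
        omega
      intro y hy i hi hiy p
      by_cases hys : y = refl b s * x
      · subst hys
        have hne : refl b i * (refl b s * x) ≠ refl b s * x := fun h =>
          length_ne b (refl b s * x) i (by rw [h])
        rw [Function.update_self, Function.update_of_ne hne]
        exact hv i hi (up _ hiy i rfl) p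
      · rw [Function.update_of_ne hys]
        by_cases hiys : refl b i * y = refl b s * x
        · have hyi : y = refl b i * (refl b s * x) := by rw [← hiys, refl_mul_cancel_left]
          have h3 := hv i hi (by rw [← hyi]; exact up y hy i hyi) p
          rw [hiys, Function.update_self, R.dvd_sub_comm]
          rwa [← hyi] at h3
        · rw [Function.update_of_ne hiys]
          exact hdsec y hy hys i hi hiy hiys p)
  refine exists_extension_of_divided_difference hcl hA hs hsΨ hx hm hsec
    (fun y hy hys => (hd y hy hys).2.2.1) huA huF fun i hi _ _ hix hiys p => ?_
  have h3 := hu i hi hix p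
  rw [Function.update_of_ne hiys] at h3
  exact h3.mul_left _

end Congruences
end BruhatGraph

/-! ### Orthogonal families of roots -/

namespace BruhatGraph

universe u₁ u₂ u₃ u₄

variable {ι : Type u₁} {K : Type u₂} {M : Type u₃} {N : Type u₄} [Field K] [AddCommGroup M]
  [Module K M] [AddCommGroup N] [Module K N] {P : RootPairing ι K M N}
variable [CharZero K] [Finite ι] [P.IsRootSystem] [P.IsCrystallographic] [P.IsReduced]
variable {b : P.Base}

theorem reflectionPerm_eq_of_pairing_eq_zero {i j : ι} (h : P.pairing j i = 0) :
    P.reflectionPerm i j = j := by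
  apply P.root.injective
  rw [P.root_reflectionPerm, P.reflection_apply_root, h, zero_smul, sub_zero]

/-- Two mutually orthogonal sets of roots. -/
def Orthogonal (Ψ₁ Ψ₂ : Set ι) : Prop :=
  ∀ i ∈ Ψ₁, ∀ j ∈ Ψ₂, P.pairing i j = 0 ∧ P.pairing j i = 0

theorem Orthogonal.symm {Ψ₁ Ψ₂ : Set ι} (h : Orthogonal (P := P) Ψ₁ Ψ₂) :
    Orthogonal (P := P) Ψ₂ Ψ₁ := fun i hi j hj => (h j hj i hi).symm

variable {Ψ₁ Ψ₂ : Set ι} {x y z : Weyl b}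

/-- Products of reflections in roots from `Ψ₁` fix the roots from `Ψ₂`. -/
theorem Above.toPerm_eq (h : Orthogonal (P := P) Ψ₁ Ψ₂) (hy : Above b Ψ₁ x y) {j : ι}
    (hj : j ∈ Ψ₂) : toPerm b (y * x⁻¹) j = j := by
  induction hy with
  | refl => simp
  | tail _ hz ih =>
    obtain ⟨-, i, hi, rfl⟩ := hz
    rw [mul_assoc, toPerm_mul_apply, ih, toPerm_refl,
      reflectionPerm_eq_of_pairing_eq_zero (h i hi j hj).2]

theorem Above.refl_comm (h : Orthogonal (P := P) Ψ₁ Ψ₂) (hy : Above b Ψ₁ x y) {j : ι}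
    (hj : j ∈ Ψ₂) (w : Weyl b) : y * x⁻¹ * (refl b j * w) = refl b j * (y * x⁻¹ * w) := by
  rw [← refl_toPerm_mul, hy.toPerm_eq h hj]

/-- Multiplication with a product of reflections in `Ψ₁` preserves the relation for `Ψ₂`. -/
theorem Above.mul_left (h : Orthogonal (P := P) Ψ₁ Ψ₂) (hy : Above b Ψ₁ x y)
    (hz : Above b Ψ₂ x z) : Above b Ψ₂ y (y * x⁻¹ * z) := by
  induction hz with
  | refl => rw [inv_mul_cancel_right]; exact Relation.ReflTransGen.refl
  | @tail z w _ hw ih =>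
    obtain ⟨hlt, j, hj, rfl⟩ := hw
    rw [hy.refl_comm h hj]
    refine ih.tail ⟨?_, j, hj, rfl⟩
    rw [length_lt_iff'] at hlt ⊢
    have hf := hy.toPerm_eq h hj
    have hf' : toPerm b (y * x⁻¹)⁻¹ j = j := by
      conv_lhs => rw [← hf]
      rw [← toPerm_mul_apply, inv_mul_cancel, map_one]; rfl
    rwa [mul_inv_rev, toPerm_mul_apply, hf']

theorem Above.comm (h : Orthogonal (P := P) Ψ₁ Ψ₂) (hy : Above b Ψ₁ x y)
    (hz : Above b Ψ₂ x z) : y * x⁻¹ * z = z * x⁻¹ * y := by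
  induction hz with
  | refl => simp
  | @tail z w _ hw ih =>
    obtain ⟨-, j, hj, rfl⟩ := hw
    rw [hy.refl_comm h hj, ih]; simp [mul_assoc]

theorem Above.mono {Ψ Ψ' : Set ι} (hΨ : Ψ' ⊆ Ψ) (h : Above b Ψ' x y) : Above b Ψ x y :=
  Relation.ReflTransGen.mono (fun _ _ hs => ⟨hs.1, hs.2.imp fun _ hi => ⟨hΨ hi.1, hi.2⟩⟩) _ _ h

theorem StrictlyAbove.mono {Ψ Ψ' : Set ι} (hΨ : Ψ' ⊆ Ψ) (h : y ∈ StrictlyAbove b Ψ' x) :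
    y ∈ StrictlyAbove b Ψ x := ⟨h.1.mono hΨ, h.2⟩

theorem StrictlyAbove.mul_left (h : Orthogonal (P := P) Ψ₁ Ψ₂) (hy : Above b Ψ₁ x y)
    (hz : z ∈ StrictlyAbove b Ψ₂ x) : y * x⁻¹ * z ∈ StrictlyAbove b (Ψ₁ ∪ Ψ₂) x := by
  refine ⟨Relation.ReflTransGen.trans (hy.mono Set.subset_union_left)
    ((hy.mul_left h hz.1).mono Set.subset_union_right), fun h0 => ?_⟩
  have h1 := (hz.1.mul_left h.symm hy).length_le
  rw [← hy.comm h hz.1, h0] at h1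
  exact h1.not_gt (StrictlyAbove.length_lt hz)

variable {S : Type*} [CommRing S] {R : CorootRing P S}

/-- Sections extend for all value modules, degrees and elements of the Weyl group. -/
def Extends (b : P.Base) (R : CorootRing P S) (Ψ : Set ι) : Prop :=
  ∀ (I : Type (max u₁ u₃ u₄)) (A : Submodule S (I → S)), IsValueModule R Ψ A →
    ∀ n x, ExtendsAt b R Ψ A n x

theorem CorootRing.σ_eq_of_pairing_eq_zero {i j : ι} (h : P.pairing i j = 0) :
    R.σ j (R.c i) = R.c i := by
  rw [R.σ_c, reflectionPerm_eq_of_pairing_eq_zero h]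

/-- The extension property for the union of two orthogonal sets of roots, one at a time. -/
theorem Extends.union (h : Orthogonal (P := P) Ψ₁ Ψ₂)
    (hc₁ : ∀ i ∈ Ψ₁, ∀ j ∈ Ψ₂, R.Coprime i j) (hc₂ : ∀ i ∈ Ψ₁, ∀ j ∈ Ψ₂, R.Coprime j i)
    (h₁ : Extends b R Ψ₁) (h₂ : Extends b R Ψ₂) : Extends b R (Ψ₁ ∪ Ψ₂) := by
  classical
  intro I A hA n x m hm hsec
  -- functions of `a`, where `a x` is above `x` for `Ψ₁`, that are sections for `Ψ₁`
  let A₂ : Submodule S (Weyl b × I → S) :=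
    { carrier := {f | ∀ a, Above b Ψ₁ x (a * x) → (fun p => f (a, p)) ∈ A ∧
        ∀ i ∈ Ψ₁, Above b Ψ₁ x (refl b i * a * x) → ∀ p, R.c i ∣ f (a, p) - f (refl b i * a, p)}
      zero_mem' := fun a _ => ⟨A.zero_mem, fun i _ _ p => by simp⟩
      add_mem' := fun {f g} hf hg a ha => ⟨A.add_mem (hf a ha).1 (hg a ha).1, fun i hi hia p => by
        have := dvd_add ((hf a ha).2 i hi hia p) ((hg a ha).2 i hi hia p)
        convert this using 1; simp only [Pi.add_apply]; ring⟩
      smul_mem' := fun r f hf a ha => ⟨A.smul_mem r (hf a ha).1, fun i hi hia p => by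
        have := ((hf a ha).2 i hi hia p).mul_left r
        convert this using 1; simp only [Pi.smul_apply, smul_eq_mul]; ring⟩ }
  have hA₂ : IsValueModule R Ψ₂ A₂ := by
    refine ⟨fun j hj f hf a ha => ⟨hA.σ_mem j (Or.inr hj) _ (hf a ha).1, fun i hi hia p => ?_⟩,
      fun j hj f hf a ha => ⟨hA.mem_of_mul_mem j (Or.inr hj) _ (hf a ha).1,
        fun i hi hia p => ?_⟩⟩
    · have := map_dvd (R.σ j) ((hf a ha).2 i hi hia p)
      rwa [R.σ_eq_of_pairing_eq_zero (h i hi j hj).1, map_sub] at this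
    · refine hc₂ i hi j hj _ ?_
      have := (hf a ha).2 i hi hia p
      rwa [← mul_sub] at this
  have hup : ∀ a, Above b Ψ₁ x (a * x) → ∀ y ∈ StrictlyAbove b Ψ₂ x,
      a * y ∈ StrictlyAbove b (Ψ₁ ∪ Ψ₂) x := fun a ha y hy => by
    have := StrictlyAbove.mul_left h ha hy
    rwa [mul_inv_cancel_right] at this
  obtain ⟨u, huA, huF, hu⟩ := h₂ (Weyl b × I) A₂ hA₂ n x
    (fun y q => if Above b Ψ₁ x (q.1 * x) then m (q.1 * y) q.2 else 0)
    (fun y hy => ⟨fun a ha => ⟨by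
        simp only [if_pos ha]; exact (hm _ (hup a ha y hy)).1, fun i hi hia p => by
        simp only [if_pos ha, if_pos hia]
        rw [mul_assoc (refl b i)]
        have := hup _ hia y hy
        rw [mul_assoc] at this
        exact hsec _ (hup a ha y hy) i (Or.inl hi) this p⟩, fun q => by
      by_cases ha : Above b Ψ₁ x (q.1 * x)
      · simp only [if_pos ha]; exact (hm _ (hup _ ha y hy)).2 _
      · simp only [if_neg ha]; exact zero_mem _⟩)
    (fun y hy j hj hjy q => by
      by_cases ha : Above b Ψ₁ x (q.1 * x)
      · simp only [if_pos ha]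
        have h1 := ha.refl_comm h hj y
        have h2 := hup _ ha _ hjy
        rw [mul_inv_cancel_right] at h1
        rw [h1] at h2 ⊢
        exact hsec _ (hup _ ha y hy) j (Or.inr hj) h2 _
      · simp [if_neg ha])
  -- corrections by elements of `A` divisible by the labels from `Ψ₂` of the edges at `x`
  let A₁ : Submodule S (I → S) :=
    { carrier := {v | v ∈ A ∧ ∀ j ∈ Ψ₂, length b x < length b (refl b j * x) → ∀ p, R.c j ∣ v p}
      zero_mem' := ⟨A.zero_mem, fun _ _ _ _ => dvd_zero _⟩
      add_mem' := fun hf hg => ⟨A.add_mem hf.1 hg.1, fun j hj hjx p =>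
        dvd_add (hf.2 j hj hjx p) (hg.2 j hj hjx p)⟩
      smul_mem' := fun r f hf => ⟨A.smul_mem r hf.1, fun j hj hjx p =>
        (hf.2 j hj hjx p).mul_left r⟩ }
  have hA₁ : IsValueModule R Ψ₁ A₁ := by
    refine ⟨fun i hi v hv => ⟨hA.σ_mem i (Or.inl hi) _ hv.1, fun j hj hjx p => ?_⟩,
      fun i hi v hv => ⟨hA.mem_of_mul_mem i (Or.inl hi) _ hv.1, fun j hj hjx p => ?_⟩⟩
    · have := map_dvd (R.σ i) (hv.2 j hj hjx p)
      rwa [R.σ_eq_of_pairing_eq_zero (h i hi j hj).2] at this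
    · exact hc₁ i hi j hj _ (hv.2 j hj hjx p)
  have hax : ∀ y, Above b Ψ₁ x y → Above b Ψ₁ x (y * x⁻¹ * x) := fun y hy => by
    rwa [inv_mul_cancel_right]
  obtain ⟨v, hvA, hvF, hv⟩ := h₁ I A₁ hA₁ n x (fun y p => m y p - u (y * x⁻¹, p))
    (fun y hy => ⟨⟨A.sub_mem (hm y (StrictlyAbove.mono Set.subset_union_left hy)).1
        (huA _ (hax y hy.1)).1, fun j hj hjx p => by
          have h1 := hu j hj hjx (y * x⁻¹, p)
          simp only [if_pos (hax y hy.1)] at h1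
          rw [hy.1.refl_comm h hj, inv_mul_cancel_right] at h1
          have h2 := StrictlyAbove.mul_left h hy.1 (StrictlyAbove.step hj hjx)
          rw [hy.1.refl_comm h hj, inv_mul_cancel_right] at h2
          have h3 := hsec y (StrictlyAbove.mono Set.subset_union_left hy) j (Or.inr hj) h2 p
          convert dvd_sub h3 h1 using 1; ring⟩,
      fun p => (R.F n).sub_mem ((hm y (StrictlyAbove.mono Set.subset_union_left hy)).2 p)
        (huF _)⟩)
    (fun y hy i hi hiy p => by
      have h1 := hsec y (StrictlyAbove.mono Set.subset_union_left hy) i (Or.inl hi)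
        (StrictlyAbove.mono Set.subset_union_left hiy) p
      have h2 := (huA _ (hax y hy.1)).2 i hi (by
        simpa [mul_assoc] using hiy.1) p
      rw [← mul_assoc] at h2
      convert dvd_sub h1 h2 using 1; ring)
  have h1x : Above b Ψ₁ x (1 * x) := by rw [one_mul]; exact Relation.ReflTransGen.refl
  refine ⟨fun p => u (1, p) + v p, A.add_mem (huA 1 h1x).1 hvA.1,
    fun p => (R.F n).add_mem (huF _) (hvF p), ?_⟩
  rintro i (hi | hi) hix p
  · have h1 := hv i hi hix p
    rw [mul_inv_cancel_right] at h1
    have h2 := (huA 1 h1x).2 i hi (by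
      rw [mul_one]; exact (StrictlyAbove.step hi hix).1) p
    rw [mul_one] at h2
    convert dvd_add h1 h2 using 1; ring
  · have h1 := hu i hi hix (1, p)
    rw [if_pos h1x, one_mul] at h1
    convert dvd_add h1 (hvA.2 i hi hix p) using 1; ring

/-! ### Unions of components -/

/-- A set of roots that is orthogonal to its complement, i.e. a union of components. -/
def IsUnion (Ψ : Set ι) : Prop := Orthogonal (P := P) Ψ Ψᶜ

theorem IsUnion.mem_of_pairing_ne_zero {Ψ : Set ι} (h : IsUnion (P := P) Ψ) {i j : ι}
    (hi : i ∈ Ψ) (hij : P.pairing i j ≠ 0) : j ∈ Ψ :=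
  by_contra fun hj => hij (h i hi j hj).1

theorem IsUnion.reflClosed {Ψ : Set ι} (h : IsUnion (P := P) Ψ) : ReflClosed (P := P) Ψ := by
  intro i hi j hj
  by_contra hk
  have h1 := (h i hi _ hk).1
  have h2 := (h j hj _ hk).1
  have h3 := P.pairing_same (P.reflectionPerm i j)
  have h4 : P.pairing (P.reflectionPerm i j) (P.reflectionPerm i j) =
      P.pairing j (P.reflectionPerm i j) -
        P.pairing j i * P.pairing i (P.reflectionPerm i j) := by
    rw [← P.root_coroot_eq_pairing, P.root_reflectionPerm, P.reflection_apply_root]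
    simp only [map_sub, map_smul, LinearMap.sub_apply, LinearMap.smul_apply, smul_eq_mul,
      P.root_coroot_eq_pairing]
  rw [h3, h1, h2, mul_zero, sub_zero] at h4
  exact two_ne_zero h4

theorem IsUnion.mem_of_root_eq_add {Ψ : Set ι} (h : IsUnion (P := P) Ψ) {i j k : ι}
    (hk : P.root k = P.root i + P.root j) (hkΨ : k ∈ Ψ) : i ∈ Ψ ∧ j ∈ Ψ := by
  have e : ∀ l, P.pairing k l = P.pairing i l + P.pairing j l := fun l => by
    simp only [RootPairing.pairing, RootPairing.root', hk, map_add, LinearMap.add_apply]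
  by_cases hiΨ : i ∈ Ψ <;> by_cases hjΨ : j ∈ Ψ
  · exact ⟨hiΨ, hjΨ⟩
  · have h1 := e j
    rw [(h k hkΨ j hjΨ).1, (h i hiΨ j hjΨ).1, P.pairing_same, zero_add] at h1
    exact absurd h1.symm two_ne_zero
  · have h1 := e i
    rw [(h k hkΨ i hiΨ).1, (h j hjΨ i hiΨ).1, P.pairing_same, add_zero] at h1
    exact absurd h1.symm two_ne_zero
  · have h1 := e k
    rw [(h k hkΨ i hiΨ).2, (h k hkΨ j hjΨ).2, P.pairing_same, add_zero] at h1
    exact absurd h1 two_ne_zero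

/-- If a root from `Ψ` is an ascent of `x` then so is a simple root from `Ψ`. -/
theorem IsUnion.exists_simple_ascent {Ψ : Set ι} (h : IsUnion (P := P) Ψ) {i : ι} (hi : i ∈ Ψ)
    (hx : length b x < length b (refl b i * x)) :
    ∃ s ∈ b.support, s ∈ Ψ ∧ length b x < length b (refl b s * x) := by
  wlog hpos : b.IsPos i generalizing i
  · refine this (i := P.reflectionPerm i i) (h.reflClosed i hi i hi) ?_
      ((isPos_reflectionPerm_self b i).2 hpos)
    rwa [refl_reflectionPerm_self]
  rw [length_lt_iff b hpos] at hx
  by_contra! hcon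
  have hs : ∀ s ∈ b.support, s ∈ Ψ → ¬ b.IsPos (toPerm b x⁻¹ s) := fun s hs hsΨ hp =>
    (hcon s hs hsΨ).not_gt (lt_length_refl_mul b (RootPairing.Base.isPos_of_mem_support hs) hp)
  refine hpos.induction_on_add (p := fun i => i ∈ Ψ → ¬ b.IsPos (toPerm b x⁻¹ i)) hs ?_ hi hx
  intro i j k hk ih hj hkΨ
  have hmem := h.mem_of_root_eq_add hk hkΨ
  have h1 := ih hmem.1
  have h2 := hs j hj hmem.2
  rw [RootPairing.Base.isPos_iff] at h1 h2 ⊢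
  rw [b.height_add (i := toPerm b x⁻¹ i) (j := toPerm b x⁻¹ j)
    (by rw [root_toPerm, root_toPerm, root_toPerm, hk, map_add])]
  omega

end BruhatGraph

/-! ### Components of type `G₂` -/

namespace BruhatGraph

universe u₁ u₂ u₃ u₄

variable {ι : Type u₁} {K : Type u₂} {M : Type u₃} {N : Type u₄} [Field K] [AddCommGroup M]
  [Module K M] [AddCommGroup N] [Module K N] {P : RootPairing ι K M N}
variable [CharZero K] [Finite ι] [P.IsRootSystem] [P.IsCrystallographic] [P.IsReduced]

/-- The roots generated by `l` and `t`, if these are the short and the long simple root of a root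
system of type `G₂`. -/
def g2Roots (P : RootPairing ι K M N) (l t : ι) : Set ι :=
  {i | ∃ j ∈ [l, t, P.reflectionPerm l t, P.reflectionPerm t l,
    P.reflectionPerm l (P.reflectionPerm t l), P.reflectionPerm t (P.reflectionPerm l t)],
    i = j ∨ i = P.reflectionPerm j j}

section

variable {l t : ι} (h : P.pairingIn ℤ t l = -3)
include h

theorem pairing_eq_neg_three : P.pairing t l = -3 := by
  rw [← P.algebraMap_pairingIn ℤ, h]; simp

theorem pairingIn_eq_neg_one : P.pairingIn ℤ l t = -1 := by
  have := P.pairingIn_pairingIn_mem_set_of_isCrystal_of_isRed t l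
  aesop

theorem pairing_eq_neg_one : P.pairing l t = -1 := by
  rw [← P.algebraMap_pairingIn ℤ, pairingIn_eq_neg_one h]; simp

theorem root_lt : P.root (P.reflectionPerm l t) = 3 • P.root l + 1 • P.root t := by
  rw [P.root_reflectionPerm, P.reflection_apply_root, pairing_eq_neg_three h]
  module

theorem root_tl : P.root (P.reflectionPerm t l) = 1 • P.root l + 1 • P.root t := by
  rw [P.root_reflectionPerm, P.reflection_apply_root, pairing_eq_neg_one h]
  module

theorem root_ltl : P.root (P.reflectionPerm l (P.reflectionPerm t l)) =
    2 • P.root l + 1 • P.root t := by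
  rw [P.root_reflectionPerm, root_tl h, map_add, map_nsmul, map_nsmul, P.reflection_apply_root,
    P.reflection_apply_root, pairing_eq_neg_three h, P.pairing_same]
  module

theorem root_tlt : P.root (P.reflectionPerm t (P.reflectionPerm l t)) =
    3 • P.root l + 2 • P.root t := by
  rw [P.root_reflectionPerm, root_lt h, map_add, map_nsmul, map_nsmul, P.reflection_apply_root,
    P.reflection_apply_root, pairing_eq_neg_one h, P.pairing_same]
  module

/-- The set `g2Roots P l t` consists of the twelve roots of the `G₂` spanned by `l` and `t`. -/
theorem mem_g2Roots_iff {i : ι} : i ∈ g2Roots P l t ↔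
    letI : P.EmbeddedG2 := ⟨t, l, h⟩
    P.root i ∈ RootPairing.EmbeddedG2.allRoots P := by
  let _ : P.EmbeddedG2 := ⟨t, l, h⟩
  simp only [g2Roots, Set.mem_ofPred_eq, List.mem_cons, List.not_mem_nil, or_false,
    ← P.root_eq_neg_iff, EmbeddingLike.apply_eq_iff_eq, exists_eq_or_imp, exists_eq_left]
  change _ ↔ i = t ∨ P.root i = - P.root t ∨ i = l ∨ P.root i = - P.root l ∨
    i = P.reflectionPerm t l ∨ P.root i = - P.root (P.reflectionPerm t l) ∨
    i = P.reflectionPerm l (P.reflectionPerm t l) ∨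
      P.root i = - P.root (P.reflectionPerm l (P.reflectionPerm t l)) ∨
    i = P.reflectionPerm l t ∨ P.root i = - P.root (P.reflectionPerm l t) ∨
    i = P.reflectionPerm t (P.reflectionPerm l t) ∨
      P.root i = - P.root (P.reflectionPerm t (P.reflectionPerm l t))
  tauto

omit h in
theorem height_toPerm (b : P.Base) (w : Weyl b) {i j k : ι} (z : ℤ)
    (hk : P.root k = P.root i + z • P.root j) :
    b.height (toPerm b w k) = b.height (toPerm b w i) + z * b.height (toPerm b w j) := by
  rw [b.height_add_zsmul (i := toPerm b w i) (j := toPerm b w j) (z := z), smul_eq_mul]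
  rw [root_toPerm, root_toPerm, root_toPerm, hk, map_add, map_zsmul]

theorem height_lt (b : P.Base) (w : Weyl b) : b.height (toPerm b w (P.reflectionPerm l t)) =
    3 * b.height (toPerm b w l) + b.height (toPerm b w t) := by
  rw [height_toPerm b w (i := t) (j := l) 3 (by rw [root_lt h]; module)]; ring

theorem height_tl (b : P.Base) (w : Weyl b) : b.height (toPerm b w (P.reflectionPerm t l)) =
    b.height (toPerm b w l) + b.height (toPerm b w t) := by
  rw [height_toPerm b w (i := t) (j := l) 1 (by rw [root_tl h]; module)]; ring

theorem height_ltl (b : P.Base) (w : Weyl b) :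
    b.height (toPerm b w (P.reflectionPerm l (P.reflectionPerm t l))) =
      2 * b.height (toPerm b w l) + b.height (toPerm b w t) := by
  rw [height_toPerm b w (i := t) (j := l) 2 (by rw [root_ltl h]; module)]; ring

theorem height_tlt (b : P.Base) (w : Weyl b) :
    b.height (toPerm b w (P.reflectionPerm t (P.reflectionPerm l t))) =
      3 * b.height (toPerm b w l) + 2 * b.height (toPerm b w t) := by
  rw [height_toPerm b w (i := P.reflectionPerm l t) (j := t) 1
    (by rw [root_tlt h, root_lt h]; module), height_lt h]; ring

/-- Up to sign, the roots of the `G₂` are combinations of `l` and `t` with coefficients in `ℕ`. -/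
theorem coeff_of_mem_g2Roots (b : P.Base) {i : ι} (hi : i ∈ g2Roots P l t) :
    ∃ (j : ι) (u v : ℕ), P.root j = u • P.root l + v • P.root t ∧
      b.height j = u * b.height l + v * b.height t ∧ (i = j ∨ i = P.reflectionPerm j j) := by
  obtain ⟨j, hj, hij⟩ := hi
  simp only [List.mem_cons, List.not_mem_nil, or_false] at hj
  rcases hj with rfl | rfl | rfl | rfl | rfl | rfl
  · exact ⟨j, 1, 0, by simp, by simp, hij⟩
  · exact ⟨j, 0, 1, by simp, by simp, hij⟩
  · exact ⟨_, 3, 1, root_lt h, by simpa using height_lt h b 1, hij⟩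
  · exact ⟨_, 1, 1, root_tl h, by simpa using height_tl h b 1, hij⟩
  · exact ⟨_, 2, 1, root_ltl h, by simpa using height_ltl h b 1, hij⟩
  · exact ⟨_, 3, 2, root_tlt h, by simpa using height_tlt h b 1, hij⟩

/-- A subsystem of type `G₂` is a component: every other root is orthogonal to it. -/
theorem isUnion_g2Roots (b : P.Base) : IsUnion (P := P) (g2Roots P l t) := by
  intro i hi j hj
  have hr : Module.IsReflexive K M := .of_isPerfPair P.toLinearMap
  obtain ⟨h1, h2⟩ : P.IsOrthogonal j l ∧ P.IsOrthogonal j t := by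
    let _ : P.EmbeddedG2 := ⟨t, l, h⟩
    exact RootPairing.EmbeddedG2.isOrthogonal_short_and_long P
      (fun h0 => hj ((mem_g2Roots_iff h).2 h0))
  obtain ⟨i', u, v, h4, -, hi'⟩ := coeff_of_mem_g2Roots h b hi
  have h3 : P.pairing i' j = 0 := by
    rw [← P.root_coroot_eq_pairing, h4]
    simp [h1.2, h2.2]
  have h5 : P.pairing i j = 0 := by
    rcases hi' with rfl | rfl
    · exact h3
    · rw [P.pairing_reflectionPerm_self_left, h3, neg_zero]
  exact ⟨h5, (P.pairing_eq_zero_iff).1 h5⟩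

/-- No root has pairing `-3` with the long root of a `G₂`. -/
theorem pairingIn_long_ne_neg_three (b : P.Base) (d : ι) : P.pairingIn ℤ d t ≠ -3 := by
  intro h0
  have h1 := pairing_eq_neg_three h0
  have h2 := pairing_eq_neg_one h
  by_cases hd : d ∈ g2Roots P l t
  · obtain ⟨j, hj, hij⟩ := hd
    have h3 : P.pairing j t = 3 ∨ P.pairing j t = -3 := by
      rcases hij with rfl | rfl
      · exact Or.inr h1
      · rw [P.pairing_reflectionPerm_self_left] at h1
        exact Or.inl (neg_injective h1)
    simp only [List.mem_cons, List.not_mem_nil, or_false] at hj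
    rcases hj with rfl | rfl | rfl | rfl | rfl | rfl
    all_goals
      rw [← P.root_coroot_eq_pairing] at h3
      simp only [root_lt h, root_tl h, root_ltl h, root_tlt h, map_add, map_nsmul,
        LinearMap.add_apply, LinearMap.smul_apply, P.root_coroot_eq_pairing, h2,
        P.pairing_same] at h3
      norm_num at h3
  · rw [(isUnion_g2Roots h b t ⟨t, by simp, Or.inl rfl⟩ d hd).2] at h1
    norm_num at h1

variable (b : P.Base)

theorem coeff_of_isPos (hl : b.IsPos l) (ht : b.IsPos t) {i : ι} (hi : i ∈ g2Roots P l t)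
    (hp : b.IsPos i) : ∃ u v : ℕ, P.root i = u • P.root l + v • P.root t := by
  obtain ⟨j, u, v, h1, h2, rfl | rfl⟩ := coeff_of_mem_g2Roots h b hi
  · exact ⟨u, v, h1⟩
  · rw [isPos_reflectionPerm_self, RootPairing.Base.isPos_iff, h2] at hp
    rw [RootPairing.Base.isPos_iff] at hl ht
    have h3 : u = 0 ∧ v = 0 := by
      constructor
      · by_contra h0
        have : 0 < (u : ℤ) := by omega
        exact hp (by positivity)
      · by_contra h0
        have : 0 < (v : ℤ) := by omega
        exact hp (by positivity)
    rw [h3.1, h3.2, zero_smul, zero_smul, add_zero] at h1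
    exact absurd h1 (P.ne_zero j)

/-- If the two simple roots of a `G₂` are positive for `b`, then the long one is simple for `b`. -/
theorem mem_support_of_pairingIn_eq_neg_three (hl : b.IsPos l) (ht : b.IsPos t) :
    t ∈ b.support := by
  -- otherwise `t` is a sum of two positive roots in the span of `l` and `t`
  by_contra hn
  have key : ∃ i j, b.IsPos i ∧ b.IsPos j ∧ P.root t = P.root i + P.root j := by
    refine (ht.induction_on_add (p := fun t => b.IsPos t ∧ (t ∉ b.support → ∃ i j, b.IsPos i ∧
      b.IsPos j ∧ P.root t = P.root i + P.root j)) ?_ ?_).2 hn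
    · exact fun i hi => ⟨RootPairing.Base.isPos_of_mem_support hi, fun hn => absurd hi hn⟩
    · intro i j k hk ih hj
      have hj' := RootPairing.Base.isPos_of_mem_support hj
      exact ⟨ih.1.add hj' hk, fun _ => ⟨i, j, ih.1, hj', hk⟩⟩
  obtain ⟨i, j, hi, hj, hij⟩ := key
  have hjm := (isUnion_g2Roots h b).mem_of_root_eq_add hij ⟨t, by simp, Or.inl rfl⟩
  obtain ⟨u, v, huv⟩ := coeff_of_isPos h b hl ht hjm.1 hi
  obtain ⟨u', v', huv'⟩ := coeff_of_isPos h b hl ht hjm.2 hj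
  have hli : LinearIndependent K ![P.root l, P.root t] := by
    let _ : P.EmbeddedG2 := ⟨t, l, h⟩
    exact RootPairing.EmbeddedG2.linearIndependent_short_long P
  rw [LinearIndependent.pair_iff] at hli
  have h5 := hli (u + u' : K) (v + v' - 1 : K) (by
    rw [huv, huv'] at hij
    exact Eq.trans (by module) (sub_eq_zero.2 hij.symm))
  have h6 : u + u' = 0 := by exact_mod_cast h5.1
  have h7 : v + v' = 1 := by
    have := sub_eq_zero.1 h5.2
    exact_mod_cast this
  have h8 : (u = 0 ∧ v = 0) ∨ (u' = 0 ∧ v' = 0) := by omega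
  rcases h8 with ⟨rfl, rfl⟩ | ⟨rfl, rfl⟩
  · exact P.ne_zero i (by simpa using huv)
  · exact P.ne_zero j (by simpa using huv')

end

/-- A simple root is the short simple root of a `G₂` as soon as some root pairs with it to `-3`. -/
theorem exists_simple_pairingIn_eq_neg_three (b : P.Base) {l : ι} (hl : l ∈ b.support)
    (h : ∃ d, P.pairingIn ℤ d l = -3) : ∃ t ∈ b.support, P.pairingIn ℤ t l = -3 := by
  have hl' := RootPairing.Base.isPos_of_mem_support hl
  obtain ⟨d, hd⟩ := h
  by_cases hp : b.IsPos d
  · exact ⟨d, mem_support_of_pairingIn_eq_neg_three hd b hl' hp, hd⟩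
  · have h1 : P.pairing (P.reflectionPerm l (P.reflectionPerm d d)) l = -3 := by
      rw [← P.pairing_reflectionPerm, P.pairing_reflectionPerm_self_right,
        P.pairing_reflectionPerm_self_left, pairing_eq_neg_three hd, neg_neg]
    have h2 : P.pairingIn ℤ (P.reflectionPerm l (P.reflectionPerm d d)) l = -3 := by
      apply FaithfulSMul.algebraMap_injective ℤ K
      rw [P.algebraMap_pairingIn, h1]; simp
    refine ⟨_, mem_support_of_pairingIn_eq_neg_three h2 b hl' ?_, h2⟩
    refine ((isPos_reflectionPerm_self b d).2 hp).reflectionPerm hl ?_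
    intro h0
    have h3 : P.pairing (P.reflectionPerm d d) l = 3 := by
      rw [P.pairing_reflectionPerm_self_left, pairing_eq_neg_three hd, neg_neg]
    rw [h0, P.pairing_same] at h3
    norm_num at h3

end BruhatGraph

/-! ### Extension of sections in type `G₂` -/

namespace BruhatGraph

universe u₁ u₂ u₃ u₄

variable {ι : Type u₁} {K : Type u₂} {M : Type u₃} {N : Type u₄} [Field K] [AddCommGroup M]
  [Module K M] [AddCommGroup N] [Module K N] {P : RootPairing ι K M N}
variable [CharZero K] [Finite ι] [P.IsRootSystem] [P.IsCrystallographic] [P.IsReduced]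
variable {S : Type*} [CommRing S] {R : CorootRing P S}

/-- The coprimality of coroots that the extension of sections relies on. In the second condition `s`
is not the short simple root of a `G₂`; in the third one, `l` and `t` are the short and the long
simple root of a `G₂`, and the listed pairs of coroots are linearly independent in every residue
characteristic other than two. -/
structure CorootRing.HasCoprimality (R : CorootRing P S) (b : P.Base) : Prop where
  coprime_of_pairing_eq_zero : ∀ i j, P.pairing i j = 0 → R.Coprime i j
  coprime_of_simple : ∀ s ∈ b.support, (∀ d, P.pairingIn ℤ d s ≠ -3) →
    ∀ i, i ≠ s → i ≠ P.reflectionPerm s s → R.Coprime s i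
  coprime_of_g2 : ∀ l t, P.pairingIn ℤ t l = -3 →
    R.Coprime l (P.reflectionPerm l t) ∧
    R.Coprime l (P.reflectionPerm t (P.reflectionPerm l t)) ∧
    R.Coprime (P.reflectionPerm l t) (P.reflectionPerm l (P.reflectionPerm t l)) ∧
    R.Coprime (P.reflectionPerm l t) (P.reflectionPerm t (P.reflectionPerm l t))

/-- Difference quotients are invariant under the reflection. -/
theorem CorootRing.σ_delta (R : CorootRing P S) {i : ι} {v q : S}
    (h : v - R.σ i v = R.c i * q) : R.σ i q = q := by
  rw [← sub_eq_zero]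
  refine R.eq_zero_of_mul i _ ?_
  have h1 := congrArg (R.σ i) h
  rw [map_sub, R.σ_σ, map_mul, R.σ_c, R.c_neg] at h1
  linear_combination h1 + h

section Coroots

variable {l t : ι} (h : P.pairingIn ℤ t l = -3)
include h

theorem CorootRing.c_lt (R : CorootRing P S) : R.c (P.reflectionPerm l t) = R.c l + R.c t := by
  rw [R.c_reflectionPerm, pairingIn_eq_neg_one h]; simp [add_comm]

theorem CorootRing.c_tl (R : CorootRing P S) :
    R.c (P.reflectionPerm t l) = R.c l + 3 * R.c t := by
  rw [R.c_reflectionPerm, h]; simp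

theorem CorootRing.c_ltl (R : CorootRing P S) :
    R.c (P.reflectionPerm l (P.reflectionPerm t l)) = 2 * R.c l + 3 * R.c t := by
  rw [← R.σ_c, R.c_tl h, map_add, map_mul, map_ofNat, R.σ_c, R.σ_c, R.c_neg, R.c_lt h]
  ring

theorem CorootRing.c_tlt (R : CorootRing P S) :
    R.c (P.reflectionPerm t (P.reflectionPerm l t)) = R.c l + 2 * R.c t := by
  rw [← R.σ_c, R.c_lt h, map_add, R.σ_c, R.σ_c, R.c_neg, R.c_tl h]
  ring

end Coroots

/-- The congruences solved by the value at `x` of a divided difference in type `G₂`, in terms of the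
short simple coroot `a` and the long one `b`; primes denote images under the reflection in `a`. -/
theorem g2_congruences {a b D D' c c' e e' g g' δD δc δe δg : S} (hD : D - D' = a * δD)
    (hc : c - c' = a * δc) (he : e - e' = a * δe) (hg : g - g' = a * δg) {d : S}
    (hd : d = D + (a + b) * c + (a + 2 * b) * e' +
      (a + b) * (a + 2 * b) * (3 * δe + (2 * a + 3 * b) * δg)) :
    (a + b ∣ d - (D + b * e')) ∧ (a + 2 * b ∣ d - (D + (a + b) * c)) ∧
    (2 * a + 3 * b ∣ 3 * (e - c - 3 * δD) → 2 * a + 3 * b ∣ 3 * (d - D')) ∧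
    (a + 3 * b ∣ 3 * (e' - c' - 3 * δD) → a + 3 * b ∣ 3 * (3 * δc - g') →
      a + 3 * b ∣ 3 * (d - (D' + (a + 2 * b) * c' + (a + b) * e +
        (a + b) * (a + 2 * b) * g))) := by
  subst hd
  obtain rfl : D = D' + a * δD := by rw [← hD]; ring
  obtain rfl : c = c' + a * δc := by rw [← hc]; ring
  obtain rfl : e = e' + a * δe := by rw [← he]; ring
  obtain rfl : g = g' + a * δg := by rw [← hg]; ring
  refine ⟨⟨(c' + a * δc) + e' + (a + 2 * b) * (3 * δe + (2 * a + 3 * b) * δg), by ring⟩,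
    ⟨e' + (a + b) * (3 * δe + (2 * a + 3 * b) * δg), by ring⟩, ?_, ?_⟩
  · rintro ⟨w, hw⟩
    refine ⟨-(a + b) * w + (-3 * δD + 3 * e' + 6 * (a + b) * δe +
      3 * (a + b) * (a + 2 * b) * δg), ?_⟩
    linear_combination (-(a + b)) * hw
  · rintro ⟨w, hw⟩ ⟨v, hv⟩
    refine ⟨b * w + 2 * b ^ 2 * v + 3 * (δD + ((a + 3 * b) - 5 * b) * (δc - δe) +
      a * (3 * δe - g') + (a + b) * (a + 2 * b) * δg), ?_⟩
    linear_combination b * hw + 2 * b ^ 2 * hv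

/-- Up to factors `a + b`, which are coprime to `2 a + 3 b`, a congruence between two values modulo
the coroot `2 a + 3 b` becomes one between their coefficients. -/
theorem g2_weak_short {a b B C D D' c e δD : S} (hD : D - D' = a * δD)
    (hB : B = D' + (a + b) * e) (hC : C = D + (a + b) * c)
    (h : 2 * a + 3 * b ∣ a * (B - C)) :
    2 * a + 3 * b ∣ (a + b) * ((a + b) * (3 * (e - c - 3 * δD))) := by
  obtain ⟨w, hw⟩ := h
  obtain rfl : D = D' + a * δD := by rw [← hD]; ring
  subst hB hC
  refine ⟨w + ((D' + (a + b) * e - (D' + a * δD + (a + b) * c)) - 3 * (a + b) * δD), ?_⟩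
  linear_combination hw

/-- The analogue of `g2_weak_short` for the value with all four coefficients. -/
theorem g2_weak_long {a b A D D' c c' e g δD δc : S} (hD : D - D' = a * δD)
    (hc : c - c' = a * δc)
    (hA : A = D' + (a + 2 * b) * c' + (a + b) * e + (a + b) * (a + 2 * b) * g)
    (h₁ : 2 * a + 3 * b ∣ 3 * (e - c - 3 * δD)) (h₂ : 2 * a + 3 * b ∣ a * (A - D)) :
    2 * a + 3 * b ∣ (a + b) * ((a + b) * ((a + b) * (3 * (3 * δc - g)))) := by
  obtain ⟨w, hw⟩ := h₁
  obtain ⟨v, hv⟩ := h₂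
  obtain rfl : D = D' + a * δD := by rw [← hD]; ring
  obtain rfl : c = c' + a * δc := by rw [← hc]; ring
  refine ⟨v + ((A - (D' + a * δD)) - 3 * (a + b) * (δD + (c' + a * δc) -
    (a + (a + b)) * δc + (a + b) * g)) - (a + b) ^ 2 * w, ?_⟩
  subst hA
  linear_combination hv - (a + b) ^ 2 * hw

section Solution

variable {l t : ι} (h : P.pairingIn ℤ t l = -3) {I : Type*} {A : Submodule S (I → S)}
include h

omit h in
/-- The difference quotient `(v - s v) / c` for the reflection `s` in the root `l`. -/
theorem IsValueModule.exists_delta {Ψ : Set ι} (hA : IsValueModule R Ψ A) (hl : l ∈ Ψ) {n : ℤ}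
    {v : I → S} (hv : v ∈ A) (hn : ∀ p, v p ∈ R.F (n + 1)) :
    ∃ q ∈ A, (∀ p, q p ∈ R.F n) ∧ ∀ p, v p - R.σ l (v p) = R.c l * q p :=
  hA.exists_quotient hl (v := fun p => v p - R.σ l (v p)) (A.sub_mem hv (hA.σ_mem l hl _ hv))
    (fun p => (R.F _).sub_mem (hn p) (R.σ_mem l _ _ (hn p))) (fun _ => R.dvd_sub_σ l _)

omit h in
theorem mem_g2Roots_short : l ∈ g2Roots P l t := ⟨l, by simp, Or.inl rfl⟩

/-- A simultaneous solution of the congruences at `x` in type `G₂`. -/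
theorem exists_g2_solution (hA : IsValueModule R (g2Roots P l t) A) {n : ℤ}
    {D c e g δD δc : I → S} (hDA : D ∈ A) (hDn : ∀ p, D p ∈ R.F (n + 3)) (hcA : c ∈ A)
    (hcn : ∀ p, c p ∈ R.F (n + 2)) (heA : e ∈ A) (hen : ∀ p, e p ∈ R.F (n + 2)) (hgA : g ∈ A)
    (hgn : ∀ p, g p ∈ R.F (n + 1)) (hδD : ∀ p, D p - R.σ l (D p) = R.c l * δD p)
    (hδc : ∀ p, c p - R.σ l (c p) = R.c l * δc p) :
    ∃ d ∈ A, (∀ p, d p ∈ R.F (n + 3)) ∧ ∀ p,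
      (R.c (P.reflectionPerm l t) ∣ d p - (D p + R.c t * R.σ l (e p))) ∧
      (R.c (P.reflectionPerm t (P.reflectionPerm l t)) ∣
        d p - (D p + R.c (P.reflectionPerm l t) * c p)) ∧
      (R.c (P.reflectionPerm l (P.reflectionPerm t l)) ∣ 3 * (e p - c p - 3 * δD p) →
        R.c (P.reflectionPerm l (P.reflectionPerm t l)) ∣ 3 * (d p - R.σ l (D p)) ∧
        (R.c (P.reflectionPerm l (P.reflectionPerm t l)) ∣ 3 * (3 * δc p - g p) →
          R.c (P.reflectionPerm t l) ∣ 3 * (d p - (R.σ l (D p) +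
            R.c (P.reflectionPerm t (P.reflectionPerm l t)) * R.σ l (c p) +
            R.c (P.reflectionPerm l t) * e p + R.c (P.reflectionPerm l t) *
            R.c (P.reflectionPerm t (P.reflectionPerm l t)) * g p)))) := by
  have hl : l ∈ g2Roots P l t := mem_g2Roots_short
  obtain ⟨δe, hδeA, hδen, hδe⟩ := hA.exists_delta hl (n := n + 1) heA
    (by convert hen using 3; ring)
  obtain ⟨δg, hδgA, hδgn, hδg⟩ := hA.exists_delta hl hgA hgn
  have hmul := fun (i : ι) (k : ℤ) (f : S) (hf : f ∈ R.F k) => R.mul_mem i k f hf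
  refine ⟨fun p => D p + R.c (P.reflectionPerm l t) * c p +
    R.c (P.reflectionPerm t (P.reflectionPerm l t)) * R.σ l (e p) +
    R.c (P.reflectionPerm l t) * (R.c (P.reflectionPerm t (P.reflectionPerm l t)) *
      (3 * δe p + R.c (P.reflectionPerm l (P.reflectionPerm t l)) * δg p)), ?_, fun p => ?_,
    fun p => ?_⟩
  · exact A.add_mem (A.add_mem (A.add_mem hDA (hA.mul_mem _ hcA))
      (hA.mul_mem _ (hA.σ_mem l hl _ heA))) (hA.mul_mem _ (hA.mul_mem _
      (A.add_mem (hA.mul_mem _ hδeA) (hA.mul_mem _ hδgA))))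
  · have e1 : n + 3 = n + 2 + 1 := by ring
    have e2 : n + 2 = n + 1 + 1 := by ring
    have h3 : 3 * δe p ∈ R.F (n + 1) := by
      have := (R.F (n + 1)).nsmul_mem (hδen p) 3
      rwa [nsmul_eq_mul] at this
    refine (R.F _).add_mem ((R.F _).add_mem ((R.F _).add_mem (hDn p) ?_) ?_) ?_
    · rw [e1]; exact hmul _ _ _ (hcn p)
    · rw [e1]; exact hmul _ _ _ (R.σ_mem _ _ _ (hen p))
    · rw [e1]; refine hmul _ _ _ ?_
      rw [e2]; refine hmul _ _ _ ((R.F _).add_mem h3 (hmul _ _ _ (hδgn p)))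
  · obtain ⟨h1, h2, h3, h4⟩ := g2_congruences (b := R.c t) (hδD p) (hδc p) (hδe p) (hδg p) rfl
    simp only [R.c_lt h, R.c_tl h, R.c_ltl h, R.c_tlt h]
    have hσ : R.σ l (2 * R.c l + 3 * R.c t) = R.c l + 3 * R.c t := by
      rw [← R.c_ltl h, ← R.c_tl h, R.σ_c, P.reflectionPerm_self]
    rw [← mul_assoc (R.c l + R.c t)]
    refine ⟨h1, h2, fun hw => ⟨h3 hw, fun hw' => h4 ?_ ?_⟩⟩
    · have h5 := map_dvd (R.σ l) hw
      rw [hσ, map_mul, map_sub, map_sub, map_mul, map_ofNat, R.σ_delta (hδD p)] at h5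
      exact h5
    · have h5 := map_dvd (R.σ l) hw'
      rw [hσ, map_mul, map_sub, map_mul, map_ofNat, R.σ_delta (hδc p)] at h5
      exact h5

omit h in
theorem refl_reflectionPerm_mul (b : P.Base) (i j : ι) (y : Weyl b) :
    refl b (P.reflectionPerm i j) * y = refl b i * (refl b j * (refl b i * y)) := by
  rw [refl_mul_comm, refl_mul_cancel_left]

/-- The braid relation of type `G₂`. -/
theorem g2_braid (b : P.Base) (y : Weyl b) :
    refl b l * (refl b t * (refl b l * (refl b t * (refl b l * (refl b t * y))))) =
      refl b t * (refl b l * (refl b t * (refl b l * (refl b t * (refl b l * y))))) := by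
  have h1 : P.reflectionPerm l (P.reflectionPerm t (P.reflectionPerm l t)) =
      P.reflectionPerm t (P.reflectionPerm l t) := by
    apply P.root.injective
    rw [P.root_reflectionPerm, root_tlt h, map_add, map_nsmul, map_nsmul, P.reflection_apply_root,
      P.reflection_apply_root, pairing_eq_neg_three h, P.pairing_same]
    module
  have h2 := refl_reflectionPerm_mul b l (P.reflectionPerm t (P.reflectionPerm l t)) (refl b l * y)
  rw [h1, refl_mul_cancel_left] at h2
  simpa [refl_reflectionPerm_mul] using h2.symm

/-- A root in which `t` occurs is not proportional to `l`. -/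
theorem ne_of_root_eq {i : ι} {u v : ℕ} (hi : P.root i = u • P.root l + v • P.root t)
    (hv : v ≠ 0) : i ≠ l ∧ i ≠ P.reflectionPerm l l := by
  have hli : LinearIndependent K ![P.root l, P.root t] := by
    let _ : P.EmbeddedG2 := ⟨t, l, h⟩
    exact RootPairing.EmbeddedG2.linearIndependent_short_long P
  rw [LinearIndependent.pair_iff] at hli
  constructor
  · rintro rfl
    refine hv ?_
    have := (hli (u - 1 : K) v (Eq.trans (by module) (sub_eq_zero.2 hi.symm))).2
    exact_mod_cast this
  · intro h0
    rw [h0, P.root_reflectionPerm, P.reflection_apply_self] at hi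
    refine hv ?_
    have := (hli (u + 1 : K) v (Eq.trans (by module) (sub_eq_zero.2 hi.symm))).2
    exact_mod_cast this

variable {b : P.Base}

/-- Sections extend in type `G₂` to elements at which only the short simple reflection is an
ascent. -/
theorem ExtendsAt.g2 (hR : R.HasCoprimality b) (hl : l ∈ b.support) (ht : t ∈ b.support)
    (hA : IsValueModule R (g2Roots P l t) A) {x : Weyl b}
    (hx : length b x < length b (refl b l * x)) (hx' : ¬ length b x < length b (refl b t * x))
    (n : ℤ) : ExtendsAt b R (g2Roots P l t) A (n + 4) x := by
  classical
  intro m hm hsec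
  set Ψ := g2Roots P l t with hΨ
  have hcl := (isUnion_g2Roots h b).reflClosed
  have hlΨ : l ∈ Ψ := mem_g2Roots_short
  have h1Ψ : P.reflectionPerm l t ∈ Ψ := ⟨_, by simp, Or.inl rfl⟩
  have h2Ψ : P.reflectionPerm l (P.reflectionPerm t l) ∈ Ψ := ⟨_, by simp, Or.inl rfl⟩
  have h3Ψ : P.reflectionPerm t (P.reflectionPerm l t) ∈ Ψ := ⟨_, by simp, Or.inl rfl⟩
  have h4Ψ : P.reflectionPerm t l ∈ Ψ := ⟨_, by simp, Or.inl rfl⟩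
  have hne1 := ne_of_root_eq h (root_lt h) one_ne_zero
  have hne2 := ne_of_root_eq h (root_ltl h) one_ne_zero
  have hne3 := ne_of_root_eq h (root_tlt h) two_ne_zero
  have hne4 := ne_of_root_eq h (root_tl h) one_ne_zero
  -- the ascents of `x` form an initial segment of the roots `l`, `3l+t`, `2l+t`, `3l+2t`, `l+t`
  have hup : (length b x < length b (refl b (P.reflectionPerm t l) * x) →
        length b x < length b (refl b (P.reflectionPerm t (P.reflectionPerm l t)) * x)) ∧
      (length b x < length b (refl b (P.reflectionPerm t (P.reflectionPerm l t)) * x) →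
        length b x < length b (refl b (P.reflectionPerm l (P.reflectionPerm t l)) * x)) ∧
      (length b x < length b (refl b (P.reflectionPerm l (P.reflectionPerm t l)) * x) →
        length b x < length b (refl b (P.reflectionPerm l t) * x)) := by
    have e1 := height_lt h b 1
    have e2 := height_ltl h b 1
    have e3 := height_tlt h b 1
    have e4 := height_tl h b 1
    have e5 := RootPairing.Base.height_one_of_mem_support hl
    have e6 := RootPairing.Base.height_one_of_mem_support ht
    simp only [map_one, Equiv.Perm.one_apply, e5, e6] at e1 e2 e3 e4
    rw [length_lt_iff b (RootPairing.Base.isPos_of_mem_support hl)] at hx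
    rw [length_lt_iff b (RootPairing.Base.isPos_of_mem_support ht)] at hx'
    rw [length_lt_iff b (by rw [RootPairing.Base.isPos_iff, e4]; norm_num),
      length_lt_iff b (by rw [RootPairing.Base.isPos_iff, e3]; norm_num),
      length_lt_iff b (by rw [RootPairing.Base.isPos_iff, e2]; norm_num),
      length_lt_iff b (by rw [RootPairing.Base.isPos_iff, e1]; norm_num)]
    rw [RootPairing.Base.isPos_iff] at hx hx'
    simp only [RootPairing.Base.isPos_iff, height_lt h, height_tl h, height_ltl h, height_tlt h]
    omega
  obtain ⟨hup4, hup3, hup2⟩ := hup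
  have e4 : n + 4 = n + 3 + 1 := by ring
  obtain ⟨d, hd⟩ := exists_divided_difference hcl hA hl hlΨ hx (n := n + 3) (e4 ▸ hm) hsec
  set U := {y | y ∈ StrictlyAbove b Ψ x ∧ y ≠ refl b l * x} with hU
  have hUl : ∀ y ∈ U, refl b l * y ∈ U := fun y hy =>
    StrictlyAbove.simple_mul hcl hl hlΨ hx hy.1 hy.2
  have hUup : ∀ i ∈ Ψ, i ≠ l ∧ i ≠ P.reflectionPerm l l →
      length b x < length b (refl b i * x) → refl b i * x ∈ U := fun i hi hne hix =>
    ⟨StrictlyAbove.step hi hix, fun h0 => by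
      rcases eq_or_neg_of_refl_eq (mul_right_cancel h0) with h1 | h1
      · exact hne.1 h1
      · exact hne.2 h1⟩
  have rel : ∀ i ∈ Ψ, i ≠ l ∧ i ≠ P.reflectionPerm l l → ∀ y ∈ U, ∀ y' ∈ U, refl b i * y = y' →
      ∀ p, R.c i ∣ R.c l * (d y p - d y' p) := by
    rintro i hi hne y hy y' hy' rfl p
    exact (hd y hy.1 hy.2).2.2.2.2 i hi hne.1 hne.2 hy'.1 hy'.2 p
  have hdl : ∀ y ∈ U, ∀ p, d (refl b l * y) p = R.σ l (d y p) := fun y hy =>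
    (hd y hy.1 hy.2).2.2.2.1
  -- it suffices to find a suitable value at `x` of the divided difference
  suffices key : ∃ v ∈ A, (∀ p, v p ∈ R.F (n + 3)) ∧ ∀ i ∈ [P.reflectionPerm l t,
      P.reflectionPerm t l, P.reflectionPerm l (P.reflectionPerm t l),
      P.reflectionPerm t (P.reflectionPerm l t)], length b x < length b (refl b i * x) →
      ∀ p, R.c i ∣ R.c l * (v p - d (refl b i * x) p) by
    obtain ⟨v, hvA, hvn, hv⟩ := key
    rw [e4]
    refine exists_extension_of_divided_difference hcl hA hl hlΨ hx (e4 ▸ hm) hsec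
      (fun y hy hys => (hd y hy hys).2.2.1) hvA hvn ?_
    rintro i ⟨j, hj, hij⟩ hil hil' hix - p
    rw [refl_eq_of_eq_or_neg hij] at hix ⊢
    rw [R.c_dvd_iff_of_eq_or_neg hij]
    rw [List.mem_cons, List.mem_cons] at hj
    rcases hj with rfl | rfl | hj
    · exact absurd hij (not_or.2 ⟨hil, hil'⟩)
    · exact absurd hix hx'
    · exact hv j hj hix p
  simp only [List.forall_mem_cons, List.not_mem_nil, false_implies, implies_true, and_true]
  obtain ⟨cop1, cop3, cop12, cop13⟩ := hR.coprime_of_g2 l t h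
  by_cases u1 : length b x < length b (refl b (P.reflectionPerm l t) * x)
  swap
  · have u2 := mt hup2 u1
    have u3 := mt hup3 u2
    have u4 := mt hup4 u3
    exact ⟨0, A.zero_mem, fun _ => zero_mem _, fun h => absurd h u1, fun h => absurd h u4,
      fun h => absurd h u2, fun h => absurd h u3⟩
  have y1 := hUup _ h1Ψ hne1 u1
  have y1' := hUl _ y1
  -- The divided difference `d` is reconstructed from its values `B`, `D`, `C`, `E` at `s_l s_γ x` or
  -- `s_γ x`, for the ascents `γ` of `x` other than `l`. If only the first few `γ` are ascents, the
  -- missing coefficients are chosen so that the remaining congruences hold.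
  obtain ⟨B, hB⟩ : ∃ B, B = d (refl b l * (refl b (P.reflectionPerm l t) * x)) := ⟨_, rfl⟩
  have hBA : B ∈ A ∧ ∀ p, B p ∈ R.F (n + 3) := hB ▸ ⟨(hd _ y1'.1 y1'.2).1, (hd _ y1'.1 y1'.2).2.1⟩
  have hB1 : ∀ p, d (refl b (P.reflectionPerm l t) * x) p = R.σ l (B p) := fun p => by
    rw [hB, hdl _ y1, R.σ_σ]
  by_cases u2 : length b x < length b (refl b (P.reflectionPerm l (P.reflectionPerm t l)) * x)
  swap
  · have u3 := mt hup3 u2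
    have u4 := mt hup4 u3
    refine ⟨fun p => R.σ l (B p), hA.σ_mem l hlΨ _ hBA.1, fun p => R.σ_mem _ _ _ (hBA.2 p),
      fun _ p => ?_, fun h => absurd h u4, fun h => absurd h u2, fun h => absurd h u3⟩
    rw [hB1, sub_self, mul_zero]
    exact dvd_zero _
  have y2 := hUup _ h2Ψ hne2 u2
  have y2' := hUl _ y2
  obtain ⟨D, hD⟩ : ∃ D,
      D = d (refl b l * (refl b (P.reflectionPerm l (P.reflectionPerm t l)) * x)) := ⟨_, rfl⟩
  have hDA : D ∈ A ∧ ∀ p, D p ∈ R.F (n + 3) := hD ▸ ⟨(hd _ y2'.1 y2'.2).1, (hd _ y2'.1 y2'.2).2.1⟩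
  have hD1 : ∀ p, d (refl b (P.reflectionPerm l (P.reflectionPerm t l)) * x) p = R.σ l (D p) :=
    fun p => by rw [hD, hdl _ y2, R.σ_σ]
  have e3 : n + 3 = n + 2 + 1 := by ring
  have e2 : n + 2 = n + 1 + 1 := by ring
  -- `B = σ D + c e` for the coroot `c` of the long root `3l+t`
  obtain ⟨e, heA, hen, he⟩ : ∃ e ∈ A, (∀ p, e p ∈ R.F (n + 2)) ∧
      ∀ p, B p - R.σ l (D p) = R.c (P.reflectionPerm l t) * e p := by
    refine hA.exists_quotient h1Ψ (v := fun p => B p - R.σ l (D p))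
      (A.sub_mem hBA.1 (hA.σ_mem l hlΨ _ hDA.1))
      (fun p => (R.F _).sub_mem (e3 ▸ hBA.2 p) (R.σ_mem _ _ _ (e3 ▸ hDA.2 p))) fun p => ?_
    refine cop1 _ ?_
    rw [← hD1, hB]
    refine rel _ h1Ψ hne1 _ y1' _ y2 ?_ p
    simp only [refl_reflectionPerm_mul, refl_mul_cancel_left]
  obtain ⟨δD, hδDA, hδDn, hδD⟩ := hA.exists_delta hlΨ hDA.1 (n := n + 2) (e3 ▸ hDA.2)
  have hσB : ∀ p, R.σ l (B p) = D p + R.c t * R.σ l (e p) := fun p => by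
    have := congrArg (R.σ l) (he p)
    rw [map_sub, map_mul, R.σ_σ, R.σ_c, P.reflectionPerm_self] at this
    linear_combination this
  have hc1 := R.c_lt h
  have hc2 := R.c_ltl h
  have hc3 := R.c_tlt h
  have hc4 := R.c_tl h
  -- the solution, in terms of the remaining data
  have fin : ∀ c ∈ A, (∀ p, c p ∈ R.F (n + 2)) → ∀ g ∈ A, (∀ p, g p ∈ R.F (n + 1)) →
      ∀ δc : I → S, (∀ p, c p - R.σ l (c p) = R.c l * δc p) →
      (∀ p, R.c (P.reflectionPerm l (P.reflectionPerm t l)) ∣ 3 * (e p - c p - 3 * δD p)) →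
      (length b x < length b (refl b (P.reflectionPerm t (P.reflectionPerm l t)) * x) → ∀ p,
        d (refl b (P.reflectionPerm t (P.reflectionPerm l t)) * x) p =
          D p + R.c (P.reflectionPerm l t) * c p) →
      (length b x < length b (refl b (P.reflectionPerm t l) * x) → ∀ p,
        R.c (P.reflectionPerm l (P.reflectionPerm t l)) ∣ 3 * (3 * δc p - g p) ∧
        d (refl b (P.reflectionPerm t l) * x) p = R.σ l (D p) +
          R.c (P.reflectionPerm t (P.reflectionPerm l t)) * R.σ l (c p) +
          R.c (P.reflectionPerm l t) * e p + R.c (P.reflectionPerm l t) *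
          R.c (P.reflectionPerm t (P.reflectionPerm l t)) * g p) →
      ∃ v ∈ A, (∀ p, v p ∈ R.F (n + 3)) ∧
      (length b x < length b (refl b (P.reflectionPerm l t) * x) → ∀ p,
        R.c (P.reflectionPerm l t) ∣ R.c l * (v p - d (refl b (P.reflectionPerm l t) * x) p)) ∧
      (length b x < length b (refl b (P.reflectionPerm t l) * x) → ∀ p,
        R.c (P.reflectionPerm t l) ∣ R.c l * (v p - d (refl b (P.reflectionPerm t l) * x) p)) ∧
      (length b x < length b (refl b (P.reflectionPerm l (P.reflectionPerm t l)) * x) → ∀ p,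
        R.c (P.reflectionPerm l (P.reflectionPerm t l)) ∣
          R.c l * (v p - d (refl b (P.reflectionPerm l (P.reflectionPerm t l)) * x) p)) ∧
      (length b x < length b (refl b (P.reflectionPerm t (P.reflectionPerm l t)) * x) → ∀ p,
        R.c (P.reflectionPerm t (P.reflectionPerm l t)) ∣
          R.c l * (v p - d (refl b (P.reflectionPerm t (P.reflectionPerm l t)) * x) p)) := by
    intro c hcA hcn g hgA hgn δc hδc hw hC hA'
    obtain ⟨v, hvA, hvn, hv⟩ := exists_g2_solution h hA hDA.1 hDA.2 hcA hcn heA hen hgA hgn hδD hδc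
    refine ⟨v, hvA, hvn, fun _ p => ?_, fun u4 p => ?_, fun _ p => ?_, fun u3 p => ?_⟩
    · rw [hB1, hσB]
      exact (hv p).1.mul_left _
    · rw [(hA' u4 p).2]
      have h1 := ((hv p).2.2 (hw p)).2 (hA' u4 p).1
      rw [hc4] at h1 ⊢
      convert dvd_sub (dvd_mul_right (R.c l + 3 * R.c t) _) (h1.mul_left (R.c t)) using 1
      swap
      · exact v p - (R.σ l (D p) +
          R.c (P.reflectionPerm t (P.reflectionPerm l t)) * R.σ l (c p) +
          R.c (P.reflectionPerm l t) * e p + R.c (P.reflectionPerm l t) *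
          R.c (P.reflectionPerm t (P.reflectionPerm l t)) * g p)
      · ring
    · rw [hD1]
      have h1 := ((hv p).2.2 (hw p)).1
      rw [hc2] at h1 ⊢
      convert dvd_sub (h1.mul_left (R.c l + R.c t))
        (dvd_mul_right (2 * R.c l + 3 * R.c t) _) using 1
      swap
      · exact v p - R.σ l (D p)
      · ring
    · rw [hC u3]
      exact (hv p).2.1.mul_left _
  by_cases u3 : length b x < length b (refl b (P.reflectionPerm t (P.reflectionPerm l t)) * x)
  swap
  · have u4 := mt hup4 u3
    have hcA : (fun p => e p - 3 * δD p) ∈ A := A.sub_mem heA (hA.mul_mem _ hδDA)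
    have hcn : ∀ p, e p - 3 * δD p ∈ R.F (n + 2) := fun p => (R.F _).sub_mem (hen p) (by
      have := (R.F (n + 2)).nsmul_mem (hδDn p) 3
      rwa [nsmul_eq_mul] at this)
    obtain ⟨δc, -, -, hδc⟩ := hA.exists_delta hlΨ hcA (n := n + 1) (e2 ▸ hcn)
    refine fin _ hcA hcn 0 A.zero_mem (fun _ => zero_mem _) δc hδc (fun p => ?_)
      (fun h => absurd h u3) (fun h => absurd h u4)
    simp
  have y3 := hUup _ h3Ψ hne3 u3
  obtain ⟨C, hC⟩ : ∃ C, C = d (refl b (P.reflectionPerm t (P.reflectionPerm l t)) * x) := ⟨_, rfl⟩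
  have hCA : C ∈ A ∧ ∀ p, C p ∈ R.F (n + 3) := hC ▸ ⟨(hd _ y3.1 y3.2).1, (hd _ y3.1 y3.2).2.1⟩
  obtain ⟨c, hcA, hcn, hc⟩ : ∃ c ∈ A, (∀ p, c p ∈ R.F (n + 2)) ∧
      ∀ p, C p - D p = R.c (P.reflectionPerm l t) * c p := by
    refine hA.exists_quotient h1Ψ (v := fun p => C p - D p) (A.sub_mem hCA.1 hDA.1)
      (fun p => (R.F _).sub_mem (e3 ▸ hCA.2 p) (e3 ▸ hDA.2 p)) fun p => ?_
    refine cop1 _ ?_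
    rw [hC, hD]
    refine rel _ h1Ψ hne1 _ y3 _ y2' ?_ p
    simp only [refl_reflectionPerm_mul, refl_mul_cancel_left, g2_braid h]
  obtain ⟨δc, hδcA, hδcn, hδc⟩ := hA.exists_delta hlΨ hcA (n := n + 1) (e2 ▸ hcn)
  have hw : ∀ p, R.c (P.reflectionPerm l (P.reflectionPerm t l)) ∣
      3 * (e p - c p - 3 * δD p) := fun p => by
    refine cop12 _ (cop12 _ ?_)
    rw [hc1, hc2]
    refine g2_weak_short (B := B p) (C := C p) (hδD p) (by rw [← hc1, ← he]; ring)
      (by rw [← hc1, ← hc]; ring) ?_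
    rw [← hc2, hB, hC]
    refine rel _ h2Ψ hne2 _ y1' _ y3 ?_ p
    simp only [refl_reflectionPerm_mul, refl_mul_cancel_left, g2_braid h]
  have hC' : ∀ p, d (refl b (P.reflectionPerm t (P.reflectionPerm l t)) * x) p =
      D p + R.c (P.reflectionPerm l t) * c p := fun p => by rw [← hc, hC]; ring
  by_cases u4 : length b x < length b (refl b (P.reflectionPerm t l) * x)
  swap
  · exact fin c hcA hcn 0 A.zero_mem (fun _ => zero_mem _) δc hδc hw (fun _ => hC')
      (fun h => absurd h u4)
  have y4 := hUup _ h4Ψ hne4 u4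
  obtain ⟨E, hE⟩ : ∃ E, E = d (refl b (P.reflectionPerm t l) * x) := ⟨_, rfl⟩
  have hEA : E ∈ A ∧ ∀ p, E p ∈ R.F (n + 3) := hE ▸ ⟨(hd _ y4.1 y4.2).1, (hd _ y4.1 y4.2).2.1⟩
  obtain ⟨f, hfA, hfn, hf⟩ : ∃ f ∈ A, (∀ p, f p ∈ R.F (n + 2)) ∧
      ∀ p, E p - R.σ l (C p) = R.c (P.reflectionPerm l t) * f p := by
    refine hA.exists_quotient h1Ψ (v := fun p => E p - R.σ l (C p))
      (A.sub_mem hEA.1 (hA.σ_mem l hlΨ _ hCA.1))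
      (fun p => (R.F _).sub_mem (e3 ▸ hEA.2 p) (R.σ_mem _ _ _ (e3 ▸ hCA.2 p))) fun p => ?_
    refine cop1 _ ?_
    rw [hE, hC, ← hdl _ y3]
    refine rel _ h1Ψ hne1 _ y4 _ (hUl _ y3) ?_ p
    simp only [refl_reflectionPerm_mul, g2_braid h]
  have hσC : ∀ p, R.σ l (C p) = R.σ l (D p) + R.c t * R.σ l (c p) := fun p => by
    have := congrArg (R.σ l) (hc p)
    rw [map_sub, map_mul, R.σ_c, P.reflectionPerm_self] at this
    linear_combination this
  obtain ⟨g, hgA, hgn, hg⟩ : ∃ g ∈ A, (∀ p, g p ∈ R.F (n + 1)) ∧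
      ∀ p, f p - e p - R.σ l (c p) =
        R.c (P.reflectionPerm t (P.reflectionPerm l t)) * g p := by
    refine hA.exists_quotient h3Ψ (v := fun p => f p - e p - R.σ l (c p))
      (A.sub_mem (A.sub_mem hfA heA) (hA.σ_mem l hlΨ _ hcA))
      (fun p => (R.F _).sub_mem ((R.F _).sub_mem (e2 ▸ hfn p) (e2 ▸ hen p))
        (R.σ_mem _ _ _ (e2 ▸ hcn p))) fun p => ?_
    refine cop13 _ ?_
    have h1 : R.c (P.reflectionPerm t (P.reflectionPerm l t)) ∣ E p - B p := by
      refine cop3 _ ?_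
      rw [hE, hB]
      refine rel _ h3Ψ hne3 _ y4 _ y1' ?_ p
      simp only [refl_reflectionPerm_mul, refl_mul_cancel_left]
    convert dvd_sub h1 (dvd_mul_right _ (R.σ l (c p))) using 1
    have h2 := hf p
    have h3 := he p
    have h4 := hσC p
    rw [hc1] at h2 h3 ⊢
    rw [hc3]
    linear_combination h3 - h2 - h4
  have hE' : ∀ p, E p = R.σ l (D p) +
      R.c (P.reflectionPerm t (P.reflectionPerm l t)) * R.σ l (c p) +
      R.c (P.reflectionPerm l t) * e p + R.c (P.reflectionPerm l t) *
      R.c (P.reflectionPerm t (P.reflectionPerm l t)) * g p := fun p => by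
    have h2 := hf p
    have h3 := hg p
    have h4 := hσC p
    rw [hc3] at h3 ⊢
    rw [hc1] at h2 ⊢
    linear_combination h2 + h4 + (R.c l + R.c t) * h3
  refine fin c hcA hcn g hgA hgn δc hδc hw (fun _ => hC') fun _ p => ⟨?_, by rw [← hE, hE']⟩
  refine cop12 _ (cop12 _ (cop12 _ ?_))
  have h1 := hw p
  have h2 := hE' p
  rw [hc1, hc3] at h2
  rw [hc2] at h1
  rw [hc1, hc2]
  refine g2_weak_long (A := E p) (hδD p) (hδc p) h2 h1 ?_
  rw [← hc2, hE, hD]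
  refine rel _ h2Ψ hne2 _ y4 _ y2' ?_ p
  simp only [refl_reflectionPerm_mul, refl_mul_cancel_left, g2_braid h]

end Solution

end BruhatGraph

/-! ### Extension of sections -/

namespace BruhatGraph

universe u₁ u₂ u₃ u₄

variable {ι : Type u₁} {K : Type u₂} {M : Type u₃} {N : Type u₄} [Field K] [AddCommGroup M]
  [Module K M] [AddCommGroup N] [Module K N] {P : RootPairing ι K M N}
variable [CharZero K] [Finite ι] [P.IsRootSystem] [P.IsCrystallographic] [P.IsReduced]
variable {S : Type*} [CommRing S] {R : CorootRing P S} {b : P.Base}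

theorem IsUnion.diff {Ψ Ψ' : Set ι} (h : IsUnion (P := P) Ψ) (h' : IsUnion (P := P) Ψ') :
    IsUnion (P := P) (Ψ \ Ψ') := by
  intro i hi j hj
  by_cases hjΨ : j ∈ Ψ
  · exact (h' j (by_contra fun hn => hj ⟨hjΨ, hn⟩) i hi.2).symm
  · exact h i hi.1 j hjΨ

theorem IsUnion.g2Roots_subset {Ψ : Set ι} (h : IsUnion (P := P) Ψ) {l t : ι}
    (hlt : P.pairingIn ℤ t l = -3) (hl : l ∈ Ψ) : g2Roots P l t ⊆ Ψ := by
  have hc := h.reflClosed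
  have ht : t ∈ Ψ := h.mem_of_pairing_ne_zero hl (by rw [pairing_eq_neg_one hlt]; norm_num)
  rintro i ⟨j, hj, hij⟩
  have hjΨ : j ∈ Ψ := by
    simp only [List.mem_cons, List.not_mem_nil, or_false] at hj
    rcases hj with rfl | rfl | rfl | rfl | rfl | rfl
    · exact hl
    · exact ht
    · exact hc _ hl _ ht
    · exact hc _ ht _ hl
    · exact hc _ hl _ (hc _ ht _ hl)
    · exact hc _ ht _ (hc _ hl _ ht)
  rcases hij with rfl | rfl
  · exact hjΨ
  · exact hc _ hjΨ _ hjΨ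

/-- The extension property for every union of components, by induction on the number of roots, then
on the degree. If `x` has a simple ascent that is not the short simple root of a `G₂`, then division
by its coroot lowers the degree. Otherwise a component of type `G₂` is split off, unless it is
everything. -/
theorem extends_of_isUnion (hR : R.HasCoprimality b) {Ψ : Set ι} (hΨ : IsUnion (P := P) Ψ) :
    Extends b R Ψ := by
  induction hk : Ψ.ncard using Nat.strong_induction_on generalizing Ψ with
  | _ k ih =>
  subst hk
  intro I A hA n
  -- sections of negative degree vanish
  obtain ⟨d, hd⟩ : ∃ d : ℕ, n < d := ⟨(n + 1).toNat, by omega⟩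
  induction d generalizing n with
  | zero =>
    intro x m hm _
    refine ⟨0, A.zero_mem, fun _ => zero_mem _, fun i hi hix p => ?_⟩
    rw [R.eq_zero_of_neg n (by simpa using hd) _ ((hm _ (StrictlyAbove.step hi hix)).2 p)]
    simp
  | succ d ihd =>
  intro x
  have hlow : ∀ x, ExtendsAt b R Ψ A (n - 1) x := ihd (n - 1) (by push_cast at hd; omega)
  by_cases hg : ∃ s ∈ b.support, s ∈ Ψ ∧ length b x < length b (refl b s * x) ∧
      ∀ d, P.pairingIn ℤ d s ≠ -3
  · obtain ⟨s, hs, hsΨ, hsx, hgood⟩ := hg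
    have := ExtendsAt.of_coprime hΨ.reflClosed hA hs hsΨ hsx
      (fun i _ h h' => hR.coprime_of_simple s hs hgood i h h') (hlow _) (hlow x)
    rwa [sub_add_cancel] at this
  push Not at hg
  by_cases hup : ∃ i ∈ Ψ, length b x < length b (refl b i * x)
  swap
  · exact fun m _ _ => ⟨0, A.zero_mem, fun _ => zero_mem _,
      fun i hi hix => absurd ⟨i, hi, hix⟩ hup⟩
  obtain ⟨i, hi, hix⟩ := hup
  obtain ⟨l, hl, hlΨ, hlx⟩ := hΨ.exists_simple_ascent hi hix
  obtain ⟨t, ht, hlt⟩ := exists_simple_pairingIn_eq_neg_three b hl (hg l hl hlΨ hlx)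
  have hsub := hΨ.g2Roots_subset hlt hlΨ
  have htm : t ∈ g2Roots P l t := ⟨t, by simp, Or.inl rfl⟩
  by_cases heq : g2Roots P l t = Ψ
  · subst heq
    have := ExtendsAt.g2 hlt hR hl ht hA hlx (fun h => by
      obtain ⟨d, hd⟩ := hg t ht htm h
      exact pairingIn_long_ne_neg_three hlt b d hd) (n - 4)
    rwa [sub_add_cancel] at this
  · have hfin : Ψ.Finite := Set.toFinite Ψ
    have hU := isUnion_g2Roots hlt b
    have h1 : (g2Roots P l t).ncard < Ψ.ncard :=
      Set.ncard_lt_ncard (hsub.ssubset_of_ne heq) hfin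
    have h2 : (Ψ \ g2Roots P l t).ncard < Ψ.ncard :=
      Set.ncard_lt_ncard ⟨Set.sdiff_subset, fun h => (h hlΨ).2 (mem_g2Roots_short)⟩ hfin
    have horth : Orthogonal (P := P) (g2Roots P l t) (Ψ \ g2Roots P l t) :=
      fun i hi j hj => hU i hi j hj.2
    have := Extends.union horth
      (fun i hi j hj => hR.coprime_of_pairing_eq_zero _ _ (horth i hi j hj).1)
      (fun i hi j hj => hR.coprime_of_pairing_eq_zero _ _ (horth i hi j hj).2)
      (ih _ h1 hU rfl) (ih _ h2 (hΨ.diff hU) rfl)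
    rw [Set.union_sdiff_cancel hsub] at this
    exact this I A hA n x

/-- Every family of values over the elements strictly above `x` that satisfies the congruences of
the Bruhat graph extends to `x`. -/
theorem exists_extension (hR : R.HasCoprimality b) (hF : ∀ f, ∃ n, ∀ m, n ≤ m → f ∈ R.F m)
    (x : Weyl b) (m : Weyl b → S)
    (hm : ∀ y, x < y → ∀ i, x < refl b i * y → R.c i ∣ m y - m (refl b i * y)) :
    ∃ u, ∀ i, x < refl b i * x → R.c i ∣ u - m (refl b i * x) := by
  have hfin : Finite (Weyl b) := Finite.of_injective _ (toPerm_injective b)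
  have hiff : ∀ y, y ∈ StrictlyAbove b Set.univ x ↔ x < y := fun y => by
    rw [lt_iff_le_and_ne, ne_comm]
    refine and_congr_left fun _ => ?_
    simp only [Above, Set.mem_univ, true_and]
    rfl
  choose n hn using hF
  obtain ⟨B, hB⟩ := (Set.finite_range fun y => n (m y)).bddAbove
  have hU : IsUnion (P := P) (Set.univ : Set ι) := fun i _ j hj => absurd (Set.mem_univ j) hj
  obtain ⟨u, -, -, hu⟩ := extends_of_isUnion hR hU PUnit ⊤
    ⟨fun _ _ _ _ => trivial, fun _ _ _ _ => trivial⟩ B x (fun y _ => m y)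
    (fun y _ => ⟨trivial, fun _ => hn _ _ (hB ⟨y, rfl⟩)⟩)
    (fun y hy i _ hiy _ => hm y ((hiff y).1 hy) i ((hiff _).1 hiy))
  exact ⟨u ⟨⟩, fun i hi => hu i trivial
    (StrictlyAbove.length_lt ((hiff _).2 hi)) ⟨⟩⟩

end BruhatGraph

/-! ### The symmetric algebra of the coroot lattice -/

section Symmetric

variable {k V : Type*} [CommRing k] [AddCommGroup V] [Module k V]

open Polynomial in
/-- If a linear form has the value `1` at `v` and `0` at `w` then `v` is a nonzerodivisor modulo `w`
in the symmetric algebra: the latter embeds into a polynomial ring in such a way that `v` becomes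
the variable and `w` a constant. -/
theorem SymmetricAlgebra.dvd_of_dvd_mul {φ : V →ₗ[k] k} {v w : V} (hv : φ v = 1) (hw : φ w = 0)
    {f : SymmetricAlgebra k V} (h : ι k V w ∣ ι k V v * f) : ι k V w ∣ f := by
  let θ : SymmetricAlgebra k V →ₐ[k] (SymmetricAlgebra k V)[X] :=
    lift ((CAlgHom (R := k)).toLinearMap ∘ₗ (ι k V - φ.smulRight (ι k V v)) + φ.smulRight X)
  have hθ : ∀ x, θ (ι k V x) = C (ι k V x - φ x • ι k V v) + φ x • X := fun x => by
    simp only [θ, lift_ι_apply]; rfl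
  have hid : ((aeval (R := SymmetricAlgebra k V) (ι k V v)).restrictScalars k).comp θ =
      AlgHom.id k _ := by
    ext x
    change aeval (ι k V v) (θ (ι k V x)) = ι k V x
    rw [hθ, map_add, aeval_C, ← algebraMap_smul (SymmetricAlgebra k V) (φ x) X, map_smul, aeval_X]
    simp [Algebra.smul_def]
  obtain ⟨g, hg⟩ := h
  have h1 := congrArg θ hg
  rw [map_mul, map_mul, hθ, hθ, hv, hw] at h1
  simp only [one_smul, sub_self, map_zero, zero_add, zero_smul, sub_zero, add_zero] at h1
  have h2 : C (ι k V w) ∣ θ f := by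
    rw [C_dvd_iff_dvd_coeff]
    intro n
    have := congrArg (fun p => coeff p (n + 1)) h1
    simp only [coeff_X_mul, coeff_C_mul] at this
    exact ⟨_, this⟩
  have h3 := map_dvd ((aeval (R := SymmetricAlgebra k V) (ι k V v)).restrictScalars k) h2
  have h4 : ∀ x, ((aeval (R := SymmetricAlgebra k V) (ι k V v)).restrictScalars k) (θ x) = x :=
    fun x => DFunLike.congr_fun hid x
  rw [h4] at h3
  simpa using h3

/-- The endomorphism of the symmetric algebra induced by a reflection. -/
def SymmetricAlgebra.reflect (e : V) (φ : Module.Dual k V) :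
    SymmetricAlgebra k V →ₐ[k] SymmetricAlgebra k V :=
  lift (ι k V ∘ₗ Module.preReflection e φ)

namespace SymmetricAlgebra

variable {e : V} {φ : Module.Dual k V}

theorem reflect_ι (x : V) : reflect e φ (ι k V x) = ι k V (x - φ x • e) := by
  rw [reflect, lift_ι_apply]; rfl

theorem reflect_reflect (h : φ e = 2) (f : SymmetricAlgebra k V) :
    reflect e φ (reflect e φ f) = f := by
  have : (reflect e φ).comp (reflect e φ) = AlgHom.id k _ := by
    ext x
    change reflect e φ (reflect e φ (ι k V x)) = ι k V x
    rw [reflect_ι, reflect_ι]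
    exact congrArg (ι k V) (Module.involutive_preReflection h x)
  exact DFunLike.congr_fun this f

theorem dvd_sub_reflect (f : SymmetricAlgebra k V) : ι k V e ∣ f - reflect e φ f := by
  induction f using SymmetricAlgebra.induction with
  | algebraMap r => simp
  | ι x =>
    rw [reflect_ι, map_sub, map_smul, sub_sub_cancel]
    exact Dvd.intro_left (algebraMap k _ (φ x)) (by rw [Algebra.smul_def])
  | mul a b ha hb =>
    rw [map_mul]
    have := dvd_add (ha.mul_right b) (hb.mul_left (reflect e φ a))
    convert this using 1; ring
  | add a b ha hb =>
    rw [map_add]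
    have := dvd_add ha hb
    convert this using 1; ring

end SymmetricAlgebra

end Symmetric

namespace SymRing

variable {k : Type*} {Y : Type*} [CommRing k] [AddCommGroup Y]

/-- The extension of an integral linear form to `k ⊗ Y`. -/
def form (k : Type*) [CommRing k] (f : Y →ₗ[ℤ] ℤ) : Module.Dual k (k ⊗[ℤ] Y) :=
  TensorProduct.AlgebraTensorModule.lift
    ((LinearMap.toSpanSingleton k (Y →ₗ[ℤ] k) ((Algebra.linearMap ℤ k) ∘ₗ f)))

theorem form_tmul (f : Y →ₗ[ℤ] ℤ) (y : Y) : form k f (1 ⊗ₜ y) = (f y : k) := by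
  simp [form]

theorem ofLattice_sub (y z : Y) : ofLattice k (y - z) = ofLattice k y - ofLattice k z := by
  simp [ofLattice, TensorProduct.tmul_sub]

theorem ofLattice_zsmul (n : ℤ) (y : Y) : ofLattice k (n • y) = n • ofLattice k y := by
  rw [ofLattice, TensorProduct.tmul_smul, map_zsmul, ofLattice]

/-- Elements of the lattice are coprime if two linear forms separate them over `k`. -/
theorem dvd_of_dvd_ofLattice_mul {v w : Y} (f g : Y →ₗ[ℤ] ℤ)
    (h : IsUnit ((f v * g w - g v * f w : ℤ) : k)) {s : SymRing k Y}
    (hs : ofLattice k w ∣ ofLattice k v * s) : ofLattice k w ∣ s := by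
  obtain ⟨r, hr⟩ := h
  refine SymmetricAlgebra.dvd_of_dvd_mul
    (φ := ((r⁻¹ : kˣ) : k) • ((g w : k) • form k f - (f w : k) • form k g)) ?_ ?_ hs
  · simp only [LinearMap.smul_apply, LinearMap.sub_apply, form_tmul, smul_eq_mul]
    rw [show (g w : k) * (f v : k) - (f w : k) * (g v : k) = r by rw [hr]; push_cast; ring]
    simp
  · simp only [LinearMap.smul_apply, LinearMap.sub_apply, form_tmul, smul_eq_mul]
    ring

theorem eq_zero_of_ofLattice_mul {v : Y} (f : Y →ₗ[ℤ] ℤ) (h : IsUnit ((f v : ℤ) : k))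
    {s : SymRing k Y} (hs : ofLattice k v * s = 0) : s = 0 := by
  obtain ⟨r, hr⟩ := h
  have := SymmetricAlgebra.dvd_of_dvd_mul (φ := ((r⁻¹ : kˣ) : k) • form k f)
    (v := (1 : k) ⊗ₜ[ℤ] v) (w := 0) (f := s) (by simp [form_tmul, ← hr]) (map_zero _)
    (by rw [map_zero, zero_dvd_iff]; exact hs)
  rwa [map_zero, zero_dvd_iff] at this

theorem ofLattice_mem_piece (y : Y) : ofLattice k y ∈ piece k Y 2 := ι_mem_piece k Y _

/-- The elements of degree at most `2 n`. -/
def degreeLE (k : Type*) (Y : Type*) [CommRing k] [AddCommGroup Y] (n : ℤ) :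
    AddSubgroup (SymRing k Y) where
  carrier := {s | ∀ m, 2 * n < m → DirectSum.decompose (piece k Y) s m = 0}
  zero_mem' := fun m _ => by simp
  add_mem' := fun hs ht m hm => by simp [hs m hm, ht m hm]
  neg_mem' := fun hs m hm => by
    rw [DirectSum.decompose_neg]; exact neg_eq_zero.2 (hs m hm)

theorem decompose_ofLattice_mul (y : Y) (s : SymRing k Y) (m : ℤ) :
    (DirectSum.decompose (piece k Y) (ofLattice k y * s) (2 + m) : SymRing k Y) =
      ofLattice k y * DirectSum.decompose (piece k Y) s m :=
  DirectSum.coe_decompose_mul_add_of_left_mem _ (ofLattice_mem_piece y)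

theorem ofLattice_mul_mem_degreeLE (y : Y) {s : SymRing k Y} {n : ℤ} (hs : s ∈ degreeLE k Y n) :
    ofLattice k y * s ∈ degreeLE k Y (n + 1) := by
  intro m hm
  obtain ⟨m, rfl⟩ : ∃ m', m = 2 + m' := ⟨m - 2, by ring⟩
  refine Subtype.ext ?_
  rw [decompose_ofLattice_mul, hs m (by linarith)]
  simp

theorem mem_degreeLE_of_ofLattice_mul {y : Y} (f : Y →ₗ[ℤ] ℤ) (h : IsUnit ((f y : ℤ) : k))
    {s : SymRing k Y} {n : ℤ} (hs : ofLattice k y * s ∈ degreeLE k Y (n + 1)) :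
    s ∈ degreeLE k Y n := by
  intro m hm
  refine Subtype.ext (eq_zero_of_ofLattice_mul f h ?_)
  rw [← decompose_ofLattice_mul, hs _ (by linarith)]
  simp

theorem eq_zero_of_mem_degreeLE {n : ℤ} (hn : n < 0) {s : SymRing k Y} (hs : s ∈ degreeLE k Y n) :
    s = 0 := by
  classical
  refine (DirectSum.decompose (piece k Y)).injective ?_
  rw [DirectSum.decompose_zero]
  ext m
  by_cases hm : 2 * n < m
  · rw [hs m hm]; rfl
  · have h1 : piece k Y m = ⊥ := piece_eq_bot k Y (by rintro ⟨d, rfl⟩; omega)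
    have := (Submodule.mem_bot k).1 (h1.le (DirectSum.decompose (piece k Y) s m).2)
    rw [this]; simp

theorem exists_mem_degreeLE (s : SymRing k Y) : ∃ n, ∀ m, n ≤ m → s ∈ degreeLE k Y m := by
  classical
  obtain ⟨B, hB⟩ := (DirectSum.decompose (piece k Y) s).support.bddAbove
  refine ⟨max B 0, fun m hm j hj => ?_⟩
  by_contra h
  have := hB (DFinsupp.mem_support_iff.2 h)
  have h1 := (le_max_left B 0).trans hm
  have h2 := (le_max_right B 0).trans hm
  omega

theorem reflect_mem_piece (e : k ⊗[ℤ] Y) (φ : Module.Dual k (k ⊗[ℤ] Y)) {n : ℤ} {s : SymRing k Y}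
    (hs : s ∈ piece k Y n) : SymmetricAlgebra.reflect e φ s ∈ piece k Y n := by
  by_cases hn : ∃ d : ℕ, n = 2 * (d : ℤ)
  · obtain ⟨d, rfl⟩ := hn
    rw [piece_two_mul] at hs ⊢
    have := Submodule.mem_map_of_mem (f := (SymmetricAlgebra.reflect e φ).toLinearMap) hs
    rw [Submodule.map_pow] at this
    have hle : (LinearMap.range (SymmetricAlgebra.ι k (k ⊗[ℤ] Y))).map
        (SymmetricAlgebra.reflect e φ).toLinearMap ≤
        LinearMap.range (SymmetricAlgebra.ι k (k ⊗[ℤ] Y)) := by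
      rintro _ ⟨_, ⟨x, rfl⟩, rfl⟩
      exact ⟨_, (SymmetricAlgebra.reflect_ι x).symm⟩
    exact pow_le_pow_left' hle d this
  · rw [piece_eq_bot k Y hn, Submodule.mem_bot] at hs ⊢
    rw [hs, map_zero]

theorem decompose_reflect (e : k ⊗[ℤ] Y) (φ : Module.Dual k (k ⊗[ℤ] Y)) (s : SymRing k Y) (n : ℤ) :
    (DirectSum.decompose (piece k Y) (SymmetricAlgebra.reflect e φ s) n : SymRing k Y) =
      SymmetricAlgebra.reflect e φ (DirectSum.decompose (piece k Y) s n) := by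
  induction s using DirectSum.Decomposition.inductionOn (piece k Y) with
  | zero => simp
  | @homogeneous i m =>
    have h := reflect_mem_piece e φ m.2
    by_cases hin : i = n
    · subst hin
      rw [DirectSum.decompose_of_mem_same _ h, DirectSum.decompose_of_mem_same _ m.2]
    · rw [DirectSum.decompose_of_mem_ne _ h hin, DirectSum.decompose_of_mem_ne _ m.2 hin, map_zero]
  | add a c ha hc =>
    simp only [map_add, DirectSum.decompose_add, DirectSum.add_apply, Submodule.coe_add, ha, hc]

theorem reflect_mem_degreeLE (e : k ⊗[ℤ] Y) (φ : Module.Dual k (k ⊗[ℤ] Y)) {n : ℤ}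
    {s : SymRing k Y} (hs : s ∈ degreeLE k Y n) :
    SymmetricAlgebra.reflect e φ s ∈ degreeLE k Y n := by
  intro m hm
  refine Subtype.ext ?_
  rw [decompose_reflect, hs m hm]
  simp

end SymRing

/-! ### Coroots in the symmetric algebra -/

namespace BruhatGraph

open SymRing

variable {ι K M N : Type*} [Field K] [AddCommGroup M]
  [Module K M] [AddCommGroup N] [Module K N] {P : RootPairing ι K M N}
variable [CharZero K] [Finite ι] [P.IsRootSystem] [P.IsCrystallographic] [P.IsReduced]

theorem corootSpanMem_reflectionPerm (i j : ι) : P.corootSpanMem ℤ (P.reflectionPerm i j) =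
    P.corootSpanMem ℤ j - P.pairingIn ℤ i j • P.corootSpanMem ℤ i := by
  refine Subtype.ext ?_
  change P.coroot (P.reflectionPerm i j) = P.coroot j - P.pairingIn ℤ i j • P.coroot i
  rw [P.coroot_reflectionPerm, P.coreflection_apply_coroot, ← P.algebraMap_pairingIn ℤ,
    algebraMap_smul]

theorem corootSpanMem_neg (i : ι) :
    P.corootSpanMem ℤ (P.reflectionPerm i i) = -P.corootSpanMem ℤ i :=
  Subtype.ext (by simp)

section Ring

variable (P) (k : Type*) [CommRing k]

theorem isUnit_root'In_corootSpanMem (h2 : IsUnit (2 : k)) (i : ι) :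
    IsUnit ((P.root'In ℤ i (P.corootSpanMem ℤ i) : ℤ) : k) := by
  simpa using h2

/-- The symmetric algebra of the coroot lattice, with the coroots and the reflections. -/
def symCorootRing (h2 : IsUnit (2 : k)) : CorootRing P (SymRing k (CorootLattice P)) where
  c i := ofLattice k (P.corootSpanMem ℤ i)
  σ i := (SymmetricAlgebra.reflect (1 ⊗ₜ P.corootSpanMem ℤ i) (form k (P.root'In ℤ i))).toRingHom
  F := degreeLE k _
  c_reflectionPerm i j := by
    rw [corootSpanMem_reflectionPerm, ofLattice_sub, ofLattice_zsmul]
  σ_c i j := by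
    change SymmetricAlgebra.reflect _ _ (SymmetricAlgebra.ι k _ _) = _
    rw [SymmetricAlgebra.reflect_ι, form_tmul, corootSpanMem_reflectionPerm, map_sub, map_smul,
      ofLattice_sub, ofLattice_zsmul, P.root'In_corootSpanMem_eq_pairingIn,
      Int.cast_smul_eq_zsmul]
    rfl
  σ_σ i f := SymmetricAlgebra.reflect_reflect (by rw [form_tmul]; simp) f
  dvd_sub_σ i f := SymmetricAlgebra.dvd_sub_reflect f
  eq_zero_of_mul i f h :=
    eq_zero_of_ofLattice_mul (P.root'In ℤ i) (isUnit_root'In_corootSpanMem P k h2 i) h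
  eq_zero_of_neg n hn f hf := eq_zero_of_mem_degreeLE hn hf
  σ_mem i n f hf := reflect_mem_degreeLE _ _ hf
  mul_mem i n f hf := ofLattice_mul_mem_degreeLE _ hf
  mem_of_mul_mem i n f hf :=
    mem_degreeLE_of_ofLattice_mul (P.root'In ℤ i) (isUnit_root'In_corootSpanMem P k h2 i) hf

end Ring

/-- Every nonzero element of the coroot lattice has a pairing at least `2` with some root. -/
theorem eq_zero_of_forall_root'In_le_one (y : CorootLattice P)
    (hy : ∀ i, P.root'In ℤ i y ≤ 1) : y = 0 := by
  classical
  have hsum : ∀ y : CorootLattice P, ∃ s : Multiset ι, y = (s.map (P.corootSpanMem ℤ)).sum := by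
    rintro ⟨y, hy⟩
    induction hy using Submodule.span_induction with
    | mem y hy =>
      obtain ⟨i, rfl⟩ := hy
      exact ⟨{i}, by simp⟩
    | zero => exact ⟨0, by simp⟩
    | add y z hy hz ihy ihz =>
      obtain ⟨s, hs⟩ := ihy
      obtain ⟨t, ht⟩ := ihz
      exact ⟨s + t, by rw [Multiset.map_add, Multiset.sum_add, ← hs, ← ht]; rfl⟩
    | smul n y hy ih =>
      obtain ⟨s, hs⟩ := ih
      have hneg : -(⟨y, hy⟩ : CorootLattice P) =
          ((s.map fun i => P.reflectionPerm i i).map (P.corootSpanMem ℤ)).sum := by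
        rw [hs, Multiset.map_map, ← Multiset.sum_map_neg]
        congr 1
        refine Multiset.map_congr rfl fun i _ => (corootSpanMem_neg i).symm
      have he : (⟨n • y, Submodule.smul_mem _ n hy⟩ : CorootLattice P) = n • ⟨y, hy⟩ := rfl
      rcases Int.le_total 0 n with hn | hn
      · obtain ⟨m, rfl⟩ := Int.eq_ofNat_of_zero_le hn
        exact ⟨m • s, by rw [he, Multiset.map_nsmul, Multiset.sum_nsmul, ← hs]; simp⟩
      · obtain ⟨m, hm⟩ := Int.eq_ofNat_of_zero_le (Int.neg_nonneg.2 hn)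
        refine ⟨m • (s.map fun i => P.reflectionPerm i i), ?_⟩
        rw [he, Multiset.map_nsmul, Multiset.sum_nsmul, ← hneg, smul_neg, ← natCast_zsmul, ← hm]
        simp
  -- a shortest expression as a sum of coroots involves no two coroots with negative pairing
  have hex : ∃ n, ∃ s : Multiset ι, s.card = n ∧ y = (s.map (P.corootSpanMem ℤ)).sum :=
    let ⟨s, hs⟩ := hsum y; ⟨_, s, rfl, hs⟩
  obtain ⟨s, hsn, hs⟩ := Nat.find_spec hex
  have hmin : ∀ t : Multiset ι, y = (t.map (P.corootSpanMem ℤ)).sum → s.card ≤ t.card :=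
    fun t ht => hsn ▸ Nat.find_min' hex ⟨t, rfl, ht⟩
  induction s using Multiset.induction with
  | empty => simpa using hs
  | cons i s _ =>
    exfalso
    have hnn : ∀ j ∈ s, 0 ≤ P.pairingIn ℤ i j := by
      intro j hj
      by_contra hneg
      obtain ⟨t, rfl⟩ := Multiset.exists_cons_of_mem hj
      by_cases hij : i = P.reflectionPerm j j
      · have := hmin t (by
          rw [hs, hij, Multiset.map_cons, Multiset.map_cons, Multiset.sum_cons, Multiset.sum_cons,
            corootSpanMem_neg, neg_add_cancel_left])
        simp at this
      · have hlt : P.flip.pairingIn ℤ j i < 0 := by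
          have : P.flip.pairingIn ℤ j i = P.pairingIn ℤ i j := by
            apply FaithfulSMul.algebraMap_injective ℤ K
            rw [P.flip.algebraMap_pairingIn, P.algebraMap_pairingIn]
            rfl
          rw [this]
          exact not_le.1 hneg
        obtain ⟨l, hl⟩ := P.flip.root_add_root_mem_of_pairingIn_neg hlt (fun h0 => hij (by
          have h1 : P.coroot i = -P.coroot j := by rw [← neg_eq_iff_eq_neg]; exact h0.symm
          rwa [P.coroot_eq_neg_iff] at h1))
        have := hmin (l ::ₘ t) (by
          have hl' : P.corootSpanMem ℤ l = P.corootSpanMem ℤ i + P.corootSpanMem ℤ j :=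
            Subtype.ext (hl.trans (add_comm _ _))
          rw [hs, Multiset.map_cons, Multiset.map_cons, Multiset.map_cons, Multiset.sum_cons,
            Multiset.sum_cons, Multiset.sum_cons, hl', add_assoc])
        simp at this
    have h1 := hy i
    rw [hs, Multiset.map_cons, Multiset.sum_cons, map_add, map_multiset_sum, Multiset.map_map] at h1
    have h2 : 0 ≤ ((s.map ((P.root'In ℤ i) ∘ P.corootSpanMem ℤ)).sum) :=
      Multiset.sum_nonneg fun z hz => by
        obtain ⟨j, hj, rfl⟩ := Multiset.mem_map.1 hz
        simpa using hnn j hj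
    have h3 : P.root'In ℤ i (P.corootSpanMem ℤ i) = 2 := by simp
    omega

section Simple

variable (b : P.Base)

/-- The basis of the coroot lattice given by the simple coroots. -/
def latticeBasis : Module.Basis b.support ℤ (CorootLattice P) :=
  Module.Basis.mk (v := fun j : b.support => P.corootSpanMem ℤ j)
    (by
      have h := b.linearIndepOn_coroot.linearIndependent.restrict_scalars' ℤ
      exact LinearIndependent.of_comp (Submodule.subtype _) h)
    (by
      rintro ⟨y, hy⟩ -
      rw [← b.span_int_coroot_support] at hy
      have : P.coroot '' b.support =
          (Submodule.subtype _) '' Set.range fun j : b.support => P.corootSpanMem ℤ j := by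
        ext z; simp
      rw [this, Submodule.span_image] at hy
      obtain ⟨z, hz, hzy⟩ := hy
      rwa [show (⟨y, _⟩ : CorootLattice P) = z from Subtype.ext hzy.symm])

/-- Either an integral linear form that vanishes at the simple coroot does not vanish modulo `p` at
`w`, or `w` is a multiple of the simple coroot modulo `p`. -/
theorem exists_form_or_exists_eq_add {s : ι} (hs : s ∈ b.support) (w : CorootLattice P) (p : ℤ) :
    (∃ g : CorootLattice P →ₗ[ℤ] ℤ, g (P.corootSpanMem ℤ s) = 0 ∧ ¬ p ∣ g w) ∨
      ∃ (c : ℤ) (y : CorootLattice P), w = c • P.corootSpanMem ℤ s + p • y := by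
  classical
  have hB : ∀ j : b.support, latticeBasis b j = P.corootSpanMem ℤ j := fun j => by
    simp [latticeBasis]
  by_cases h : ∃ j : b.support, j ≠ ⟨s, hs⟩ ∧ ¬ p ∣ (latticeBasis b).repr w j
  · obtain ⟨j, hj, hw⟩ := h
    refine Or.inl ⟨(latticeBasis b).coord j, ?_, hw⟩
    rw [← hB ⟨s, hs⟩, Module.Basis.coord_apply, Module.Basis.repr_self,
      Finsupp.single_eq_of_ne hj]
  · push Not at h
    refine Or.inr ⟨(latticeBasis b).repr w ⟨s, hs⟩, (latticeBasis b).equivFun.symm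
      (fun j => if j = ⟨s, hs⟩ then 0 else (latticeBasis b).repr w j / p), ?_⟩
    refine (latticeBasis b).ext_elem fun j => ?_
    rw [← hB ⟨s, hs⟩, map_add, map_smul, map_smul, Module.Basis.repr_self]
    have := congrFun ((latticeBasis b).equivFun.apply_symm_apply
      (fun j => if j = ⟨s, hs⟩ then 0 else (latticeBasis b).repr w j / p)) j
    rw [Module.Basis.equivFun_apply] at this
    simp only [Finsupp.add_apply, Finsupp.smul_apply, this, smul_eq_mul]
    by_cases hj : j = ⟨s, hs⟩
    · subst hj; simp
    · rw [if_neg hj, Finsupp.single_eq_of_ne hj, Int.mul_ediv_cancel' (h j hj)]; simp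

theorem abs_pairingIn_le_two {s : ι} (hs : ∀ d, P.pairingIn ℤ d s ≠ -3) (d : ι) :
    -2 ≤ P.pairingIn ℤ d s ∧ P.pairingIn ℤ d s ≤ 2 := by
  have h1 := hs d
  have h2 := hs (P.reflectionPerm d d)
  rw [P.pairingIn_reflectionPerm_self_left] at h2
  have h3 := P.pairingIn_pairingIn_mem_set_of_isCrystal_of_isRed d s
  simp only [Set.mem_insert_iff, Set.mem_singleton_iff, Prod.mk_zero_zero, Prod.mk_eq_zero,
    Prod.mk_one_one, Prod.mk_eq_one, Prod.mk.injEq] at h3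
  omega

/-- If two roots pair to `±1` in both orders, then one is, up to sign, the image of the other under
a product of reflections; hence no root pairs to `-3` with the one if none does with the other. -/
theorem pairingIn_ne_neg_three_of_eq {s i : ι} {ε : ℤ} (hε : ε = 1 ∨ ε = -1)
    (hsi : P.pairingIn ℤ s i = ε) (his : P.pairingIn ℤ i s = ε)
    (hs : ∀ d, P.pairingIn ℤ d s ≠ -3) (d : ι) : P.pairingIn ℤ d i ≠ -3 := by
  have hb := abs_pairingIn_le_two hs
    (P.reflectionPerm i (P.reflectionPerm s d))
  rw [← P.pairingIn_reflectionPerm, ← P.pairingIn_reflectionPerm] at hb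
  have hr : P.root (P.reflectionPerm s (P.reflectionPerm i s)) = -(ε • P.root i) := by
    have h1 : P.pairing s i = ε := by rw [← P.algebraMap_pairingIn ℤ, hsi]; simp
    have h2 : P.pairing i s = ε := by rw [← P.algebraMap_pairingIn ℤ, his]; simp
    rw [P.root_reflectionPerm, P.root_reflectionPerm, P.reflection_apply_root, map_sub, map_smul,
      P.reflection_apply_root, P.reflection_apply_root, P.pairing_same, h1, h2]
    rcases hε with rfl | rfl
    · push_cast; module
    · push_cast; module
  rcases hε with rfl | rfl
  · have : P.reflectionPerm s (P.reflectionPerm i s) = P.reflectionPerm i i := by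
      rw [← P.root_eq_neg_iff, hr, one_smul]
    rw [this, P.pairingIn_reflectionPerm_self_right] at hb
    omega
  · have : P.reflectionPerm s (P.reflectionPerm i s) = i := by
      apply P.root.injective
      rw [hr]; simp
    rw [this] at hb
    omega

variable {k : Type*} [CommRing k] [IsLocalRing k]

/-- In a local ring in which `p` is not invertible, the integers prime to `p` are invertible. -/
theorem isUnit_intCast_of_isCoprime {p n : ℤ} (hp : IsCoprime p n) (h : ¬ IsUnit (p : k)) :
    IsUnit (n : k) := by
  obtain ⟨x, y, hxy⟩ := hp
  have h1 : (x : k) * p + y * n = 1 := by exact_mod_cast congrArg (Int.cast (R := k)) hxy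
  rcases IsLocalRing.isUnit_or_isUnit_of_add_one h1 with h2 | h2
  · exact absurd (isUnit_of_mul_isUnit_right h2) h
  · exact isUnit_of_mul_isUnit_right h2

theorem symCorootRing_coprime (h2 : IsUnit (2 : k)) {i j : ι} (f g : CorootLattice P →ₗ[ℤ] ℤ)
    (h : IsUnit ((f (P.corootSpanMem ℤ i) * g (P.corootSpanMem ℤ j) -
      g (P.corootSpanMem ℤ i) * f (P.corootSpanMem ℤ j) : ℤ) : k)) :
    (symCorootRing P k h2).Coprime i j := fun _ hs => dvd_of_dvd_ofLattice_mul f g h hs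

/-- The coroot of a simple root which is not the short simple root of a `G₂` is coprime to all
coroots that are not proportional to it. The pairings separate the two coroots unless they are congruent up
to sign modulo a nonunit `3`. In that case a form vanishing on the simple coroot separates them,
because otherwise a third of their sum or difference would be an element of the coroot lattice that
pairs to at most `1` with every root. -/
theorem symCorootRing_coprime_of_simple (h2 : IsUnit (2 : k)) {s : ι} (hs : s ∈ b.support)
    (hd : ∀ d, P.pairingIn ℤ d s ≠ -3) {i : ι} (his : i ≠ s) (his' : i ≠ P.reflectionPerm s s) :
    (symCorootRing P k h2).Coprime s i := by
  have h4 : IsUnit (4 : k) := by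
    have := h2.mul h2
    norm_num at this
    exact this
  by_cases hu : IsUnit ((4 - P.pairingIn ℤ i s * P.pairingIn ℤ s i : ℤ) : k)
  · refine symCorootRing_coprime h2 (P.root'In ℤ s) (P.root'In ℤ i) ?_
    simpa using hu
  -- the coroots are proportional modulo a nonunit `3`
  have hset := P.pairingIn_pairingIn_mem_set_of_isCrystal_of_isRed' i s
    (fun h => his (P.root.injective h)) (fun h => his' ((P.root_eq_neg_iff).1 h))
  obtain ⟨ε, hε, hisε, hsiε⟩ : ∃ ε : ℤ, (ε = 1 ∨ ε = -1) ∧ P.pairingIn ℤ i s = ε ∧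
      P.pairingIn ℤ s i = ε := by
    simp only [Set.mem_insert_iff, Set.mem_singleton_iff, Prod.mk.injEq] at hset
    rcases hset with h | h | h | h | h | h | h | h | h | h | h <;> rw [h.1, h.2] at hu
    · exact absurd (by simpa using h4) hu
    · exact ⟨1, Or.inl rfl, h⟩
    · exact ⟨-1, Or.inr rfl, h⟩
    all_goals
      refine absurd ?_ hu
      norm_num [h2]
  have h3 : ¬ IsUnit ((3 : ℤ) : k) := by
    rw [hisε, hsiε] at hu
    rcases hε with rfl | rfl <;> norm_num at hu ⊢ <;> exact hu
  rcases exists_form_or_exists_eq_add b hs (P.corootSpanMem ℤ i) 3 with ⟨g, hg, hgi⟩ | ⟨c, y, hy⟩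
  · refine symCorootRing_coprime h2 (P.root'In ℤ s) g ?_
    rw [hg, zero_mul, sub_zero, P.root'In_corootSpanMem_eq_pairingIn, P.pairingIn_same]
    have h5 : IsCoprime (3 : ℤ) (g (P.corootSpanMem ℤ i)) :=
      (Int.prime_three.coprime_iff_not_dvd).2 hgi
    have := h2.mul (isUnit_intCast_of_isCoprime h5 h3)
    push_cast
    exact this
  · exfalso
    have e1 := congrArg (P.root'In ℤ s) hy
    rw [map_add, map_smul, map_smul, P.root'In_corootSpanMem_eq_pairingIn,
      P.root'In_corootSpanMem_eq_pairingIn, P.pairingIn_same, hsiε, smul_eq_mul, smul_eq_mul] at e1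
    obtain ⟨a, ha⟩ : ∃ a, c = -ε + 3 * a :=
      ⟨(c + ε) / 3, by rcases hε with rfl | rfl <;> omega⟩
    have hy' : (3 : ℤ) • (y + a • P.corootSpanMem ℤ s) =
        P.corootSpanMem ℤ i + ε • P.corootSpanMem ℤ s := by
      rw [hy, ha]; module
    have hz := eq_zero_of_forall_root'In_le_one (y + a • P.corootSpanMem ℤ s) fun d => by
      have e2 := congrArg (P.root'In ℤ d) hy'
      rw [map_smul, map_add (P.root'In ℤ d) (P.corootSpanMem ℤ i), map_smul,
        P.root'In_corootSpanMem_eq_pairingIn,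
        P.root'In_corootSpanMem_eq_pairingIn, smul_eq_mul, smul_eq_mul] at e2
      have e3 := abs_pairingIn_le_two hd d
      have e4 := abs_pairingIn_le_two (pairingIn_ne_neg_three_of_eq hε hsiε hisε hd) d
      rcases hε with rfl | rfl <;> omega
    rw [hz, smul_zero] at hy'
    have e5 := congrArg Subtype.val hy'.symm
    change P.coroot i + ε • P.coroot s = 0 at e5
    rcases hε with rfl | rfl
    · rw [one_smul, add_eq_zero_iff_eq_neg, P.coroot_eq_neg_iff] at e5
      exact his' e5
    · rw [neg_smul, one_smul, ← sub_eq_add_neg, sub_eq_zero] at e5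
      exact his (P.coroot.injective e5)

theorem hasCoprimality_symCorootRing (h2 : IsUnit (2 : k)) :
    (symCorootRing P k h2).HasCoprimality b where
  coprime_of_simple s hs hd i hi hi' := symCorootRing_coprime_of_simple b h2 hs hd hi hi'
  coprime_of_pairing_eq_zero i j h := by
    have h' : P.pairingIn ℤ i j = 0 := by
      apply FaithfulSMul.algebraMap_injective ℤ K
      rw [P.algebraMap_pairingIn, h, map_zero]
    refine symCorootRing_coprime h2 (P.root'In ℤ i) (P.root'In ℤ j) ?_
    have h4 := h2.mul h2
    simp only [P.root'In_corootSpanMem_eq_pairingIn, P.pairingIn_same, h', mul_zero, sub_zero]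
    push_cast
    norm_num at h4 ⊢
    exact h4
  coprime_of_g2 l t h := by
    have h' := pairingIn_eq_neg_one h
    have e1 : P.corootSpanMem ℤ (P.reflectionPerm l t) =
        P.corootSpanMem ℤ l + P.corootSpanMem ℤ t := by
      rw [corootSpanMem_reflectionPerm, h']; module
    have e2 : P.corootSpanMem ℤ (P.reflectionPerm t (P.reflectionPerm l t)) =
        P.corootSpanMem ℤ l + (2 : ℤ) • P.corootSpanMem ℤ t := by
      rw [corootSpanMem_reflectionPerm, ← P.root'In_corootSpanMem_eq_pairingIn (S := ℤ), e1,
        map_add,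
        P.root'In_corootSpanMem_eq_pairingIn, P.root'In_corootSpanMem_eq_pairingIn, h,
        P.pairingIn_same]
      module
    have e4 : P.corootSpanMem ℤ (P.reflectionPerm t l) =
        P.corootSpanMem ℤ l + (3 : ℤ) • P.corootSpanMem ℤ t := by
      rw [corootSpanMem_reflectionPerm, h]; module
    have e3 : P.corootSpanMem ℤ (P.reflectionPerm l (P.reflectionPerm t l)) =
        (2 : ℤ) • P.corootSpanMem ℤ l + (3 : ℤ) • P.corootSpanMem ℤ t := by
      rw [corootSpanMem_reflectionPerm, ← P.root'In_corootSpanMem_eq_pairingIn (S := ℤ), e4,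
        map_add,
        map_smul, P.root'In_corootSpanMem_eq_pairingIn, P.root'In_corootSpanMem_eq_pairingIn, h',
        P.pairingIn_same, smul_eq_mul]
      module
    refine ⟨?_, ?_, ?_, ?_⟩ <;>
      refine symCorootRing_coprime h2 (P.root'In ℤ l) (P.root'In ℤ t) ?_ <;>
      simp only [e1, e2, e3, map_add, map_smul, P.root'In_corootSpanMem_eq_pairingIn, h, h',
        P.pairingIn_same, smul_eq_mul] <;> norm_num [h2]

end Simple

end BruhatGraph

/-! ### Graded modules over the symmetric algebra -/

section Augmentation

variable {k : Type*} {Y : Type*} [CommRing k] [AddCommGroup Y]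

namespace SymRing

/-- The augmentation of the symmetric algebra. -/
def augmentation (k : Type*) (Y : Type*) [CommRing k] [AddCommGroup Y] : SymRing k Y →ₐ[k] k :=
  SymmetricAlgebra.algebraMapInv

theorem augmentation_ofLattice (y : Y) : augmentation k Y (ofLattice k y) = 0 :=
  SymmetricAlgebra.algebraMapInv_ι _

theorem exists_algebraMap_eq {s : SymRing k Y} (hs : s ∈ piece k Y 0) :
    ∃ r, algebraMap k (SymRing k Y) r = s := by
  have h := piece_two_mul k Y 0
  rw [Nat.cast_zero, mul_zero, pow_zero] at h
  rw [h] at hs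
  exact Submodule.mem_one.1 hs

theorem augmentation_eq_zero {n : ℤ} (hn : n ≠ 0) {s : SymRing k Y} (hs : s ∈ piece k Y n) :
    augmentation k Y s = 0 := by
  by_cases h : ∃ d : ℕ, n = 2 * (d : ℤ)
  · obtain ⟨d, rfl⟩ := h
    obtain ⟨d, rfl⟩ := Nat.exists_eq_succ_of_ne_zero (n := d) (by rintro rfl; simp at hn)
    rw [piece_two_mul, pow_succ] at hs
    have hle : LinearMap.range (SymmetricAlgebra.ι k (k ⊗[ℤ] Y)) ^ d *
        LinearMap.range (SymmetricAlgebra.ι k (k ⊗[ℤ] Y)) ≤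
        LinearMap.ker (augmentation k Y).toLinearMap := by
      rw [Submodule.mul_le]
      rintro a - _ ⟨x, rfl⟩
      rw [LinearMap.mem_ker, AlgHom.toLinearMap_apply, map_mul]
      rw [show augmentation k Y (SymmetricAlgebra.ι k _ x) = 0 from
        SymmetricAlgebra.algebraMapInv_ι x, mul_zero]
    exact hle hs
  · rw [piece_eq_bot k Y h, Submodule.mem_bot] at hs
    rw [hs, map_zero]

end SymRing

end Augmentation

namespace GradedMod

universe u v

variable {k : Type u} {Y : Type v} [CommRing k] [AddCommGroup Y]

/-- The homogeneous component of degree `i`. -/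
def component (A : GradedMod k Y) (i : ℤ) (m : A) : A :=
  letI := A.isInternal.chooseDecomposition
  (DirectSum.decompose A.piece m i : A)

theorem component_mem (A : GradedMod k Y) (i : ℤ) (m : A) : A.component i m ∈ A.piece i :=
  letI := A.isInternal.chooseDecomposition
  (DirectSum.decompose A.piece m i).2

theorem component_of_mem {A : GradedMod k Y} {i : ℤ} {m : A} (h : m ∈ A.piece i) :
    A.component i m = m :=
  letI := A.isInternal.chooseDecomposition
  DirectSum.decompose_of_mem_same A.piece h

theorem Hom.map_component {A B : GradedMod k Y} (f : Hom A B) (i : ℤ) (m : A) :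
    f.toLinearMap (A.component i m) = B.component i (f.toLinearMap m) := by
  let _ := A.isInternal.chooseDecomposition
  let _ := B.isInternal.chooseDecomposition
  change f.toLinearMap (DirectSum.decompose A.piece m i : A) =
    (DirectSum.decompose B.piece (f.toLinearMap m) i : B)
  induction m using DirectSum.Decomposition.inductionOn A.piece with
  | zero => simp
  | @homogeneous j m =>
    have h := f.map_mem j m m.2
    by_cases hij : j = i
    · subst hij
      rw [DirectSum.decompose_of_mem_same _ h, DirectSum.decompose_of_mem_same _ m.2]
    · rw [DirectSum.decompose_of_mem_ne _ h hij, DirectSum.decompose_of_mem_ne _ m.2 hij, map_zero]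
  | add a c ha hc =>
    rw [f.toLinearMap.map_add a c, DirectSum.decompose_add, DirectSum.decompose_add,
      DirectSum.add_apply, DirectSum.add_apply, AddSubgroup.coe_add, AddSubgroup.coe_add,
      f.toLinearMap.map_add, ha, hc]

/-- The homomorphism from the symmetric algebra to a graded module given by an element of degree
zero. -/
def ofElement (A : GradedMod k Y) {g : A} (hg : g ∈ A.piece 0) : Hom (self k Y) A where
  toLinearMap := LinearMap.toSpanSingleton (SymRing k Y) A g
  map_mem i s hs := by
    have := A.smul_mem (s := s) (i := i) hs hg
    rwa [add_zero] at this

theorem one_mem_piece_zero : (1 : SymRing k Y) ∈ (self k Y).piece 0 :=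
  (SetLike.GradedOne.one_mem : (1 : SymRing k Y) ∈ SymRing.piece k Y 0)

theorem isProjective_self : (self k Y).IsProjective := by
  intro A B g f hg
  obtain ⟨a, ha⟩ := hg (f.toLinearMap (1 : SymRing k Y))
  refine ⟨A.ofElement (A.component_mem 0 a), LinearMap.ext fun (s : SymRing k Y) => ?_⟩
  change g.toLinearMap (s • A.component 0 a) = f.toLinearMap s
  rw [map_smul, g.map_component, ha,
    component_of_mem (f.map_mem 0 (1 : SymRing k Y) one_mem_piece_zero)]
  exact (f.toLinearMap.map_smul s (1 : SymRing k Y)).symm.trans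
    (congrArg f.toLinearMap (mul_one s))

/-- A graded ideal containing an element with invertible constant term is the unit ideal. -/
theorem eq_top_of_isUnit_augmentation [IsLocalRing k]
    {N : Submodule (SymRing k Y) (self k Y)} (hN : (self k Y).IsGraded N) {n : SymRing k Y}
    (hn : n ∈ N) (h : IsUnit (SymRing.augmentation k Y n)) : N = ⊤ := by
  by_contra hne
  have key : ∀ m ∈ N, SymRing.augmentation k Y m ∈ IsLocalRing.maximalIdeal k := by
    intro m hm
    refine Submodule.span_induction (p := fun m _ => SymRing.augmentation k Y m ∈
      IsLocalRing.maximalIdeal k) ?_ ?_ ?_ ?_ (hN hm)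
    · rintro m ⟨hm, i, hi⟩
      by_cases hi0 : i = 0
      · subst hi0
        obtain ⟨r, rfl⟩ := SymRing.exists_algebraMap_eq hi
        rw [AlgHom.commutes, IsLocalRing.mem_maximalIdeal]
        intro hr
        refine hne ((Ideal.eq_top_iff_one N).2 ?_)
        obtain ⟨r, rfl⟩ := hr
        have := N.smul_mem (algebraMap k _ ((r⁻¹ : kˣ) : k)) hm
        have he : (algebraMap k (SymRing k Y) ((r⁻¹ : kˣ) : k)) • algebraMap k (SymRing k Y) r =
            1 := by
          rw [smul_eq_mul, ← map_mul, Units.inv_mul, map_one]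
        exact he ▸ this
      · rw [SymRing.augmentation_eq_zero hi0 hi]
        exact zero_mem _
    · rw [map_zero]; exact zero_mem _
    · intro a c _ _ ha hc
      rw [map_add]; exact add_mem ha hc
    · intro s a _ ha
      have : SymRing.augmentation k Y (s * a) ∈ IsLocalRing.maximalIdeal k := by
        rw [map_mul]; exact Ideal.mul_mem_left _ _ ha
      exact this
  exact (IsLocalRing.mem_maximalIdeal _).1 (key n hn) h

/-- The quotient of the symmetric algebra by an element of the lattice. -/
def quotient (k : Type u) {Y : Type v} [CommRing k] [AddCommGroup Y] (l : Y) : GradedMod k Y where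
  carrier := SymRing k Y ⧸ Ideal.span {SymRing.ofLattice k l}
  piece i := (SymRing.piece k Y i).toAddSubgroup.map
    (Submodule.mkQ (Ideal.span {SymRing.ofLattice k l})).toAddMonoidHom
  isInternal := by
    classical
    set q := Submodule.mkQ (Ideal.span {SymRing.ofLattice k l})
    refine ⟨?_, ?_⟩
    · rw [injective_iff_map_eq_zero]
      intro x hx
      have hf : ∀ i, ∃ f ∈ SymRing.piece k Y i, q f = x i := fun i => (x i).2
      choose f hfp hfx using hf
      rw [DirectSum.coeAddMonoidHom_eq_dfinsuppSum, DFinsupp.sum] at hx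
      have h1 : q (∑ i ∈ x.support, f i) = 0 := by
        rw [map_sum, ← hx]
        exact Finset.sum_congr rfl fun i _ => hfx i
      obtain ⟨g, hg⟩ := Ideal.mem_span_singleton'.1 ((Submodule.Quotient.mk_eq_zero _).1 h1)
      ext i
      by_cases hi : i ∈ x.support
      swap
      · rw [DFinsupp.notMem_support_iff.1 hi]
        rfl
      have h2 : (DirectSum.decompose (SymRing.piece k Y) (∑ i ∈ x.support, f i) i :
          SymRing k Y) = f i := by
        rw [DirectSum.decompose_sum, DirectSum.sum_apply, Submodule.coe_sum,
          Finset.sum_eq_single i]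
        · exact DirectSum.decompose_of_mem_same _ (hfp i)
        · exact fun j _ hj => DirectSum.decompose_of_mem_ne _ (hfp j) hj
        · exact fun h => absurd hi h
      obtain ⟨j, rfl⟩ : ∃ j, i = 2 + j := ⟨i - 2, by ring⟩
      rw [← hg, mul_comm, SymRing.decompose_ofLattice_mul] at h2
      rw [← hfx, ← h2]
      exact (Submodule.Quotient.mk_eq_zero _).2 (Ideal.mul_mem_right _ _
        (Ideal.mem_span_singleton_self _))
    · intro x
      obtain ⟨s, rfl⟩ := Submodule.mkQ_surjective _ x
      refine ⟨∑ i ∈ (DirectSum.decompose (SymRing.piece k Y) s).support,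
        DirectSum.of _ i ⟨q (DirectSum.decompose (SymRing.piece k Y) s i), _,
          (DirectSum.decompose (SymRing.piece k Y) s i).2, rfl⟩, ?_⟩
      rw [map_sum]
      simp only [DirectSum.coeAddMonoidHom_of]
      rw [← map_sum, DirectSum.sum_support_decompose]
  smul_mem := by
    rintro i j s _ hs ⟨m, hm, rfl⟩
    exact ⟨s * m, SetLike.mul_mem_graded hs hm, rfl⟩
  finite := inferInstance

/-- The projection to the quotient by an element of the lattice. -/
def toQuotient (l : Y) : Hom (self k Y) (quotient k l) where
  toLinearMap := Submodule.mkQ _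
  map_mem _ m hm := ⟨m, hm, rfl⟩

theorem toQuotient_surjective (l : Y) :
    Function.Surjective (toQuotient (k := k) l).toLinearMap := Submodule.mkQ_surjective _

theorem toQuotient_eq_zero_iff (l : Y) (s : SymRing k Y) :
    (toQuotient (k := k) l).toLinearMap s = 0 ↔ SymRing.ofLattice k l ∣ s := by
  rw [← Ideal.mem_span_singleton]
  exact Submodule.Quotient.mk_eq_zero _

theorem ofLattice_smul_quotient (l : Y) (m : quotient k l) : SymRing.ofLattice k l • m = 0 := by
  obtain ⟨s, rfl⟩ := toQuotient_surjective l m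
  rw [← map_smul]
  exact (toQuotient_eq_zero_iff l _).2 (Dvd.intro s rfl)

end GradedMod

/-! ### Canonical sheaves of rank one -/

theorem SymRing.not_ofLattice_dvd_one {k : Type*} {Y : Type*} [CommRing k] [Nontrivial k]
    [AddCommGroup Y] (l : Y) : ¬ SymRing.ofLattice k l ∣ 1 := by
  rintro ⟨s, hs⟩
  have h := congrArg (SymRing.augmentation k Y) hs
  rw [map_mul, SymRing.augmentation_ofLattice, zero_mul, map_one] at h
  exact one_ne_zero h

namespace MomentGraph

universe u v

variable {k : Type u} [CommRing k] {Y : Type v} [AddCommGroup Y] {V : Type*} [PartialOrder V]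
  {G : MomentGraph Y V}

/-- Every family of elements of the symmetric algebra on the vertices above `x` which satisfies the
congruences modulo the labels of the edges between them extends to the vertex `x`. -/
def HasExtensions (k : Type u) [CommRing k] (G : MomentGraph Y V) : Prop :=
  ∀ (x : V) (m : V → SymRing k Y),
    (∀ y z, x < y → ∀ e : G.Edge y z, SymRing.ofLattice k (G.label e) ∣ m y - m z) →
    ∃ u, ∀ y, ∀ e : G.Edge x y, SymRing.ofLattice k (G.label e) ∣ u - m y

/-- The structure sheaf: its stalks are the symmetric algebra, and its modules on the edges are the
quotients by the labels. -/
def structureSheaf (k : Type u) [CommRing k] (G : MomentGraph Y V) : Sheaf k G where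
  stalk _ := GradedMod.self k Y
  edge e := GradedMod.quotient k (G.label e)
  label_smul e m := GradedMod.ofLattice_smul_quotient (G.label e) m
  resSource e := GradedMod.toQuotient (G.label e)
  resTarget e := GradedMod.toQuotient (G.label e)

theorem range_downMap_structureSheaf (hG : HasExtensions k G) (x : V) :
    LinearMap.range ((structureSheaf k G).downMap x) = (structureSheaf k G).boundary x := by
  classical
  apply le_antisymm
  · rintro _ ⟨s, rfl⟩
    exact ⟨fun _ => s, fun _ _ _ => rfl, rfl⟩
  · rintro _ ⟨m, hm, rfl⟩
    obtain ⟨m', hm'⟩ : ∃ m' : V → SymRing k Y, ∀ y (h : x < y), m' y = m ⟨y, h⟩ :=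
      ⟨fun y => if h : x < y then m ⟨y, h⟩ else (0 : SymRing k Y), fun y h => dif_pos h⟩
    obtain ⟨u, hu⟩ := hG x m' fun y z hy e => by
      refine (GradedMod.toQuotient_eq_zero_iff (k := k) (G.label e) _).1
        ((LinearMap.map_sub _ (m' y) (m' z)).trans (sub_eq_zero.2 ?_))
      rw [hm' y hy, hm' z (hy.trans (G.lt_of_edge e))]
      exact hm ⟨y, hy⟩ ⟨z, hy.trans (G.lt_of_edge e)⟩ e
    refine ⟨u, funext fun y => ?_⟩
    have h := (LinearMap.map_sub _ u (m' y.1)).symm.trans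
      ((GradedMod.toQuotient_eq_zero_iff (k := k) (G.label y.2) _).2 (hu y.1 y.2))
    rw [hm' y.1 (G.lt_of_edge y.2)] at h
    exact sub_eq_zero.1 h

theorem isProjectiveCover_structureSheaf [IsLocalRing k] (hG : HasExtensions k G) {x : V}
    (hx : ∃ y, G.Edge x y) :
    ((structureSheaf k G).stalk x).IsProjectiveCover ((structureSheaf k G).downMap x)
      ((structureSheaf k G).boundary x) := by
  refine ⟨range_downMap_structureSheaf hG x, GradedMod.isProjective_self, fun N hN h => ?_⟩
  obtain ⟨y, e⟩ := hx
  have h1 : ∀ m, m ∈ N ⊔ LinearMap.ker ((structureSheaf k G).downMap x) :=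
    fun m => h ▸ Submodule.mem_top
  obtain ⟨n, hn, t, ht, hnt⟩ := Submodule.mem_sup.1 (h1 (1 : SymRing k Y))
  refine GradedMod.eq_top_of_isUnit_augmentation hN hn ?_
  obtain ⟨s, hs⟩ := (GradedMod.toQuotient_eq_zero_iff (G.label e) t).1
    (congrFun (LinearMap.mem_ker.1 ht) ⟨y, e⟩)
  have h2 := congrArg (SymRing.augmentation k Y) hnt
  -- The kernel consists of multiples of the label, on which the augmentation vanishes.
  have h3 : SymRing.augmentation k Y t = 0 := by
    rw [hs, map_mul, SymRing.augmentation_ofLattice, zero_mul]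
  have h4 : SymRing.augmentation k Y n + SymRing.augmentation k Y t = 1 :=
    (map_add (SymRing.augmentation k Y) n t).symm.trans (h2.trans (map_one _))
  rw [h3, add_zero] at h4
  rw [h4]
  exact isUnit_one

/-- The symmetric algebra is an indecomposable graded module. -/
theorem eq_top_or_eq_top_of_isCompl [IsLocalRing k]
    {A B : Submodule (SymRing k Y) (GradedMod.self k Y)} (hA : (GradedMod.self k Y).IsGraded A)
    (hB : (GradedMod.self k Y).IsGraded B) (h : IsCompl A B) : A = ⊤ ∨ B = ⊤ := by
  have h1 : ∀ m, m ∈ A ⊔ B := fun m => h.sup_eq_top ▸ Submodule.mem_top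
  obtain ⟨a, ha, c, hc, hac⟩ := Submodule.mem_sup.1 (h1 (1 : SymRing k Y))
  have h2 : SymRing.augmentation k Y a + SymRing.augmentation k Y c = 1 :=
    (map_add (SymRing.augmentation k Y) a c).symm.trans
      ((congrArg (SymRing.augmentation k Y) hac).trans (map_one _))
  exact (IsLocalRing.isUnit_or_isUnit_of_add_one h2).imp
    (GradedMod.eq_top_of_isUnit_augmentation hA ha)
    (GradedMod.eq_top_of_isUnit_augmentation hB hc)

/-- The two ends of an edge belong to the same summand of the structure sheaf, since the class of
`1` on the edge cannot lie in both summands. -/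
theorem stalk_eq_top_of_edge [IsLocalRing k] {A B : (structureSheaf k G).Subsheaf}
    (h : A.IsDecomposition B) {x y : V} (e : G.Edge x y) (hy : A.stalk y = ⊤) :
    A.stalk x = ⊤ := by
  have htop : A.stalk x = ⊤ ∨ B.stalk x = ⊤ :=
    eq_top_or_eq_top_of_isCompl (A.stalk_graded x) (B.stalk_graded x) (h.1 x)
  refine htop.resolve_right fun hx => ?_
  have hA := A.resTarget_mem e (1 : SymRing k Y) (by rw [hy]; exact Submodule.mem_top)
  have hB := B.resSource_mem e (1 : SymRing k Y) (by rw [hx]; exact Submodule.mem_top)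
  have h0 := (Submodule.disjoint_def.1 (h.2 x y e).disjoint) _ hA hB
  exact SymRing.not_ofLattice_dvd_one _ ((GradedMod.toQuotient_eq_zero_iff (G.label e) _).1 h0)

section Ranked

variable {w : V} {r : V → ℕ}

theorem isZero_of_stalk_eq_top [IsLocalRing k] (hr : ∀ {x y}, x < y → r y < r x)
    (hsrc : ∀ x, x ≠ w → ∃ y, G.Edge x y) {A B : (structureSheaf k G).Subsheaf}
    (h : A.IsDecomposition B) (hw : A.stalk w = ⊤) : B.IsZero := by
  have key : ∀ n x, r x < n → A.stalk x = ⊤ := by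
    intro n
    induction n with
    | zero => exact fun x hx => absurd hx (Nat.not_lt_zero _)
    | succ n ih =>
      intro x hx
      by_cases hxw : x = w
      · rw [hxw, hw]
      · obtain ⟨y, e⟩ := hsrc x hxw
        exact stalk_eq_top_of_edge h e (ih y (by have := hr (G.lt_of_edge e); omega))
  have hA : ∀ x, A.stalk x = ⊤ := fun x => key _ x (Nat.lt_succ_self _)
  refine ⟨fun x => ?_, fun x y e => ?_⟩
  · have := (h.1 x).disjoint
    rwa [hA, top_disjoint] at this
  · have hAe : A.edge e = ⊤ := eq_top_iff.2 fun m _ => by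
      obtain ⟨s, rfl⟩ := GradedMod.toQuotient_surjective (k := k) (G.label e) m
      exact A.resTarget_mem e s (hA y ▸ Submodule.mem_top)
    have := (h.2 x y e).disjoint
    rwa [hAe, top_disjoint] at this

theorem isCanonical_structureSheaf [IsLocalRing k] (hG : HasExtensions k G)
    (hr : ∀ {x y}, x < y → r y < r x) (hsrc : ∀ x, x ≠ w → ∃ y, G.Edge x y) :
    (structureSheaf k G).IsCanonical w where
  isIndecomposable := by
    refine ⟨fun h => ?_, fun A B h => ?_⟩
    · have : Subsingleton (SymRing k Y) := h.1 w
      refine SymRing.not_ofLattice_dvd_one (k := k) (0 : Y) ⟨1, Subsingleton.elim _ _⟩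
    · have h' : B.IsDecomposition A := ⟨fun x => (h.1 x).symm, fun x y e => (h.2 x y e).symm⟩
      exact (eq_top_or_eq_top_of_isCompl (A.stalk_graded w) (B.stalk_graded w) (h.1 w)).symm.imp
        (isZero_of_stalk_eq_top hr hsrc h') (isZero_of_stalk_eq_top hr hsrc h)
  stalk_top := ⟨LinearEquiv.refl _ _, fun _ _ => Iff.rfl⟩
  resTarget_surjective e := GradedMod.toQuotient_surjective (G.label e)
  ker_resTarget e m := GradedMod.toQuotient_eq_zero_iff (G.label e) m
  isProjectiveCover _ hx := isProjectiveCover_structureSheaf hG hx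

end Ranked

namespace Sheaf

/-- The elements `g` of the stalks form a compatible system of generators at the vertex `x`: `g x`
is a free homogeneous generator, glued to `g y` along every edge from `x` to `y`. -/
structure IsGenerator (F : Sheaf k G) (g : ∀ x, F.stalk x) (x : V) : Prop where
  mem : g x ∈ (F.stalk x).piece 0
  bijective : Function.Bijective fun s : SymRing k Y => s • g x
  compatible : ∀ {y} (e : G.Edge x y),
    (F.resSource e).toLinearMap (g x) = (F.resTarget e).toLinearMap (g y)

variable {F : Sheaf k G} {w : V} {g : ∀ x, F.stalk x} {x : V}

theorem IsGenerator.ker_resTarget (hF : F.IsCanonical w) {y z : V} (hg : F.IsGenerator g z)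
    (e : G.Edge y z) (s : SymRing k Y) :
    (F.resTarget e).toLinearMap (s • g z) = 0 ↔ SymRing.ofLattice k (G.label e) ∣ s := by
  rw [hF.ker_resTarget]
  constructor
  · rintro ⟨n, hn⟩
    obtain ⟨t, rfl⟩ := hg.bijective.2 n
    refine ⟨t, hg.bijective.1 ?_⟩
    exact hn.trans (mul_smul _ _ _).symm
  · rintro ⟨t, rfl⟩
    exact ⟨t • g z, mul_smul _ _ _⟩

/-- If the stalks above `x` are free of rank one with compatible generators, the sections above `x`
are families of elements of the symmetric algebra satisfying congruences; when such families extend,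
the boundary module at `x` is generated by the family of generators. -/
theorem exists_eq_smul_of_mem_boundary (hG : HasExtensions k G) (hF : F.IsCanonical w)
    (hg : ∀ y, x < y → F.IsGenerator g y) {t : ∀ y : {y : V // G.Edge x y}, F.edge y.2}
    (ht : t ∈ F.boundary x) :
    ∃ s : SymRing k Y, t = s • F.upMap x fun y => g y := by
  classical
  obtain ⟨m, hm, rfl⟩ := ht
  obtain ⟨f, hf⟩ : ∃ f : V → SymRing k Y, ∀ y (h : x < y), m ⟨y, h⟩ = f y • g y := by
    have h : ∀ y, ∃ s : SymRing k Y, ∀ h : x < y, m ⟨y, h⟩ = s • g y := fun y => by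
      by_cases hy : x < y
      · obtain ⟨s, hs⟩ := (hg y hy).bijective.2 (m ⟨y, hy⟩)
        exact ⟨s, fun _ => hs.symm⟩
      · exact ⟨0, fun h => absurd h hy⟩
    choose f hf using h
    exact ⟨f, hf⟩
  obtain ⟨u, hu⟩ := hG x f fun y z hy e => by
    have hz := hy.trans (G.lt_of_edge e)
    have h := hm ⟨y, hy⟩ ⟨z, hz⟩ e
    rw [hf y hy, hf z hz, map_smul, (hg y hy).compatible e, ← map_smul] at h
    rw [← (hg z hz).ker_resTarget hF e, sub_smul, map_sub, h, sub_self]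
  refine ⟨u, funext fun y => ?_⟩
  have hy := G.lt_of_edge y.2
  have h := ((hg y.1 hy).ker_resTarget hF y.2 _).2 (hu y.1 y.2)
  rw [sub_smul, map_sub, sub_eq_zero, ← hf y.1 hy, map_smul] at h
  exact h.symm

/-- The inductive step of the uniqueness: a system of generators above `x` extends to `x`. The
family of generators is a section above `x`; a lift of it to the stalk at `x` generates because the
cover is essential, and is free because the stalk is projective. -/
theorem exists_generator (hG : HasExtensions k G) [IsLocalRing k] (hF : F.IsCanonical w)
    (hg : ∀ y, x < y → F.IsGenerator g y) (hx : ∃ y, G.Edge x y) :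
    ∃ γ : F.stalk x, γ ∈ (F.stalk x).piece 0 ∧ Function.Bijective (fun s : SymRing k Y => s • γ) ∧
      ∀ {y} (e : G.Edge x y),
        (F.resSource e).toLinearMap γ = (F.resTarget e).toLinearMap (g y) := by
  obtain ⟨hrange, hproj, hess⟩ := hF.isProjectiveCover x hx
  obtain ⟨c, hc⟩ : F.upMap x (fun y => g y) ∈ LinearMap.range (F.downMap x) := by
    rw [hrange]
    exact ⟨_, fun y z e => (hg y y.2).compatible e, rfl⟩
  set γ := (F.stalk x).component 0 c with hγ_def
  have hγ : γ ∈ (F.stalk x).piece 0 := (F.stalk x).component_mem 0 c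
  have hγe : ∀ {y} (e : G.Edge x y),
      (F.resSource e).toLinearMap γ = (F.resTarget e).toLinearMap (g y) := by
    intro y e
    have h : (F.resSource e).toLinearMap c = (F.resTarget e).toLinearMap (g y) :=
      congrFun hc ⟨y, e⟩
    rw [hγ_def, GradedMod.Hom.map_component, h]
    exact GradedMod.component_of_mem ((F.resTarget e).map_mem 0 _ (hg y (G.lt_of_edge e)).mem)
  have hdown : F.downMap x γ = F.upMap x fun y => g y := funext fun y => hγe y.2
  have hspan : Submodule.span (SymRing k Y) {γ} = ⊤ := by
    refine hess _ ?_ ?_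
    · rw [GradedMod.IsGraded, Submodule.span_singleton_le_iff_mem]
      exact Submodule.subset_span ⟨Submodule.mem_span_singleton_self _, 0, hγ⟩
    · refine eq_top_iff.2 fun m _ => ?_
      obtain ⟨s, hs⟩ := exists_eq_smul_of_mem_boundary hG hF hg
        (hrange ▸ LinearMap.mem_range_self (F.downMap x) m)
      refine Submodule.mem_sup.2 ⟨s • γ, Submodule.smul_mem _ _
        (Submodule.mem_span_singleton_self _), m - s • γ, ?_, add_sub_cancel _ _⟩
      rw [LinearMap.mem_ker, map_sub, map_smul, hdown, hs, sub_self]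
  have hsurj : ∀ m : F.stalk x, ∃ s : SymRing k Y, s • γ = m := fun m =>
    Submodule.mem_span_singleton.1 (hspan ▸ Submodule.mem_top)
  refine ⟨γ, hγ, ⟨?_, hsurj⟩, hγe⟩
  obtain ⟨h, hh⟩ := hproj _ _ (GradedMod.ofElement _ hγ) ⟨LinearMap.id, fun _ _ => id⟩ hsurj
  obtain ⟨a, ha⟩ : ∃ a : SymRing k Y, a = h.toLinearMap γ := ⟨_, rfl⟩
  have haγ : a • γ = γ := by rw [ha]; exact LinearMap.congr_fun hh γ
  have hmul : ∀ s : SymRing k Y, h.toLinearMap (s • γ) = s * a := fun s => by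
    rw [map_smul, ha]; rfl
  have haa : a * a = a := by rw [← hmul, haγ, ha]
  obtain ⟨c, hca⟩ := SymRing.exists_algebraMap_eq (s := a) (ha ▸ h.map_mem 0 γ hγ)
  have hcc : c * c = c := by
    have := congrArg (SymRing.augmentation k Y) haa
    rwa [← hca, map_mul, AlgHom.commutes] at this
  -- A local ring has no idempotents besides `0` and `1`.
  have h1 : a = 1 := by
    rcases IsLocalRing.isUnit_or_isUnit_of_add_one (add_sub_cancel c 1) with hu | hu
    · rw [← hca, hu.mul_left_cancel (hcc.trans (mul_one c).symm), map_one]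
    · exfalso
      have hc0 : c = 0 := hu.mul_left_cancel (by rw [sub_mul, one_mul, hcc, sub_self, mul_zero])
      rw [← hca, hc0, map_zero, zero_smul] at haγ
      obtain ⟨y, e⟩ := hx
      have h0 := hγe e
      rw [← haγ, map_zero, ← one_smul (SymRing k Y) (g y)] at h0
      exact SymRing.not_ofLattice_dvd_one _
        (((hg y (G.lt_of_edge e)).ker_resTarget hF e 1).1 h0.symm)
  intro s t hst
  have := congrArg h.toLinearMap hst
  rwa [hmul, hmul, h1, mul_one, mul_one] at this

theorem exists_isGenerator {r : V → ℕ} (hr : ∀ {x y}, x < y → r y < r x)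
    (hsrc : ∀ x, x ≠ w → ∃ y, G.Edge x y) (hw : ∀ x, x ≤ w) (hG : HasExtensions k G)
    [IsLocalRing k] (hF : F.IsCanonical w) (n : ℕ) :
    ∃ g : ∀ x, F.stalk x, ∀ x, r x < n → F.IsGenerator g x := by
  classical
  induction n with
  | zero => exact ⟨fun _ => 0, fun x hx => absurd hx (Nat.not_lt_zero _)⟩
  | succ n ih =>
    obtain ⟨g, hg⟩ := ih
    have hstep : ∀ x, r x = n → ∃ γ : F.stalk x, γ ∈ (F.stalk x).piece 0 ∧
        Function.Bijective (fun s : SymRing k Y => s • γ) ∧ ∀ {y} (e : G.Edge x y),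
          (F.resSource e).toLinearMap γ = (F.resTarget e).toLinearMap (g y) := by
      intro x hx
      by_cases hxw : x = w
      · subst hxw
        obtain ⟨e, he⟩ := hF.stalk_top
        refine ⟨e.symm (1 : SymRing k Y), (he 0 _).2 ?_, ?_, fun {y} e' =>
          absurd (G.lt_of_edge e') (hw y).not_gt⟩
        · exact (e.apply_symm_apply (1 : SymRing k Y)).symm ▸ GradedMod.one_mem_piece_zero
        · have h1 : (fun s : SymRing k Y => s • e.symm (1 : SymRing k Y)) = e.symm := by
            funext s
            exact (e.symm.map_smul s (1 : SymRing k Y)).symm.trans (congrArg e.symm (mul_one s))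
          rw [h1]
          exact e.symm.bijective
      · exact exists_generator hG hF (fun y hy => hg y (by have := hr hy; omega)) (hsrc x hxw)
    choose γ hγ using hstep
    refine ⟨fun x => if h : r x = n then γ x h else g x, fun x hx => ?_⟩
    have hlt : ∀ {y}, G.Edge x y → ¬ r y = n := fun e => by
      have := hr (G.lt_of_edge e); omega
    by_cases h : r x = n
    · obtain ⟨h1, h2, h3⟩ := hγ x h
      refine ⟨?_, ?_, fun e => ?_⟩
      · rwa [dif_pos h]
      · simpa only [dif_pos h] using h2
      · rw [dif_pos h, dif_neg (hlt e)]
        exact h3 e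
    · obtain ⟨h1, h2, h3⟩ := hg x (by omega)
      refine ⟨?_, ?_, fun e => ?_⟩
      · rwa [dif_neg h]
      · simpa only [dif_neg h] using h2
      · rw [dif_neg h, dif_neg (hlt e)]
        exact h3 e

theorem IsGenerator.isomorphic (hg : F.IsGenerator g x) :
    (F.stalk x).Isomorphic (GradedMod.self k Y) := by
  let f := GradedMod.ofElement (F.stalk x) hg.mem
  have hf : Function.Bijective f.toLinearMap := hg.bijective
  refine ⟨(LinearEquiv.ofBijective f.toLinearMap hf).symm, fun i m => ?_⟩
  obtain ⟨s, rfl⟩ := hf.2 m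
  rw [show (LinearEquiv.ofBijective f.toLinearMap hf).symm (f.toLinearMap s) = s from
    (LinearEquiv.ofBijective f.toLinearMap hf).symm_apply_apply s]
  refine ⟨fun h => ?_, f.map_mem i s⟩
  have h1 := f.map_component i s
  rw [GradedMod.component_of_mem h] at h1
  exact hf.1 h1 ▸ (GradedMod.self k Y).component_mem i s

theorem IsCanonical.stalk_isomorphic [IsLocalRing k] {r : V → ℕ}
    (hr : ∀ {x y}, x < y → r y < r x)
    (hsrc : ∀ x, x ≠ w → ∃ y, G.Edge x y) (hw : ∀ x, x ≤ w) (hG : HasExtensions k G)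
    (hF : F.IsCanonical w) (x : V) : (F.stalk x).Isomorphic (GradedMod.self k Y) := by
  obtain ⟨g, hg⟩ := exists_isGenerator hr hsrc hw hG hF (r x + 1)
  exact (hg x (Nat.lt_succ_self _)).isomorphic

end Sheaf

end MomentGraph

/-! ### The structure sheaf of the Bruhat graph -/

namespace BruhatGraph

variable {ι K M N : Type*} [Finite ι] [Field K] [CharZero K] [AddCommGroup M] [Module K M]
  [AddCommGroup N] [Module K N] {P : RootPairing ι K M N} [P.IsRootSystem] [P.IsCrystallographic]
  [P.IsReduced] {b : P.Base}

theorem lt_refl_mul {x : Weyl b} {i : ι} (h : length b x < length b (refl b i * x)) :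
    x < refl b i * x :=
  lt_of_le_of_ne (Relation.ReflTransGen.single ⟨h, i, rfl⟩) fun h0 => by
    rw [← h0] at h; exact h.false

theorem edge_refl_mul {x : Weyl b} {i : ι} (h : x < refl b i * x) :
    (bruhatGraph b).Edge x (refl b i * x) := by
  refine ⟨h, ?_⟩
  by_cases hi : b.IsPos i
  · exact ⟨i, hi, by rw [mul_inv_cancel_right]⟩
  · exact ⟨P.reflectionPerm i i, (isPos_reflectionPerm_self b i).2 hi, by
      rw [mul_inv_cancel_right, refl_reflectionPerm_self]⟩

variable {k : Type*} [CommRing k]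

theorem label_dvd_iff (h2 : IsUnit (2 : k)) {x y : Weyl b} (e : (bruhatGraph b).Edge x y) {i : ι}
    (hi : y = refl b i * x) (f : SymRing k (CorootLattice P)) :
    SymRing.ofLattice k ((bruhatGraph b).label e) ∣ f ↔ (symCorootRing P k h2).c i ∣ f := by
  refine CorootRing.c_dvd_iff_of_eq_or_neg (symCorootRing P k h2) (i := e.2.choose)
    (eq_or_neg_of_refl_eq (b := b) ?_) f
  rw [← e.2.choose_spec.2, hi, mul_inv_cancel_right]

theorem hasExtensions_bruhatGraph [IsLocalRing k] (h2 : IsUnit (2 : k)) {w₀ : Weyl b}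
    (hw₀ : ∀ w, length b w ≤ length b w₀) :
    ((bruhatGraph b).restrict (Set.Iic w₀)).HasExtensions k := by
  intro x m hm
  have hle := le_longest b hw₀
  obtain ⟨u, hu⟩ := exists_extension (hasCoprimality_symCorootRing b h2)
    SymRing.exists_mem_degreeLE x.1 (fun y => m ⟨y, hle y⟩) (by
      intro y hy i hiy
      rcases (length_ne b y i).lt_or_gt with h | h
      · have hlt : refl b i * y < refl b i * (refl b i * y) :=
          lt_refl_mul (by rwa [refl_mul_cancel_left])
        have e := edge_refl_mul hlt
        rw [refl_mul_cancel_left] at e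
        rw [CorootRing.dvd_sub_comm]
        exact (label_dvd_iff h2 e (refl_mul_cancel_left b i y).symm _).1
          (hm ⟨_, hle _⟩ ⟨y, hle y⟩ hiy e)
      · have e := edge_refl_mul (lt_refl_mul h)
        exact (label_dvd_iff h2 e rfl _).1 (hm ⟨y, hle y⟩ ⟨_, hle _⟩ hy e))
  refine ⟨u, fun y e => ?_⟩
  obtain ⟨i, -, hi⟩ := e.2
  have hy : y.1 = refl b i * x.1 := by rw [← hi, inv_mul_cancel_right]
  refine (label_dvd_iff h2 e hy _).2 ?_
  have h := hu i (hy ▸ e.1)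
  rwa [show (⟨refl b i * x.1, hle _⟩ : Set.Iic w₀) = y from Subtype.ext hy.symm] at h

theorem exists_edge_of_ne {w₀ : Weyl b} (hw₀ : ∀ w, length b w ≤ length b w₀)
    (x : Set.Iic w₀) (hx : x ≠ ⟨w₀, Set.mem_Iic.mpr le_rfl⟩) :
    ∃ y, ((bruhatGraph b).restrict (Set.Iic w₀)).Edge x y := by
  obtain ⟨s, -, h⟩ := exists_simple_ascent b hw₀ (x := x.1) fun h => hx (Subtype.ext h)
  exact ⟨⟨refl b s * x.1, le_longest b hw₀ _⟩, edge_refl_mul (lt_refl_mul h)⟩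

theorem length_lt_of_lt {x y : Weyl b} (h : x < y) : length b x < length b y :=
  (BruhatLE.eq_or_length_lt b h.le).resolve_left h.ne

end BruhatGraph

theorem mainTheorem5 {ι K M N : Type*} [Finite ι] [Field K] [CharZero K]
    [AddCommGroup M] [Module K M] [AddCommGroup N] [Module K N]
    (P : RootPairing ι K M N) [P.IsRootSystem] [P.IsCrystallographic] [P.IsReduced] (b : P.Base)
    (w₀ : BruhatGraph.Weyl b)
    (hw₀ : ∀ w : BruhatGraph.Weyl b, BruhatGraph.length b w ≤ BruhatGraph.length b w₀)
    (k : Type*) [CommRing k] [IsLocalRing k] (h2 : IsUnit (2 : k)) :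
    (∃ B : MomentGraph.Sheaf k ((BruhatGraph.bruhatGraph b).restrict (Set.Iic w₀)),
      B.IsCanonical ⟨w₀, Set.mem_Iic.mpr le_rfl⟩) ∧
    ∀ B : MomentGraph.Sheaf k ((BruhatGraph.bruhatGraph b).restrict (Set.Iic w₀)),
      B.IsCanonical ⟨w₀, Set.mem_Iic.mpr le_rfl⟩ →
      ∀ y : BruhatGraph.Weyl b, ∃ hy : y ≤ w₀,
        (B.stalk ⟨y, hy⟩).Isomorphic
          (GradedMod.self k (BruhatGraph.CorootLattice P)) := by
  have hr : ∀ {x y : Set.Iic w₀}, x < y → BruhatGraph.length b w₀ - BruhatGraph.length b y.1 <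
      BruhatGraph.length b w₀ - BruhatGraph.length b x.1 := fun {x y} h => by
    have h1 := BruhatGraph.length_lt_of_lt (Subtype.coe_lt_coe.2 h)
    have h3 := hw₀ y
    omega
  have hG := BruhatGraph.hasExtensions_bruhatGraph h2 hw₀
  have hsrc := BruhatGraph.exists_edge_of_ne hw₀
  exact ⟨⟨_, MomentGraph.isCanonical_structureSheaf hG hr hsrc⟩, fun B hB y =>
    ⟨BruhatGraph.le_longest b hw₀ y, hB.stalk_isomorphic hr hsrc (fun x => x.2) hG _⟩⟩

end
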